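/- **Setting.** Let $Y=\{y_1<\dots<y_n\}\subset\mathbb R$ be finite, $H^1(\mathbb R\setminus Y)=\{f\in L^2(\mathbb R): f'\in L^2(\mathbb R)\}$ with $f'$ the distributional derivative on $\mathbb R\setminus Y$, and $H^2(\mathbb R\setminus Y)=\{f\in H^1(\mathbb R\setminus Y): f'\in H^1(\mathbb R\setminus Y)\}$. For $f\in H^1(\mathbb R\setminus Y)$ put $[f]_{y}=f(y^+)-f(y^-)$, $\langle f\rangle_y=\frac12(f(y^-)+f(y^+))$. For $\Psi=(\psi_1,\psi_2)\in H^1(\mathbb R\setminus Y;\mathbb C^2)$ put $\tau\Psi=(\langle\Psi\rangle_{y_k})_{k}\in\mathbb C^{2n}$ and $\rho\Psi=(i\sigma_1[\Psi]_{y_k})_k\in\mathbb C^{2n}$. Given an orthogonal projector $\Pi$ in $\mathbb C^{2n}$ and a symmetric operator $\Theta$ in $\mathrm{ran}(\Pi)$, let $\mathsf D_{\Pi,\Theta}$ be the operator $-i\sigma_1\frac{d}{dx}+\frac12\sigma_3$ in $L^2(\mathbb R;\mathbb C^2)$, the derivative being taken on $\mathbb R\setminus Y$, with domain $\{\Psi\in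 H^1(\mathbb R\setminus Y;\mathbb C^2):\rho\Psi\in\mathrm{ran}(\Pi),\ \Pi\tau\Psi=\Theta\rho\Psi\}$. Likewise, given an orthogonal projector $\widehat\Pi$ in $\mathbb C^{4n}$ and a symmetric operator $\widehat\Theta$ in $\mathrm{ran}(\widehat\Pi)$, let $\widehat{\mathsf H}_{\widehat\Pi,\widehat\Theta}$ be $\Psi\mapsto-\Psi''$ (derivatives on $\mathbb R\setminus Y$) in $L^2(\mathbb R;\mathbb C^2)$ with domain $\{\Psi\in H^2(\mathbb R\setminus Y;\mathbb C^2):\widehat\rho\Psi\in\mathrm{ran}(\widehat\Pi),\ \widehat\Pi\widehat\tau\Psi=\widehat\Theta\widehat\rho\Psi\}$, where $\widehat\rho\Psi$ and $\widehat\tau\Psi$ collect the values $[\psi_c']_{y_k}\oplus[-\psi_c]_{y_k}$ and $\langle\psi_c\rangle_{y_k}\oplus\langle\psi_c'\rangle_{y_k}$, $c=1,2$, $1\le k\le n$. Equalities of operators include equality of domains; squares and sums have their natural domains. **(1) Decoupled boundary conditions.** Suppose that there are linear operators $B_j:H^1(\mathbb R\setminus Y)\to\mathbb C^{d_j}$,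 $j=1,2$, such that for all $\Psi=(\psi_1,\psi_2)\in H^1(\mathbb R\setminus Y;\mathbb C^2)$ the conditions $\rho\Psi\in\mathrm{ran}(\Pi)$, $\Pi\tau\Psi=\Theta\rho\Psi$ hold if and only if $B_1(\psi_1)=0$ and $B_2(\psi_2)=0$. Let $\mathsf H_{j,k}\psi=-\psi''$ (derivatives on $\mathbb R\setminus Y$) in $L^2(\mathbb R)$ with domain $\{\psi\in H^2(\mathbb R\setminus Y): B_j(\psi)=0,\ B_k(\psi')=0\}$, for $(j,k)=(1,2),(2,1)$. Then $\mathsf D_{\Pi,\Theta}$, $\mathsf H_{1,2}$ and $\mathsf H_{2,1}$ are self-adjoint and $$(\mathsf D_{\Pi,\Theta})^2=\left(\mathsf H_{1,2}+\tfrac14\right)\oplus\left(\mathsf H_{2,1}+\tfrac14\right).$$ Moreover there is a couple $(\widehat\Pi,\widehat\Theta)$ with $(\mathsf D_{\Pi,\Theta})^2=\widehat{\mathsf H}_{\widehat\Pi,\widehat\Theta}+\frac14$ and $\widehat{\mathsf H}_{\widehat\Pi,\widehat\Theta}=\mathsf H_{1,2}\oplus\mathsf H_{2,1}$. **(2) The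 eye graph.** Let $n=3$. Call (C) the conditions $f(y_1^-)=f(y_1^+)=f(y_2^+)$, $f(y_2^-)=f(y_3^-)=f(y_3^+)$ and (F) the conditions $f(y_1^-)-f(y_1^+)-f(y_2^+)=0$, $f(y_2^-)+f(y_3^-)-f(y_3^+)=0$. Let $\mathsf D_{\rm K}$ be $-i\sigma_1\frac{d}{dx}+\frac12\sigma_3$ (derivative on $\mathbb R\setminus Y$) on those $\Psi\in H^1(\mathbb R\setminus Y;\mathbb C^2)$ for which $\psi_1$ satisfies (C) and $\psi_2$ satisfies (F). Let $\mathsf H_{\rm K}$ (resp. $\mathsf H_{{\rm K}_*}$) be $\psi\mapsto-\psi''$ (derivatives on $\mathbb R\setminus Y$) on those $\psi\in H^2(\mathbb R\setminus Y)$ for which $\psi$ satisfies (C) and $\psi'$ satisfies (F) (resp. $\psi'$ satisfies (C) and $\psi$ satisfies (F)). Then $\mathsf D_{\rm K}=\mathsf D_{\Pi,\Theta}$, where $$\Pi=\frac13\begin{bmatrix}2&0&-1&0&-1&0\\0&0&0&0&0&0\\-1&0&2&0&-1&0\\0&0&0&3&0&0\\-1&0&-1&0&2&0\\0&0&0&0&0&0\end{bmatrix}$$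 is an orthogonal projector and $\Theta$ is the restriction to $\mathrm{ran}(\Pi)$, which it preserves, of $$\frac i2\begin{bmatrix}0&0&0&-1&0&0\\0&0&0&0&0&0\\0&0&0&0&0&0\\1&0&0&0&-1&0\\0&0&0&1&0&0\\0&0&0&0&0&0\end{bmatrix};$$ the operators $\mathsf D_{\rm K}$, $\mathsf H_{\rm K}$, $\mathsf H_{{\rm K}_*}$ are self-adjoint, and $$(\mathsf D_{\rm K})^2=\left(\mathsf H_{\rm K}+\tfrac14\right)\oplus\left(\mathsf H_{{\rm K}_*}+\tfrac14\right).$$ **(3) Any finite metric graph.** Let $G$ be a metric graph with finitely many edges, each a bounded or unbounded open interval, every finite end of an edge being attached to a vertex. Let $L^2(G)$, $H^1(G)$, $H^2(G)$ be the direct sums over the edges of the corresponding spaces, with edgewise derivatives. Say that $f$ is continuous at the vertex $v$ if its boundary values at all endpoints attached to $v$ agree, and let $\sum_v^{\pm}f(v)$ be the sum of its boundary values at the endpoints attached to $v$, with sign $-$ at left ends and $+$ at right ends of edges. Let $\mathsf D_{\rm K}$ be $-i\sigma_1\frac{d}{dx}+\frac12\sigma_3$ on those $\Psi\in H^1(G;\mathbb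 C^2)$ with $\psi_1$ continuous at every vertex and $\sum_v^\pm\psi_2(v)=0$ for every vertex $v$. Let $\mathsf H_{\rm K}$ (resp. $\mathsf H_{{\rm K}_*}$) be $\psi\mapsto-\psi''$ on those $\psi\in H^2(G)$ with $\psi$ continuous at every vertex and $\sum_v^\pm\psi'(v)=0$ for every $v$ (resp. $\psi'$ continuous at every vertex and $\sum_v^\pm\psi(v)=0$ for every $v$). Then $\mathsf D_{\rm K}$, $\mathsf H_{\rm K}$, $\mathsf H_{{\rm K}_*}$ are self-adjoint and $(\mathsf D_{\rm K})^2=\left(\mathsf H_{\rm K}+\frac14\right)\oplus\left(\mathsf H_{{\rm K}_*}+\frac14\right)$. -/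

import Mathlib

open MeasureTheory Filter Topology TopologicalSpace
open scoped ContDiff ENNReal

noncomputable section

namespace QGraph

/-! ### Unbounded operators on Hilbert spaces

An (unbounded) linear operator in `𝓗` is a `𝓗 →ₗ.[ℂ] 𝓗`; equality of two such operators means
equality of domains and of actions. -/

section Operators

variable {𝓗 : Type*} [NormedAddCommGroup 𝓗] [InnerProductSpace ℂ 𝓗]

/-- The Hilbert space `𝓗 ⊕ 𝓗`, whose elements `Ψ = (ψ₁, ψ₂)` are the two-component spinors. -/
abbrev Spinor (𝓗 : Type*) [NormedAddCommGroup 𝓗] [InnerProductSpace ℂ 𝓗] : Type _ :=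
  WithLp 2 (𝓗 × 𝓗)

/-- The product `A B`, with its natural domain `{x ∈ dom B : B x ∈ dom A}`. -/
def opComp (A B : 𝓗 →ₗ.[ℂ] 𝓗) : 𝓗 →ₗ.[ℂ] 𝓗 where
  domain :=
    { carrier := {x | ∃ h : x ∈ B.domain, B ⟨x, h⟩ ∈ A.domain}
      zero_mem' := ⟨B.domain.zero_mem, by
        have : B ⟨0, B.domain.zero_mem⟩ = 0 := B.map_zero
        rw [this]; exact A.domain.zero_mem⟩
      add_mem' := by
        rintro x y ⟨hx, hx'⟩ ⟨hy, hy'⟩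
        refine ⟨B.domain.add_mem hx hy, ?_⟩
        have : B ⟨x + y, B.domain.add_mem hx hy⟩ = B ⟨x, hx⟩ + B ⟨y, hy⟩ :=
          B.map_add ⟨x, hx⟩ ⟨y, hy⟩
        rw [this]; exact A.domain.add_mem hx' hy'
      smul_mem' := by
        rintro c x ⟨hx, hx'⟩
        refine ⟨B.domain.smul_mem c hx, ?_⟩
        have : B ⟨c • x, B.domain.smul_mem c hx⟩ = c • B ⟨x, hx⟩ := B.map_smul c ⟨x, hx⟩
        rw [this]; exact A.domain.smul_mem c hx' }
  toFun :=
    { toFun := fun x => A ⟨B ⟨x.1, x.2.1⟩, x.2.2⟩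
      map_add' := fun x y => by
        rw [← A.map_add]
        congr 1
        exact Subtype.ext (B.map_add ⟨x.1, x.2.1⟩ ⟨y.1, y.2.1⟩)
      map_smul' := fun c x => by
        rw [RingHom.id_apply, ← A.map_smul]
        congr 1
        exact Subtype.ext (B.map_smul c ⟨x.1, x.2.1⟩) }

/-- The operator `A + c`, with domain `dom A`. -/
def opAddConst (A : 𝓗 →ₗ.[ℂ] 𝓗) (c : ℂ) : 𝓗 →ₗ.[ℂ] 𝓗 :=
  (c • (LinearMap.id : 𝓗 →ₗ[ℂ] 𝓗)) +ᵥ A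

/-- The direct sum `A ⊕ B`, with domain `dom A ⊕ dom B`, acting in `𝓗 ⊕ 𝓗`. -/
def opSum (A B : 𝓗 →ₗ.[ℂ] 𝓗) : Spinor 𝓗 →ₗ.[ℂ] Spinor 𝓗 where
  domain :=
    { carrier := {Ψ | Ψ.fst ∈ A.domain ∧ Ψ.snd ∈ B.domain}
      zero_mem' := ⟨A.domain.zero_mem, B.domain.zero_mem⟩
      add_mem' := fun h h' => ⟨A.domain.add_mem h.1 h'.1, B.domain.add_mem h.2 h'.2⟩
      smul_mem' := fun c _ h => ⟨A.domain.smul_mem c h.1, B.domain.smul_mem c h.2⟩ }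
  toFun :=
    { toFun := fun Ψ => WithLp.toLp 2 (A ⟨Ψ.1.fst, Ψ.2.1⟩, B ⟨Ψ.1.snd, Ψ.2.2⟩)
      map_add' := fun Ψ Φ => by
        have h1 := A.map_add ⟨Ψ.1.fst, Ψ.2.1⟩ ⟨Φ.1.fst, Φ.2.1⟩
        have h2 := B.map_add ⟨Ψ.1.snd, Ψ.2.2⟩ ⟨Φ.1.snd, Φ.2.2⟩
        exact congrArg (WithLp.toLp 2) (Prod.ext h1 h2)
      map_smul' := fun c Ψ => by
        have h1 := A.map_smul c ⟨Ψ.1.fst, Ψ.2.1⟩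
        have h2 := B.map_smul c ⟨Ψ.1.snd, Ψ.2.2⟩
        exact congrArg (WithLp.toLp 2) (Prod.ext h1 h2) }

/-- The first component, as a map `dom (A ⊕ B) → dom A`. -/
def opSumFst (A B : 𝓗 →ₗ.[ℂ] 𝓗) : (opSum A B).domain →ₗ[ℂ] A.domain where
  toFun Ψ := ⟨Ψ.1.fst, Ψ.2.1⟩
  map_add' _ _ := rfl
  map_smul' _ _ := rfl

/-- The second component, as a map `dom (A ⊕ B) → dom B`. -/
def opSumSnd (A B : 𝓗 →ₗ.[ℂ] 𝓗) : (opSum A B).domain →ₗ[ℂ] B.domain where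
  toFun Ψ := ⟨Ψ.1.snd, Ψ.2.2⟩
  map_add' _ _ := rfl
  map_smul' _ _ := rfl

/-- Let `d` be the derivative `ψ ↦ ψ'` with domain `H¹`. The Dirac operator
`-i σ₁ d/dx + σ₃ / 2`, i.e. `(ψ₁, ψ₂) ↦ (-i ψ₂' + ψ₁ / 2, -i ψ₁' - ψ₂ / 2)`, on the domain of all
`Ψ = (ψ₁, ψ₂)` with `ψ₁, ψ₂ ∈ H¹`. -/
def diracMax (d : 𝓗 →ₗ.[ℂ] 𝓗) : Spinor 𝓗 →ₗ.[ℂ] Spinor 𝓗 where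
  domain := (opSum d d).domain
  toFun := (WithLp.linearEquiv 2 ℂ (𝓗 × 𝓗)).symm.toLinearMap ∘ₗ LinearMap.prod
    (-Complex.I • (d.toFun ∘ₗ opSumSnd d d) + (1 / 2 : ℂ) • (d.domain.subtype ∘ₗ opSumFst d d))
    (-Complex.I • (d.toFun ∘ₗ opSumFst d d) - (1 / 2 : ℂ) • (d.domain.subtype ∘ₗ opSumSnd d d))

/-- The Dirac operator on the domain of those `Ψ = (ψ₁, ψ₂)` with `ψ₁, ψ₂ ∈ H¹` which satisfy the
linear boundary conditions `(ψ₁, ψ₂) ∈ C`. -/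
def dirac (d : 𝓗 →ₗ.[ℂ] 𝓗) (C : Submodule ℂ (d.domain × d.domain)) :
    Spinor 𝓗 →ₗ.[ℂ] Spinor 𝓗 :=
  (diracMax d).domRestrict
    ((C.comap ((opSumFst d d).prod (opSumSnd d d))).map (opSum d d).domain.subtype)

/-- The map `ψ ↦ (ψ, ψ')` on `H² = {ψ ∈ H¹ : ψ' ∈ H¹}`. -/
def jet (d : 𝓗 →ₗ.[ℂ] 𝓗) : (opComp d d).domain →ₗ[ℂ] d.domain × d.domain where
  toFun ψ := (⟨ψ.1, ψ.2.1⟩, ⟨d ⟨ψ.1, ψ.2.1⟩, ψ.2.2⟩)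
  map_add' ψ φ := Prod.ext rfl (Subtype.ext (d.map_add ⟨ψ.1, ψ.2.1⟩ ⟨φ.1, φ.2.1⟩))
  map_smul' c ψ := Prod.ext rfl (Subtype.ext (d.map_smul c ⟨ψ.1, ψ.2.1⟩))

/-- Let `d` be the derivative `ψ ↦ ψ'` with domain `H¹`. The Schrödinger operator `ψ ↦ -ψ''` on
the domain of those `ψ ∈ H²` which satisfy the linear boundary conditions `(ψ, ψ') ∈ C`. -/
def schrodinger (d : 𝓗 →ₗ.[ℂ] 𝓗) (C : Submodule ℂ (d.domain × d.domain)) : 𝓗 →ₗ.[ℂ] 𝓗 :=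
  (-opComp d d).domRestrict ((C.comap (jet d)).map (opComp d d).domain.subtype)

/-- A couple `(Π, Θ)`: an orthogonal projector `Π` in `F` and a symmetric operator
`Θ : ran Π → ran Π`. -/
structure BoundaryPair (F : Type*) [NormedAddCommGroup F] [InnerProductSpace ℂ F] where
  /-- the orthogonal projector `Π` -/
  proj : F →ₗ[ℂ] F
  isSymmetricProjection : proj.IsSymmetricProjection
  /-- the operator `Θ` -/
  op : LinearMap.range proj →ₗ[ℂ] LinearMap.range proj
  isSymmetric : op.IsSymmetric

/-- For boundary maps `ρ, τ : M → F` and a couple `(Π, Θ)`: the boundary conditions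
`ρ m ∈ ran Π`, `Π τ m = Θ ρ m`. -/
def boundaryCond {M F : Type*} [AddCommGroup M] [Module ℂ M] [NormedAddCommGroup F]
    [InnerProductSpace ℂ F] (ρ τ : M →ₗ[ℂ] F) (b : BoundaryPair F) : Submodule ℂ M where
  carrier := {m | ∃ h : ρ m ∈ LinearMap.range b.proj, b.proj (τ m) = b.op ⟨ρ m, h⟩}
  zero_mem' := by
    refine ⟨by simp, ?_⟩
    have : (⟨ρ 0, by simp⟩ : LinearMap.range b.proj) = 0 := Subtype.ext (map_zero ρ)
    rw [this]; simp
  add_mem' := by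
    rintro x z ⟨hx, hx'⟩ ⟨hz, hz'⟩
    refine ⟨by rw [map_add]; exact Submodule.add_mem _ hx hz, ?_⟩
    have : (⟨ρ (x + z), by rw [map_add]; exact Submodule.add_mem _ hx hz⟩ :
        LinearMap.range b.proj) = ⟨ρ x, hx⟩ + ⟨ρ z, hz⟩ := Subtype.ext (map_add ρ x z)
    rw [this, map_add, map_add, map_add, hx', hz']; rfl
  smul_mem' := by
    rintro c x ⟨hx, hx'⟩
    refine ⟨by rw [map_smul]; exact Submodule.smul_mem _ c hx, ?_⟩
    have : (⟨ρ (c • x), by rw [map_smul]; exact Submodule.smul_mem _ c hx⟩ :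
        LinearMap.range b.proj) = c • ⟨ρ x, hx⟩ := Subtype.ext (map_smul ρ c x)
    rw [this, map_smul, map_smul, map_smul, hx']; rfl

end Operators

/-! ### The weak derivative in `L²(U)` and its one-sided boundary values -/

/-- `L²(U; ℂ)` for an open set `U ⊆ ℝ`. -/
abbrev L2 (U : Opens ℝ) : Type := Lp ℂ 2 (volume.restrict (U : Set ℝ))

/-- `g` is the distributional derivative of `f` on `U`. -/
def IsWeakDeriv (U : Opens ℝ) (f g : ℝ → ℂ) : Prop :=
  ∀ φ : ℝ → ℂ, ContDiff ℝ ∞ φ → HasCompactSupport φ → tsupport φ ⊆ U →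
    ∫ x in U, f x * deriv φ x = - ∫ x in U, g x * φ x

theorem IsWeakDeriv.congr {U : Opens ℝ} {f f' g g' : ℝ → ℂ} (h : IsWeakDeriv U f g)
    (hf : f =ᵐ[volume.restrict (U : Set ℝ)] f') (hg : g =ᵐ[volume.restrict (U : Set ℝ)] g') :
    IsWeakDeriv U f' g' := by
  intro φ h1 h2 h3
  have e1 : ∫ x in U, f' x * deriv φ x = ∫ x in U, f x * deriv φ x :=
    integral_congr_ae (by filter_upwards [hf] with x hx; rw [hx])
  have e2 : ∫ x in U, g' x * φ x = ∫ x in U, g x * φ x :=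
    integral_congr_ae (by filter_upwards [hg] with x hx; rw [hx])
  rw [e1, e2]
  exact h φ h1 h2 h3

theorem L2.integrable_mul {U : Opens ℝ} (f : L2 U) {φ : ℝ → ℂ} (hφ : Continuous φ)
    (hc : HasCompactSupport φ) :
    Integrable (fun x => f x * φ x) (volume.restrict (U : Set ℝ)) :=
  (Lp.memLp f).integrable_mul (q := 2) (hφ.memLp_of_hasCompactSupport hc)

/-- The graph of the weak derivative: all `(f, f')` with `f, f' ∈ L²(U)`. -/
def weakDerivGraph (U : Opens ℝ) : Submodule ℂ (L2 U × L2 U) where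
  carrier := {p | IsWeakDeriv U p.1 p.2}
  zero_mem' := by
    have : IsWeakDeriv U (fun _ => 0) (fun _ => 0) := by intro φ _ _ _; simp
    exact this.congr (Lp.coeFn_zero ℂ 2 _).symm (Lp.coeFn_zero ℂ 2 _).symm
  add_mem' := by
    rintro ⟨f, g⟩ ⟨f', g'⟩ h h'
    have : IsWeakDeriv U (fun x => f x + f' x) (fun x => g x + g' x) := by
      intro φ h1 h2 h3
      have hd : Continuous (deriv φ) := h1.continuous_deriv (by simp)
      have hs : HasCompactSupport (deriv φ) := h2.deriv
      simp_rw [add_mul]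
      rw [integral_add (L2.integrable_mul f hd hs) (L2.integrable_mul f' hd hs),
        integral_add (L2.integrable_mul g h1.continuous h2)
          (L2.integrable_mul g' h1.continuous h2),
        h φ h1 h2 h3, h' φ h1 h2 h3, neg_add]
    exact this.congr (Lp.coeFn_add f f').symm (Lp.coeFn_add g g').symm
  smul_mem' := by
    rintro c ⟨f, g⟩ h
    have : IsWeakDeriv U (fun x => c * f x) (fun x => c * g x) := by
      intro φ h1 h2 h3
      simp_rw [mul_assoc]
      rw [integral_const_mul, integral_const_mul, h φ h1 h2 h3, mul_neg]
    exact this.congr (Lp.coeFn_smul c f).symm (Lp.coeFn_smul c g).symm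

theorem weakDerivGraph_snd_eq_zero (U : Opens ℝ) (p : L2 U × L2 U) (hp : p ∈ weakDerivGraph U)
    (h0 : p.1 = 0) : p.2 = 0 := by
  have hp' : IsWeakDeriv U (fun _ => 0) p.2 := by
    refine IsWeakDeriv.congr hp ?_ EventuallyEq.rfl
    rw [h0]; exact Lp.coeFn_zero ℂ 2 _
  have hloc : LocallyIntegrableOn p.2 (U : Set ℝ) volume :=
    locallyIntegrableOn_of_locallyIntegrable_restrict
      ((Lp.memLp p.2).locallyIntegrable (by norm_num))
  have hz := U.isOpen.ae_eq_zero_of_integral_contDiff_smul_eq_zero hloc (by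
    intro θ hθ hc hs
    have := hp' (fun x => (θ x : ℂ)) (Complex.ofRealCLM.contDiff.comp hθ)
      (hc.comp_left (g := ((↑) : ℝ → ℂ)) (by simp)) ((tsupport_comp_subset
        (g := ((↑) : ℝ → ℂ)) (by simp) θ).trans hs)
    simp only [zero_mul, integral_zero] at this
    rw [← setIntegral_eq_integral_of_forall_compl_eq_zero (s := (U : Set ℝ))]
    · have h2 : ∫ x in U, p.2 x * (θ x : ℂ) = 0 := neg_eq_zero.1 this.symm
      rw [← h2]
      refine integral_congr_ae (Eventually.of_forall fun x => ?_)
      simp only [Complex.real_smul, mul_comm]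
    · intro x hx
      have : θ x = 0 := image_eq_zero_of_notMem_tsupport fun h' => hx (hs h')
      simp [this])
  rw [Lp.eq_zero_iff_ae_eq_zero]
  exact (ae_restrict_iff' U.isOpen.measurableSet).2 hz

/-- The weak derivative `f ↦ f'` in `L²(U)`, with domain `H¹(U) = {f ∈ L²(U) : f' ∈ L²(U)}`. -/
def weakDeriv (U : Opens ℝ) : L2 U →ₗ.[ℂ] L2 U := (weakDerivGraph U).toLinearPMap

/-- The Sobolev space `H¹(U; ℂ)`. -/
abbrev H1 (U : Opens ℝ) : Submodule ℂ (L2 U) := (weakDeriv U).domain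

theorem mem_H1_iff {U : Opens ℝ} {f : L2 U} : f ∈ H1 U ↔ ∃ g : L2 U, IsWeakDeriv U f g := by
  change f ∈ (weakDerivGraph U).map (LinearMap.fst ℂ _ _) ↔ _
  constructor
  · rintro ⟨⟨f', g⟩, h, rfl⟩
    exact ⟨g, h⟩
  · rintro ⟨g, h⟩
    exact ⟨(f, g), h, rfl⟩

theorem isWeakDeriv_weakDeriv {U : Opens ℝ} (f : H1 U) :
    IsWeakDeriv U (f : L2 U) (weakDeriv U f) :=
  Submodule.mem_graph_toLinearPMap (weakDerivGraph_snd_eq_zero U) f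

theorem exists_primitive {a b : ℝ} (hab : a < b) {θ : ℝ → ℝ} (hθ : ContDiff ℝ ∞ θ)
    (hc : HasCompactSupport θ) (hs : tsupport θ ⊆ Set.Ioo a b) (h0 : ∫ x, θ x = 0) :
    ContDiff ℝ ∞ (fun t => ∫ s in a..t, θ s) ∧ HasCompactSupport (fun t => ∫ s in a..t, θ s) ∧
      tsupport (fun t => ∫ s in a..t, θ s) ⊆ Set.Ioo a b ∧
      deriv (fun t => ∫ s in a..t, θ s) = θ := by
  have hd : deriv (fun t => ∫ s in a..t, θ s) = θ := by
    funext t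
    exact hθ.continuous.deriv_integral θ a t
  obtain ⟨c, d, hac, hdb, hcd⟩ : ∃ c d, a < c ∧ d < b ∧ tsupport θ ⊆ Set.Icc c d := by
    rcases (tsupport θ).eq_empty_or_nonempty with h | h
    · exact ⟨b, a, hab, hab, by simp [h]⟩
    · obtain ⟨c, hc1, hc2⟩ := hc.isCompact.exists_isLeast h
      obtain ⟨d, hd1, hd2⟩ := hc.isCompact.exists_isGreatest h
      exact ⟨c, d, (hs hc1).1, (hs hd1).2, fun x hx => ⟨hc2 hx, hd2 hx⟩⟩
  have hz : ∀ s, s ∉ Set.Icc c d → θ s = 0 := fun s hs' =>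
    image_eq_zero_of_notMem_tsupport fun h => hs' (hcd h)
  have hsub : Function.support (fun t => ∫ s in a..t, θ s) ⊆ Set.Icc c d := by
    intro t ht
    by_contra hn
    apply ht
    rcases lt_or_ge t c with h | h
    · show ∫ s in a..t, θ s = 0
      rw [intervalIntegral.integral_congr (g := fun _ => 0), intervalIntegral.integral_zero]
      intro s hs'
      apply hz
      intro hh
      have := hs'.2
      have h2 : s < c := lt_of_le_of_lt this (max_lt hac h)
      exact absurd hh.1 (not_le.2 h2)
    · have hdt : d < t := by
        by_contra h'
        exact hn ⟨h, not_lt.1 h'⟩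
      show ∫ s in a..t, θ s = 0
      rw [← h0]
      apply intervalIntegral.integral_eq_integral_of_support_subset
      intro s hs'
      have hh : s ∈ Set.Icc c d := by
        by_contra h'
        exact hs' (hz s h')
      exact ⟨hac.trans_le hh.1, hh.2.trans hdt.le⟩
  have hts : tsupport (fun t => ∫ s in a..t, θ s) ⊆ Set.Icc c d :=
    closure_minimal hsub isClosed_Icc
  refine ⟨?_, ?_, ?_, hd⟩
  · rw [contDiff_infty_iff_deriv, hd]
    exact ⟨fun t => (hθ.continuous.integral_hasStrictDerivAt a t).hasDerivAt.differentiableAt, hθ⟩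
  · exact isCompact_Icc.of_isClosed_subset (isClosed_tsupport _) hts
  · exact hts.trans fun x hx => ⟨hac.trans_le hx.1, hx.2.trans_lt hdb⟩

theorem integral_primitive_eq_zero {U : Opens ℝ} {f g : ℝ → ℂ} {a b : ℝ} (hab : a < b)
    (hU : Set.Ioo a b ⊆ (U : Set ℝ)) (hf : IntegrableOn f (Set.Ioo a b))
    (hg : IntegrableOn g (Set.Ioo a b)) (h : IsWeakDeriv U f g)
    {θ : ℝ → ℝ} (hθ : ContDiff ℝ ∞ θ) (hc : HasCompactSupport θ)
    (hs : tsupport θ ⊆ Set.Ioo a b) (h0 : ∫ x, θ x = 0) :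
    ∫ s, θ s • (f s + ∫ t in s..b, (Set.Ioo a b).indicator g t) = 0 := by
  obtain ⟨hΦ, hΦc, hΦs, hΦd⟩ := exists_primitive hab hθ hc hs h0
  set Φ : ℝ → ℝ := fun t => ∫ s in a..t, θ s with hΦdef
  set I := Set.Ioo a b with hI
  have hIm : MeasurableSet I := measurableSet_Ioo
  obtain ⟨M, hM⟩ := hc.exists_bound_of_continuous hθ.continuous
  have hθi : Integrable θ := hθ.continuous.integrable_of_hasCompactSupport hc
  have h1 := h (fun t => (Φ t : ℂ)) (Complex.ofRealCLM.contDiff.comp hΦ)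
    (hΦc.comp_left (g := ((↑) : ℝ → ℂ)) (by simp)) ((tsupport_comp_subset (g := ((↑) : ℝ → ℂ))
      (by simp) Φ).trans (hΦs.trans hU))
  have hdc : deriv (fun t => (Φ t : ℂ)) = fun t => (θ t : ℂ) := by
    funext t
    have : HasDerivAt Φ (θ t) t := by
      rw [← hΦd]
      exact ((hΦ.differentiable (by simp)) t).hasDerivAt
    exact this.ofReal_comp.deriv
  rw [hdc] at h1
  have hθz : ∀ x, x ∉ I → θ x = 0 := fun x hx =>
    image_eq_zero_of_notMem_tsupport fun h' => hx (hs h')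
  have hΦz : ∀ x, x ∉ I → Φ x = 0 := fun x hx =>
    image_eq_zero_of_notMem_tsupport fun h' => hx (hΦs h')
  have e1 : ∫ x in U, f x * (θ x : ℂ) = ∫ x in I, f x * (θ x : ℂ) :=
    (setIntegral_eq_of_subset_of_forall_sdiff_eq_zero U.isOpen.measurableSet hU
      (fun x hx => by simp [hθz x hx.2]))
  have e2 : ∫ x in U, g x * (Φ x : ℂ) = ∫ x in I, g x * (Φ x : ℂ) :=
    (setIntegral_eq_of_subset_of_forall_sdiff_eq_zero U.isOpen.measurableSet hU
      (fun x hx => by simp [hΦz x hx.2]))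
  rw [e1, e2] at h1
  have hJ : ∀ s ∈ I, ∫ t in s..b, I.indicator g t = ∫ t in I, (Set.Ici s).indicator g t := by
    intro s hs'
    rw [intervalIntegral.integral_of_le hs'.2.le, setIntegral_indicator hIm,
      setIntegral_indicator measurableSet_Ici]
    have : Set.Ioc s b ∩ I = Set.Ioo s b := by
      ext x; simp only [hI, Set.mem_inter_iff, Set.mem_Ioc, Set.mem_Ioo]
      have := hs'.1
      constructor
      · rintro ⟨⟨h1, h2⟩, h3, h4⟩; exact ⟨h1, h4⟩
      · rintro ⟨h1, h2⟩; exact ⟨⟨h1, h2.le⟩, this.trans h1, h2⟩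
    have h' : I ∩ Set.Ici s = Set.Ico s b := by
      ext x; simp only [hI, Set.mem_inter_iff, Set.mem_Ici, Set.mem_Ioo, Set.mem_Ico]
      have := hs'.1
      constructor
      · rintro ⟨⟨h1, h2⟩, h3⟩; exact ⟨h3, h2⟩
      · rintro ⟨h1, h2⟩; exact ⟨⟨this.trans_le h1, h2⟩, h1⟩
    rw [this, h', integral_Ico_eq_integral_Ioo]
  have hΦ' : ∀ t ∈ I, (Φ t : ℂ) = ∫ s in I, (Set.Iic t).indicator (fun s => (θ s : ℂ)) s := by
    intro t ht
    rw [setIntegral_indicator measurableSet_Iic]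
    have : I ∩ Set.Iic t = Set.Ioc a t := by
      ext x; simp only [hI, Set.mem_inter_iff, Set.mem_Iic, Set.mem_Ioo, Set.mem_Ioc]
      have := ht.2
      constructor
      · rintro ⟨⟨h1, h2⟩, h3⟩; exact ⟨h1, h3⟩
      · rintro ⟨h1, h2⟩; exact ⟨⟨h1, h2.trans_lt this⟩, h2⟩
    rw [this, ← intervalIntegral.integral_of_le ht.1.le, intervalIntegral.integral_ofReal]
  have hFub : ∫ t in I, ∫ s in I, g t * (Set.Iic t).indicator (fun s => (θ s : ℂ)) s =
      ∫ s in I, ∫ t in I, g t * (Set.Iic t).indicator (fun s => (θ s : ℂ)) s := by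
    apply integral_integral_swap
    have hθc : Integrable (fun s => (θ s : ℂ)) (volume.restrict I) := hθi.ofReal.integrableOn
    have hprod : Integrable (fun p : ℝ × ℝ => g p.1 * (θ p.2 : ℂ))
        ((volume.restrict I).prod (volume.restrict I)) := Integrable.mul_prod hg hθc
    have := hprod.indicator (s := {p : ℝ × ℝ | p.2 ≤ p.1})
      (measurableSet_le measurable_snd measurable_fst)
    refine this.congr (Eventually.of_forall ?_)
    rintro ⟨t, s⟩
    by_cases hst : s ≤ t <;> simp [Function.uncurry, Set.indicator, hst]
  have hE : ∫ t in I, g t * (Φ t : ℂ) =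
      ∫ s in I, (θ s : ℂ) * ∫ t in s..b, I.indicator g t := by
    rw [setIntegral_congr_fun (g := fun t => ∫ s in I, g t *
      (Set.Iic t).indicator (fun s => (θ s : ℂ)) s) hIm, hFub]
    · apply setIntegral_congr_fun hIm
      intro s hs'
      simp only
      rw [hJ s hs', ← integral_const_mul]
      congr 1
      funext t
      by_cases hst : s ≤ t <;> simp [Set.indicator, hst, mul_comm]
    · intro t ht
      simp only
      rw [hΦ' t ht, ← integral_const_mul]
  rw [hE] at h1
  have hgi : Integrable (I.indicator g) := hg.integrable_indicator hIm
  have hcont : Continuous fun s => ∫ t in s..b, I.indicator g t := by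
    have := (intervalIntegral.continuous_primitive
      (fun _ _ => hgi.intervalIntegrable) b).neg
    refine this.congr fun s => ?_
    rw [Pi.neg_apply, ← intervalIntegral.integral_symm]
  have i1 : IntegrableOn (fun s => f s * (θ s : ℂ)) I := by
    refine Integrable.mul_bdd (c := M) hf ?_ (Eventually.of_forall fun x => ?_)
    · exact (Complex.continuous_ofReal.comp hθ.continuous).aestronglyMeasurable
    · simpa using hM x
  have i2 : IntegrableOn (fun s => (θ s : ℂ) * ∫ t in s..b, I.indicator g t) I := by
    refine ((Continuous.integrable_of_hasCompactSupport ?_ ?_)).integrableOn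
    · exact (Complex.continuous_ofReal.comp hθ.continuous).mul hcont
    · exact (hc.comp_left (g := ((↑) : ℝ → ℂ)) (by simp)).mul_right
  rw [← setIntegral_eq_integral_of_forall_compl_eq_zero (s := I)
    (fun x hx => by simp [hθz x hx])]
  have : ∀ s, θ s • (f s + ∫ t in s..b, I.indicator g t) =
      f s * (θ s : ℂ) + (θ s : ℂ) * ∫ t in s..b, I.indicator g t := by
    intro s
    rw [Complex.real_smul]; ring
  simp_rw [this]
  rw [integral_add i1 i2, h1]
  simp

theorem exists_continuous_rep {U : Opens ℝ} {f g : ℝ → ℂ} {a b : ℝ} (hab : a < b)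
    (hU : Set.Ioo a b ⊆ (U : Set ℝ)) (hf : IntegrableOn f (Set.Ioo a b))
    (hg : IntegrableOn g (Set.Ioo a b)) (h : IsWeakDeriv U f g) :
    ∃ F : ℝ → ℂ, Continuous F ∧ ∀ᵐ x, x ∈ Set.Ioo a b → f x = F x := by
  have hgi : Integrable ((Set.Ioo a b).indicator g) := hg.integrable_indicator measurableSet_Ioo
  have hcont : Continuous fun s => ∫ t in s..b, (Set.Ioo a b).indicator g t := by
    have := (intervalIntegral.continuous_primitive
      (fun _ _ => hgi.intervalIntegrable) b).neg
    refine this.congr fun s => ?_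
    rw [Pi.neg_apply, ← intervalIntegral.integral_symm]
  set J : ℝ → ℂ := fun s => ∫ t in s..b, (Set.Ioo a b).indicator g t with hJ
  let χ₀ : ContDiffBump ((a + b) / 2) := ⟨(b - a) / 8, (b - a) / 4, by linarith, by linarith⟩
  set χ : ℝ → ℝ := χ₀.normed volume with hχ
  have hχ1 : ContDiff ℝ ∞ χ := χ₀.contDiff_normed
  have hχc : HasCompactSupport χ := χ₀.hasCompactSupport_normed
  have hχs : tsupport χ ⊆ Set.Ioo a b := by
    rw [hχ, χ₀.tsupport_normed_eq, Real.closedBall_eq_Icc]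
    intro x hx
    have h1 : χ₀.rOut = (b - a) / 4 := rfl
    rw [h1] at hx
    exact ⟨by linarith [hx.1], by linarith [hx.2]⟩
  have hχi : ∫ x, χ x = 1 := χ₀.integral_normed
  set c : ℂ := ∫ s, χ s • (f s + J s) with hcdef
  have hloc : LocallyIntegrableOn (fun s => f s + J s - c) (Set.Ioo a b) := by
    refine IntegrableOn.locallyIntegrableOn ?_
    refine (Integrable.add hf ?_).sub ?_
    · exact (hcont.integrableOn_Icc (a := a) (b := b)).mono_set Set.Ioo_subset_Icc_self
    · exact integrableOn_const (by simp)
  have hint : ∀ θ : ℝ → ℝ, ContDiff ℝ ∞ θ → HasCompactSupport θ → tsupport θ ⊆ Set.Ioo a b →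
      Integrable (fun s => θ s • (f s + J s)) := by
    intro θ hθ hc hs
    obtain ⟨M, hM⟩ := hc.exists_bound_of_continuous hθ.continuous
    have : IntegrableOn (fun s => θ s • (f s + J s)) (Set.Ioo a b) := by
      refine Integrable.bdd_smul (C := M) ?_ ?_ (Eventually.of_forall hM)
      · refine Integrable.add hf ?_
        exact (hcont.integrableOn_Icc (a := a) (b := b)).mono_set Set.Ioo_subset_Icc_self
      · exact hθ.continuous.aestronglyMeasurable
    refine (integrableOn_iff_integrable_of_support_subset ?_).1 this
    intro x hx
    apply hs
    apply subset_tsupport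
    intro h'
    exact hx (by simp [h'])
  have hzero : ∀ᵐ x, x ∈ Set.Ioo a b → f x + J x - c = 0 := by
    refine isOpen_Ioo.ae_eq_zero_of_integral_contDiff_smul_eq_zero hloc ?_
    intro θ hθ hc hs
    have hθi : Integrable θ := hθ.continuous.integrable_of_hasCompactSupport hc
    have hχI : Integrable χ := hχ1.continuous.integrable_of_hasCompactSupport hχc
    have hk := integral_primitive_eq_zero hab hU hf hg h (θ := fun x => θ x - (∫ y, θ y) * χ x)
      (hθ.sub (contDiff_const.mul hχ1)) (hc.sub hχc.mul_left)
      ((tsupport_sub _ _).trans (Set.union_subset hs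
        ((tsupport_mul_subset_right).trans hχs)))
      (by rw [integral_sub hθi (hχI.const_mul _), integral_const_mul, hχi]; simp)
    have e1 : ∫ s, (θ s - (∫ y, θ y) * χ s) • (f s + J s) =
        (∫ s, θ s • (f s + J s)) - (∫ y, θ y) • c := by
      rw [hcdef, ← integral_smul]
      have hi : Integrable (fun s => (∫ y, θ y) • χ s • (f s + J s)) :=
        (hint χ hχ1 hχc hχs).smul (∫ y, θ y)
      rw [← integral_sub (hint θ hθ hc hs) hi]
      congr 1; funext s
      rw [sub_smul, mul_smul]
    rw [e1] at hk
    have e2 : ∫ s, θ s • (f s + J s - c) = (∫ s, θ s • (f s + J s)) - (∫ y, θ y) • c := by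
      rw [← integral_smul_const, ← integral_sub (hint θ hθ hc hs) (hθi.smul_const c)]
      congr 1; funext s
      rw [smul_sub]
    rw [e2, hk]
  refine ⟨fun x => c - J x, continuous_const.sub hcont, ?_⟩
  filter_upwards [hzero] with x hx hxI
  have := hx hxI
  linear_combination this

/-- The right limit `f(y⁺)` of a class of functions modulo null sets (an essential limit). -/
def rightLim (f : ℝ → ℂ) (y : ℝ) : ℂ := limUnder (𝓝[>] y ⊓ ae volume) f

/-- The left limit `f(y⁻)` of a class of functions modulo null sets (an essential limit). -/
def leftLim (f : ℝ → ℂ) (y : ℝ) : ℂ := limUnder (𝓝[<] y ⊓ ae volume) f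

instance neBot_right (y : ℝ) : NeBot (𝓝[>] y ⊓ ae volume) := by
  rw [Filter.inf_neBot_iff]
  intro s hs t ht
  obtain ⟨u, hu, hus⟩ := mem_nhdsGT_iff_exists_Ioo_subset.1 hs
  by_contra hne
  rw [Set.not_nonempty_iff_eq_empty, ← Set.disjoint_iff_inter_eq_empty] at hne
  have : volume (Set.Ioo y u) = 0 :=
    measure_mono_null (hus.trans hne.subset_compl_right) (mem_ae_iff.1 ht)
  rw [Real.volume_Ioo, ENNReal.ofReal_eq_zero] at this
  have hu' : y < u := hu
  linarith

instance neBot_left (y : ℝ) : NeBot (𝓝[<] y ⊓ ae volume) := by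
  rw [Filter.inf_neBot_iff]
  intro s hs t ht
  obtain ⟨u, hu, hus⟩ := mem_nhdsLT_iff_exists_Ioo_subset.1 hs
  by_contra hne
  rw [Set.not_nonempty_iff_eq_empty, ← Set.disjoint_iff_inter_eq_empty] at hne
  have : volume (Set.Ioo u y) = 0 :=
    measure_mono_null (hus.trans hne.subset_compl_right) (mem_ae_iff.1 ht)
  rw [Real.volume_Ioo, ENNReal.ofReal_eq_zero] at this
  have hu' : u < y := hu
  linarith

theorem L2.integrableOn_Ioo {U : Opens ℝ} (f : L2 U) {a b : ℝ}
    (h : Set.Ioo a b ⊆ (U : Set ℝ)) : IntegrableOn f (Set.Ioo a b) := by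
  have : MemLp f 2 (volume.restrict (Set.Ioo a b)) :=
    (Lp.memLp f).mono_measure (Measure.restrict_mono h le_rfl)
  exact this.integrable (by norm_num)

theorem tendsto_rightLim {U : Opens ℝ} {y : ℝ} (h : (U : Set ℝ) ∈ 𝓝[>] y) (f : H1 U) :
    Tendsto (f : L2 U) (𝓝[>] y ⊓ ae volume) (𝓝 (rightLim (f : L2 U) y)) := by
  obtain ⟨b, hb, hbU⟩ := mem_nhdsGT_iff_exists_Ioo_subset.1 h
  obtain ⟨F, hF, hfF⟩ := exists_continuous_rep hb hbU (L2.integrableOn_Ioo _ hbU)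
    (L2.integrableOn_Ioo _ hbU) (isWeakDeriv_weakDeriv f)
  have h1 : Tendsto F (𝓝[>] y ⊓ ae volume) (𝓝 (F y)) :=
    hF.continuousAt.mono_left (inf_le_left.trans nhdsWithin_le_nhds)
  have h2 : F =ᶠ[𝓝[>] y ⊓ ae volume] (f : L2 U) := by
    filter_upwards [mem_inf_of_left (Ioo_mem_nhdsGT hb), mem_inf_of_right hfF] with x hx hx'
    exact (hx' hx).symm
  exact tendsto_nhds_limUnder ⟨_, h1.congr' h2⟩

theorem tendsto_leftLim {U : Opens ℝ} {y : ℝ} (h : (U : Set ℝ) ∈ 𝓝[<] y) (f : H1 U) :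
    Tendsto (f : L2 U) (𝓝[<] y ⊓ ae volume) (𝓝 (leftLim (f : L2 U) y)) := by
  obtain ⟨a, ha, haU⟩ := mem_nhdsLT_iff_exists_Ioo_subset.1 h
  obtain ⟨F, hF, hfF⟩ := exists_continuous_rep ha haU (L2.integrableOn_Ioo _ haU)
    (L2.integrableOn_Ioo _ haU) (isWeakDeriv_weakDeriv f)
  have h1 : Tendsto F (𝓝[<] y ⊓ ae volume) (𝓝 (F y)) :=
    hF.continuousAt.mono_left (inf_le_left.trans nhdsWithin_le_nhds)
  have h2 : F =ᶠ[𝓝[<] y ⊓ ae volume] (f : L2 U) := by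
    filter_upwards [mem_inf_of_left (Ioo_mem_nhdsLT ha), mem_inf_of_right hfF] with x hx hx'
    exact (hx' hx).symm
  exact tendsto_nhds_limUnder ⟨_, h1.congr' h2⟩

theorem eventually_right_of_ae {U : Opens ℝ} {y : ℝ} (h : (U : Set ℝ) ∈ 𝓝[>] y) {p : ℝ → Prop}
    (hp : ∀ᵐ x ∂volume.restrict (U : Set ℝ), p x) : ∀ᶠ x in 𝓝[>] y ⊓ ae volume, p x := by
  filter_upwards [mem_inf_of_left h,
    mem_inf_of_right ((ae_restrict_iff' U.isOpen.measurableSet).1 hp)] with x hx hx'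
  exact hx' hx

theorem eventually_left_of_ae {U : Opens ℝ} {y : ℝ} (h : (U : Set ℝ) ∈ 𝓝[<] y) {p : ℝ → Prop}
    (hp : ∀ᵐ x ∂volume.restrict (U : Set ℝ), p x) : ∀ᶠ x in 𝓝[<] y ⊓ ae volume, p x := by
  filter_upwards [mem_inf_of_left h,
    mem_inf_of_right ((ae_restrict_iff' U.isOpen.measurableSet).1 hp)] with x hx hx'
  exact hx' hx

/-- The boundary value `f ↦ f(y⁺)` on `H¹(U)`, where `U` contains some interval `(y, y + ε)`. -/
def rightTrace (U : Opens ℝ) (y : ℝ) (h : (U : Set ℝ) ∈ 𝓝[>] y) : H1 U →ₗ[ℂ] ℂ where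
  toFun f := rightLim (f : L2 U) y
  map_add' f g := by
    refine (((tendsto_rightLim h f).add (tendsto_rightLim h g)).congr' ?_).limUnder_eq
    filter_upwards [eventually_right_of_ae h (Lp.coeFn_add (f : L2 U) (g : L2 U))] with x hx
    exact hx.symm
  map_smul' c f := by
    refine (((tendsto_rightLim h f).const_smul c).congr' ?_).limUnder_eq
    filter_upwards [eventually_right_of_ae h (Lp.coeFn_smul c (f : L2 U))] with x hx
    exact hx.symm

/-- The boundary value `f ↦ f(y⁻)` on `H¹(U)`, where `U` contains some interval `(y - ε, y)`. -/
def leftTrace (U : Opens ℝ) (y : ℝ) (h : (U : Set ℝ) ∈ 𝓝[<] y) : H1 U →ₗ[ℂ] ℂ where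
  toFun f := leftLim (f : L2 U) y
  map_add' f g := by
    refine (((tendsto_leftLim h f).add (tendsto_leftLim h g)).congr' ?_).limUnder_eq
    filter_upwards [eventually_left_of_ae h (Lp.coeFn_add (f : L2 U) (g : L2 U))] with x hx
    exact hx.symm
  map_smul' c f := by
    refine (((tendsto_leftLim h f).const_smul c).congr' ?_).limUnder_eq
    filter_upwards [eventually_left_of_ae h (Lp.coeFn_smul c (f : L2 U))] with x hx
    exact hx.symm

/-! ### The line with point interactions at `Y = {y₁ < ... < yₙ}` -/

section Line

variable {n : ℕ}

/-- The open set `ℝ \ Y`, `Y = {y₁, ..., yₙ}`. -/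
def cutLine (y : Fin n → ℝ) : Opens ℝ := ⟨(Set.range y)ᶜ, (Set.finite_range y).isClosed.isOpen_compl⟩

/-- The set `Y` is negligible, so that `L²(ℝ \ Y)` is `L²(ℝ)`. -/
theorem restrict_cutLine (y : Fin n → ℝ) :
    (volume : Measure ℝ).restrict (cutLine y : Set ℝ) = volume :=
  Measure.restrict_eq_self_of_ae_mem (by
    have : volume (Set.range y) = 0 := (Set.finite_range y).measure_zero volume
    exact measure_eq_zero_iff_ae_notMem.1 this)

theorem cutLine_mem (y : Fin n → ℝ) (x : ℝ) : (cutLine y : Set ℝ) ∈ 𝓝[≠] x := by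
  have h : (Set.range y \ {x})ᶜ ∈ 𝓝 x :=
    ((Set.finite_range y).subset Set.sdiff_subset).isClosed.isOpen_compl.mem_nhds (by simp)
  filter_upwards [mem_nhdsWithin_of_mem_nhds h, self_mem_nhdsWithin] with z hz hz'
  exact fun hr => hz ⟨hr, hz'⟩

theorem cutLine_mem_right (y : Fin n → ℝ) (x : ℝ) : (cutLine y : Set ℝ) ∈ 𝓝[>] x :=
  nhdsWithin_mono x (fun _ h => ne_of_gt h) (cutLine_mem y x)

theorem cutLine_mem_left (y : Fin n → ℝ) (x : ℝ) : (cutLine y : Set ℝ) ∈ 𝓝[<] x :=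
  nhdsWithin_mono x (fun _ h => ne_of_lt h) (cutLine_mem y x)

/-- `f ↦ f(y_k⁺)` on `H¹(ℝ \ Y)`. -/
def valR (y : Fin n → ℝ) (k : Fin n) : H1 (cutLine y) →ₗ[ℂ] ℂ :=
  rightTrace (cutLine y) (y k) (cutLine_mem_right y (y k))

/-- `f ↦ f(y_k⁻)` on `H¹(ℝ \ Y)`. -/
def valL (y : Fin n → ℝ) (k : Fin n) : H1 (cutLine y) →ₗ[ℂ] ℂ :=
  leftTrace (cutLine y) (y k) (cutLine_mem_left y (y k))

/-- The jump `[f]_{y_k} = f(y_k⁺) - f(y_k⁻)`. -/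
def jump (y : Fin n → ℝ) (k : Fin n) : H1 (cutLine y) →ₗ[ℂ] ℂ := valR y k - valL y k

/-- The mean value `⟨f⟩_{y_k} = (f(y_k⁻) + f(y_k⁺)) / 2`. -/
def mean (y : Fin n → ℝ) (k : Fin n) : H1 (cutLine y) →ₗ[ℂ] ℂ :=
  (1 / 2 : ℂ) • (valL y k + valR y k)

/-- The linear map into `ℂ^ι` with given components. -/
def toEuclidean {M ι : Type*} [AddCommGroup M] [Module ℂ M] (L : ι → M →ₗ[ℂ] ℂ) :
    M →ₗ[ℂ] EuclideanSpace ℂ ι :=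
  (WithLp.linearEquiv 2 ℂ (ι → ℂ)).symm.toLinearMap ∘ₗ LinearMap.pi L

/-- `H¹(ℝ \ Y; ℂ²)`, as pairs `(ψ₁, ψ₂)`. -/
abbrev H1Pair (y : Fin n → ℝ) : Type := H1 (cutLine y) × H1 (cutLine y)

/-- `τ Ψ = (⟨Ψ⟩_{y₁}, ..., ⟨Ψ⟩_{yₙ}) ∈ ℂ^{2n}`; the index `(k, j)` stands for the `j`-th component
at `y_k`. -/
def tau (y : Fin n → ℝ) : H1Pair y →ₗ[ℂ] EuclideanSpace ℂ (Fin n × Fin 2) :=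
  toEuclidean fun q =>
    ![mean y q.1 ∘ₗ LinearMap.fst ℂ _ _, mean y q.1 ∘ₗ LinearMap.snd ℂ _ _] q.2

/-- `ρ Ψ = (i σ₁ [Ψ]_{y₁}, ..., i σ₁ [Ψ]_{yₙ}) ∈ ℂ^{2n}`. -/
def rho (y : Fin n → ℝ) : H1Pair y →ₗ[ℂ] EuclideanSpace ℂ (Fin n × Fin 2) :=
  toEuclidean fun q =>
    ![Complex.I • (jump y q.1 ∘ₗ LinearMap.snd ℂ _ _),
      Complex.I • (jump y q.1 ∘ₗ LinearMap.fst ℂ _ _)] q.2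

/-- The Dirac operator `D_{Π,Θ}` in `L²(ℝ; ℂ²)`: `-i σ₁ d/dx + σ₃ / 2` on `ℝ \ Y` with domain
`{Ψ ∈ H¹(ℝ \ Y; ℂ²) : ρ Ψ ∈ ran Π, Π τ Ψ = Θ ρ Ψ}`. -/
def diracPT (y : Fin n → ℝ) (b : BoundaryPair (EuclideanSpace ℂ (Fin n × Fin 2))) :
    Spinor (L2 (cutLine y)) →ₗ.[ℂ] Spinor (L2 (cutLine y)) :=
  dirac (weakDeriv (cutLine y)) (boundaryCond (rho y) (tau y) b)

/-- The derivative `Ψ ↦ Ψ'` in `L²(ℝ; ℂ²)`, with domain `H¹(ℝ \ Y; ℂ²)`. -/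
abbrev spinorDeriv (y : Fin n → ℝ) : Spinor (L2 (cutLine y)) →ₗ.[ℂ] Spinor (L2 (cutLine y)) :=
  opSum (weakDeriv (cutLine y)) (weakDeriv (cutLine y))

/-- The `c`-th component of an element of `H¹(ℝ \ Y; ℂ²)`. -/
def spinorComp (y : Fin n → ℝ) (c : Fin 2) : (spinorDeriv y).domain →ₗ[ℂ] H1 (cutLine y) :=
  ![opSumFst _ _, opSumSnd _ _] c

/-- In terms of the pair `(Ψ, Ψ')`, the vector of all `⟨ψ_c⟩_{y_k} ⊕ ⟨ψ_c'⟩_{y_k}` in `ℂ^{4n}`,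
where `c` is the component and `k` the point. -/
def tauHat (y : Fin n → ℝ) : ((spinorDeriv y).domain × (spinorDeriv y).domain) →ₗ[ℂ]
    EuclideanSpace ℂ (Fin 2 × Fin n × Fin 2) :=
  toEuclidean fun q =>
    ![mean y q.2.1 ∘ₗ spinorComp y q.1 ∘ₗ LinearMap.fst ℂ _ _,
      mean y q.2.1 ∘ₗ spinorComp y q.1 ∘ₗ LinearMap.snd ℂ _ _] q.2.2

/-- In terms of the pair `(Ψ, Ψ')`, the vector of all `[ψ_c']_{y_k} ⊕ [-ψ_c]_{y_k}` in `ℂ^{4n}`,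
where `c` is the component and `k` the point. -/
def rhoHat (y : Fin n → ℝ) : ((spinorDeriv y).domain × (spinorDeriv y).domain) →ₗ[ℂ]
    EuclideanSpace ℂ (Fin 2 × Fin n × Fin 2) :=
  toEuclidean fun q =>
    ![jump y q.2.1 ∘ₗ spinorComp y q.1 ∘ₗ LinearMap.snd ℂ _ _,
      -(jump y q.2.1 ∘ₗ spinorComp y q.1 ∘ₗ LinearMap.fst ℂ _ _)] q.2.2

/-- The Schrödinger operator `Ĥ_{Π,Θ}` in `L²(ℝ; ℂ²)`: `-d²/dx²` on `ℝ \ Y` on the domain of those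
`Ψ ∈ H²(ℝ \ Y; ℂ²)` for which the vector `rhoHat` of `Ψ` lies in `ran Π` and is mapped by `Θ` to
the projection by `Π` of the vector `tauHat` of `Ψ`. -/
def schrodingerPT (y : Fin n → ℝ)
    (b : BoundaryPair (EuclideanSpace ℂ (Fin 2 × Fin n × Fin 2))) :
    Spinor (L2 (cutLine y)) →ₗ.[ℂ] Spinor (L2 (cutLine y)) :=
  schrodinger (spinorDeriv y) (boundaryCond (rhoHat y) (tauHat y) b)

/-- The operator `-d²/dx²` in `L²(ℝ)` with domain
`{ψ ∈ H²(ℝ \ Y) : B (ψ) = 0, B' (ψ') = 0}`. -/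
def schrodingerB (y : Fin n → ℝ) {F F' : Type*} [AddCommGroup F] [Module ℂ F] [AddCommGroup F']
    [Module ℂ F'] (B : H1 (cutLine y) →ₗ[ℂ] F) (B' : H1 (cutLine y) →ₗ[ℂ] F') :
    L2 (cutLine y) →ₗ.[ℂ] L2 (cutLine y) :=
  schrodinger (weakDeriv (cutLine y)) ((LinearMap.ker B).prod (LinearMap.ker B'))

end Line

/-! ### The eye graph

The edges are `(-∞, y₁]`, `[y₁, y₂]`, `[y₂, y₃]`, `[y₃, ∞)`; the endpoints `y₁⁻, y₁⁺, y₂⁺` are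
glued to one vertex and the endpoints `y₂⁻, y₃⁻, y₃⁺` to the other. -/

section Eye

/-- Continuity at the two vertices:
`f(y₁⁻) = f(y₁⁺) = f(y₂⁺)` and `f(y₂⁻) = f(y₃⁻) = f(y₃⁺)`. -/
def eyeCont (y : Fin 3 → ℝ) : Submodule ℂ (H1 (cutLine y)) where
  carrier := {f | (valL y 0 f = valR y 0 f ∧ valR y 0 f = valR y 1 f) ∧
    (valL y 1 f = valL y 2 f ∧ valL y 2 f = valR y 2 f)}
  zero_mem' := by simp
  add_mem' := by
    rintro f g ⟨⟨h1, h2⟩, h3, h4⟩ ⟨⟨k1, k2⟩, k3, k4⟩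
    simp only [Set.mem_ofPred_eq, map_add]
    exact ⟨⟨by rw [h1, k1], by rw [h2, k2]⟩, by rw [h3, k3], by rw [h4, k4]⟩
  smul_mem' := by
    rintro c f ⟨⟨h1, h2⟩, h3, h4⟩
    simp only [Set.mem_ofPred_eq, map_smul]
    exact ⟨⟨by rw [h1], by rw [h2]⟩, by rw [h3], by rw [h4]⟩

/-- Balance at the two vertices:
`f(y₁⁻) - f(y₁⁺) - f(y₂⁺) = 0` and `f(y₂⁻) + f(y₃⁻) - f(y₃⁺) = 0`. -/
def eyeFlux (y : Fin 3 → ℝ) : Submodule ℂ (H1 (cutLine y)) where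
  carrier := {f | valL y 0 f - valR y 0 f - valR y 1 f = 0 ∧
    valL y 1 f + valL y 2 f - valR y 2 f = 0}
  zero_mem' := by simp
  add_mem' := by
    rintro f g ⟨h1, h2⟩ ⟨k1, k2⟩
    simp only [Set.mem_ofPred_eq, map_add]
    exact ⟨by linear_combination h1 + k1, by linear_combination h2 + k2⟩
  smul_mem' := by
    rintro c f ⟨h1, h2⟩
    simp only [Set.mem_ofPred_eq, map_smul, smul_eq_mul]
    exact ⟨by linear_combination c * h1, by linear_combination c * h2⟩

/-- The Dirac operator on the eye graph with Kirchhoff-type conditions. -/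
def eyeDirac (y : Fin 3 → ℝ) : Spinor (L2 (cutLine y)) →ₗ.[ℂ] Spinor (L2 (cutLine y)) :=
  dirac (weakDeriv (cutLine y)) ((eyeCont y).prod (eyeFlux y))

/-- The Schrödinger operator on the eye graph with Kirchhoff conditions. -/
def eyeSchrodingerK (y : Fin 3 → ℝ) : L2 (cutLine y) →ₗ.[ℂ] L2 (cutLine y) :=
  schrodinger (weakDeriv (cutLine y)) ((eyeCont y).prod (eyeFlux y))

/-- The Schrödinger operator on the eye graph with the reversed Kirchhoff conditions, in which
the roles of `ψ` and `ψ'` are exchanged. -/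
def eyeSchrodingerKstar (y : Fin 3 → ℝ) : L2 (cutLine y) →ₗ.[ℂ] L2 (cutLine y) :=
  schrodinger (weakDeriv (cutLine y)) ((eyeFlux y).prod (eyeCont y))

/-- The matrix of the orthogonal projector `Π` in `ℂ⁶` for the eye graph; the coordinates are
ordered as `(k, j) ↦ 2 k + j`. -/
def eyePiMatrix : Matrix (Fin 3 × Fin 2) (Fin 3 × Fin 2) ℂ :=
  ((1 / 3 : ℂ) • (!![2, 0, -1, 0, -1, 0;
                     0, 0, 0, 0, 0, 0;
                     -1, 0, 2, 0, -1, 0;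
                     0, 0, 0, 3, 0, 0;
                     -1, 0, -1, 0, 2, 0;
                     0, 0, 0, 0, 0, 0] : Matrix (Fin (3 * 2)) (Fin (3 * 2)) ℂ)).submatrix
    finProdFinEquiv finProdFinEquiv

/-- The matrix of `Θ` in `ℂ⁶` for the eye graph. -/
def eyeThetaMatrix : Matrix (Fin 3 × Fin 2) (Fin 3 × Fin 2) ℂ :=
  ((Complex.I / 2) • (!![0, 0, 0, -1, 0, 0;
                         0, 0, 0, 0, 0, 0;
                         0, 0, 0, 0, 0, 0;
                         1, 0, 0, 0, -1, 0;
                         0, 0, 0, 1, 0, 0;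
                         0, 0, 0, 0, 0, 0] : Matrix (Fin (3 * 2)) (Fin (3 * 2)) ℂ)).submatrix
    finProdFinEquiv finProdFinEquiv

/-- The projector with matrix `eyePiMatrix`. -/
def eyePi : EuclideanSpace ℂ (Fin 3 × Fin 2) →ₗ[ℂ] EuclideanSpace ℂ (Fin 3 × Fin 2) :=
  Matrix.toEuclideanLin eyePiMatrix

/-- The operator in `ℂ⁶` with matrix `eyeThetaMatrix`. -/
def eyeTheta : EuclideanSpace ℂ (Fin 3 × Fin 2) →ₗ[ℂ] EuclideanSpace ℂ (Fin 3 × Fin 2) :=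
  Matrix.toEuclideanLin eyeThetaMatrix

end Eye

/-! ### Arbitrary finite metric graphs -/

/-- A metric graph with edge set `E` and vertex set `V`. The edge `e` is the interval
`(lo e, hi e)`, bounded or unbounded; every finite end of an edge is attached to a vertex. The left
ends are indexed by the edges with `lo e ≠ -∞` and the right ends by those with `hi e ≠ +∞`. -/
structure MetricGraph (E V : Type*) where
  /-- the left end of an edge -/
  lo : E → EReal
  /-- the right end of an edge -/
  hi : E → EReal
  lo_lt_hi : ∀ e, lo e < hi e
  /-- the vertex to which an endpoint is attached -/
  vert : {e // lo e ≠ ⊥} ⊕ {e // hi e ≠ ⊤} → V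

namespace MetricGraph

variable {E V : Type*} (G : MetricGraph E V)

/-- The endpoints of the edges: left ends and right ends. -/
abbrev Endpoint : Type _ := {e // G.lo e ≠ ⊥} ⊕ {e // G.hi e ≠ ⊤}

/-- The open interval `(lo e, hi e)`. -/
def edge (e : E) : Opens ℝ where
  carrier := {x | G.lo e < (x : EReal) ∧ (x : EReal) < G.hi e}
  is_open' := (isOpen_lt continuous_const continuous_coe_real_ereal).inter
    (isOpen_lt continuous_coe_real_ereal continuous_const)

theorem edge_mem_right (e : E) (h : G.lo e ≠ ⊥) :
    (G.edge e : Set ℝ) ∈ 𝓝[>] (G.lo e).toReal := by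
  have hl : ((G.lo e).toReal : EReal) = G.lo e :=
    EReal.coe_toReal (ne_top_of_lt (G.lo_lt_hi e)) h
  have h1 : {x : ℝ | (x : EReal) < G.hi e} ∈ 𝓝 (G.lo e).toReal :=
    (isOpen_lt continuous_coe_real_ereal continuous_const).mem_nhds
      (by rw [Set.mem_ofPred_eq, hl]; exact G.lo_lt_hi e)
  filter_upwards [mem_nhdsWithin_of_mem_nhds h1, self_mem_nhdsWithin] with x hx hx'
  refine ⟨?_, hx⟩
  rw [← hl]
  exact EReal.coe_lt_coe_iff.2 hx'

theorem edge_mem_left (e : E) (h : G.hi e ≠ ⊤) :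
    (G.edge e : Set ℝ) ∈ 𝓝[<] (G.hi e).toReal := by
  have hl : ((G.hi e).toReal : EReal) = G.hi e :=
    EReal.coe_toReal h (ne_bot_of_gt (G.lo_lt_hi e))
  have h1 : {x : ℝ | G.lo e < (x : EReal)} ∈ 𝓝 (G.hi e).toReal :=
    (isOpen_lt continuous_const continuous_coe_real_ereal).mem_nhds
      (by rw [Set.mem_ofPred_eq, hl]; exact G.lo_lt_hi e)
  filter_upwards [mem_nhdsWithin_of_mem_nhds h1, self_mem_nhdsWithin] with x hx hx'
  refine ⟨hx, ?_⟩
  rw [← hl]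
  exact EReal.coe_lt_coe_iff.2 hx'

variable [Fintype E]

/-- `L²(G) = ⨁_e L²(e)`. -/
abbrev L2 : Type _ := PiLp 2 fun e => QGraph.L2 (G.edge e)

/-- The edgewise weak derivative in `L²(G)`, with domain `H¹(G) = ⨁_e H¹(e)`. -/
def deriv : G.L2 →ₗ.[ℂ] G.L2 where
  domain :=
    { carrier := {f | ∀ e, f e ∈ H1 (G.edge e)}
      zero_mem' := fun e => (H1 (G.edge e)).zero_mem
      add_mem' := fun h h' e => (H1 (G.edge e)).add_mem (h e) (h' e)
      smul_mem' := fun c _ h e => (H1 (G.edge e)).smul_mem c (h e) }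
  toFun :=
    { toFun := fun f => WithLp.toLp 2 fun e => weakDeriv (G.edge e) ⟨f.1 e, f.2 e⟩
      map_add' := fun f g => by
        refine congrArg (WithLp.toLp 2) (funext fun e => ?_)
        exact (weakDeriv (G.edge e)).map_add ⟨f.1 e, f.2 e⟩ ⟨g.1 e, g.2 e⟩
      map_smul' := fun c f => by
        refine congrArg (WithLp.toLp 2) (funext fun e => ?_)
        exact (weakDeriv (G.edge e)).map_smul c ⟨f.1 e, f.2 e⟩ }

/-- The restriction to the edge `e`, as a map `H¹(G) → H¹(e)`. -/
def restr (e : E) : G.deriv.domain →ₗ[ℂ] H1 (G.edge e) where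
  toFun f := ⟨f.1 e, f.2 e⟩
  map_add' _ _ := rfl
  map_smul' _ _ := rfl

/-- The boundary value at an endpoint `y`: `f(y⁺)` at a left end, `f(y⁻)` at a right end. -/
def val : G.Endpoint → G.deriv.domain →ₗ[ℂ] ℂ
  | Sum.inl e => rightTrace (G.edge e) (G.lo e).toReal (G.edge_mem_right e e.2) ∘ₗ G.restr e
  | Sum.inr e => leftTrace (G.edge e) (G.hi e).toReal (G.edge_mem_left e e.2) ∘ₗ G.restr e

/-- The sign convention: `-1` at a left end and `+1` at a right end. -/
def sign : G.Endpoint → ℂ := Sum.elim (fun _ => -1) (fun _ => 1)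

/-- The functions that are continuous at any vertex. -/
def cont : Submodule ℂ G.deriv.domain where
  carrier := {f | ∀ p q : G.Endpoint, G.vert p = G.vert q → G.val p f = G.val q f}
  zero_mem' := fun p q _ => by simp
  add_mem' := fun {f g} hf hg p q h => by rw [map_add, map_add, hf p q h, hg p q h]
  smul_mem' := fun c f hf p q h => by rw [map_smul, map_smul, hf p q h]

open Classical in
/-- The functions whose signed sum of boundary values vanishes at any vertex. -/
def flux : Submodule ℂ G.deriv.domain where
  carrier := {f | ∀ v : V, ∑ p : G.Endpoint with G.vert p = v, G.sign p * G.val p f = 0}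
  zero_mem' := fun v => by simp
  add_mem' := fun {f g} hf hg v => by
    simp only [map_add, mul_add, Finset.sum_add_distrib]
    rw [hf v, hg v, add_zero]
  smul_mem' := fun c f hf v => by
    simp only [map_smul, smul_eq_mul, mul_left_comm _ c, ← Finset.mul_sum]
    rw [hf v, mul_zero]

/-- The Dirac operator on `G` with Kirchhoff-type conditions: `ψ₁` is continuous at any vertex and
the signed sum of `ψ₂` vanishes at any vertex. -/
def diracK : Spinor G.L2 →ₗ.[ℂ] Spinor G.L2 := dirac G.deriv (G.cont.prod G.flux)

/-- The Schrödinger operator on `G` with Kirchhoff conditions: `ψ` is continuous at any vertex and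
the signed sum of `ψ'` vanishes at any vertex. -/
def schrodingerK : G.L2 →ₗ.[ℂ] G.L2 := schrodinger G.deriv (G.cont.prod G.flux)

/-- The Schrödinger operator on `G` with reversed Kirchhoff conditions: `ψ'` is continuous at any
vertex and the signed sum of `ψ` vanishes at any vertex. -/
def schrodingerKstar : G.L2 →ₗ.[ℂ] G.L2 := schrodinger G.deriv (G.flux.prod G.cont)

end MetricGraph

end QGraph

end

/-!
All Dirac operators here are of the form `-i σ₁ d/dx + σ₃ / 2`, where `d/dx` is the maximal
derivative in `L²` of an open subset of the line (or of a direct sum of such spaces, for a graph),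
with a subspace `C` of boundary conditions.

Functions in `H¹` have absolutely continuous representatives, and integration by parts
(`greenForm_cutLine`, `MetricGraph.greenForm_deriv`) expresses the boundary form
`⟪f', g⟫ + ⟪f, g'⟫` through finitely many one-sided boundary values; there is no contribution from
infinity because an integrable function with a limit at infinity tends to zero. The maximal
derivative is minus the adjoint of its restriction to functions with zero boundary values
(`exists_weakDeriv_eq`), so a Dirac operator is self-adjoint as soon as `C` is Lagrangian, i.e.
equal to its own annihilator in the boundary form (`isSelfAdjoint_dirac`).

On the line the boundary form of the Dirac operator is a multiple of
`⟪ρ Ψ, τ Φ⟫ - ⟪τ Ψ, ρ Φ⟫`, and `(ρ, τ)` is onto because boundary values can be prescribed.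
The conditions given by a couple `(Π, Θ)` are Lagrangian (`mem_boundaryCond_iff`), and conversely
any Lagrangian subspace is given by a couple (`exists_boundaryCond_eq`). On a metric graph the
Kirchhoff conditions are Lagrangian because continuity and vanishing of the signed sums annihilate
each other vertex by vertex (`MetricGraph.mem_cont_prod_flux_iff`). The eye graph is a case of
point interactions on the line, by an explicit computation of `Π` and `Θ`
(`boundaryCond_eyePair`).

If the conditions decouple into `ψ₁ ∈ M₁` and `ψ₂ ∈ M₂` then the first-order terms in the square of
the Dirac operator cancel, and `D²` is the direct sum of `-d²/dx² + 1/4` with the conditions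
`ψ ∈ M₁, ψ' ∈ M₂` and with the conditions `ψ ∈ M₂, ψ' ∈ M₁` (`opComp_dirac_prod`). The square of a
self-adjoint operator is self-adjoint (`IsSelfAdjoint.opComp_self`), hence so are both summands
(`isSelfAdjoint_schrodinger_of_dirac`). Finally, `M₁` and `M₂` are each other's annihilators, so the
conditions on the direct sum are Lagrangian for the second derivative and are given by a couple
in `ℂ⁴ⁿ` (`exists_boundaryCond_eq_crossedCond`).
-/

namespace QGraph

/-! ### Criteria for self-adjointness -/

section SelfAdjoint

variable {𝓗 : Type*} [NormedAddCommGroup 𝓗] [InnerProductSpace ℂ 𝓗]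

local notation "⟪" x ", " y "⟫" => inner ℂ x y

theorem inner_spinor (Ψ Φ : Spinor 𝓗) :
    ⟪Ψ, Φ⟫ = ⟪Ψ.fst, Φ.fst⟫ + ⟪Ψ.snd, Φ.snd⟫ := rfl

/-- A densely defined symmetric operator is self-adjoint as soon as the domain of its adjoint is
not larger than its own. -/
theorem isSelfAdjoint_of_forall_mem_domain [CompleteSpace 𝓗] {T : 𝓗 →ₗ.[ℂ] 𝓗}
    (hd : Dense (T.domain : Set 𝓗))
    (hs : ∀ x y : T.domain, ⟪T x, (y : 𝓗)⟫ = ⟪(x : 𝓗), T y⟫)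
    (hm : ∀ v w : 𝓗, (∀ x : T.domain, ⟪w, (x : 𝓗)⟫ = ⟪v, T x⟫) → v ∈ T.domain) :
    IsSelfAdjoint T := by
  rw [LinearPMap.isSelfAdjoint_def]
  have hle : T ≤ T.adjoint := LinearPMap.IsFormalAdjoint.le_adjoint hd hs
  refine (LinearPMap.eq_of_le_of_domain_eq hle (le_antisymm hle.1 fun v hv => ?_)).symm
  exact hm v (T.adjoint ⟨v, hv⟩) fun x => T.adjoint_isFormalAdjoint hd ⟨v, hv⟩ x

theorem IsSelfAdjoint.inner_apply_left [CompleteSpace 𝓗] {T : 𝓗 →ₗ.[ℂ] 𝓗} (h : IsSelfAdjoint T)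
    (x y : T.domain) : ⟪T x, (y : 𝓗)⟫ = ⟪(x : 𝓗), T y⟫ := by
  have := T.adjoint_isFormalAdjoint h.dense_domain
  rw [LinearPMap.isSelfAdjoint_def.1 h] at this
  exact this x y

/-- The variational description of the domain: if `x ↦ ⟪v, T x⟫` is represented by `w` on the
domain then `v` is in the domain and `T v = w`. -/
theorem IsSelfAdjoint.exists_apply_eq [CompleteSpace 𝓗] {T : 𝓗 →ₗ.[ℂ] 𝓗} (h : IsSelfAdjoint T)
    {v w : 𝓗} (hvw : ∀ x : T.domain, ⟪w, (x : 𝓗)⟫ = ⟪v, T x⟫) :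
    ∃ hv : v ∈ T.domain, T ⟨v, hv⟩ = w := by
  have hv : v ∈ T.adjoint.domain := LinearPMap.mem_adjoint_domain_of_exists v ⟨w, hvw⟩
  have hw : T.adjoint ⟨v, hv⟩ = w := LinearPMap.adjoint_apply_eq h.dense_domain ⟨v, hv⟩ hvw
  have key : ∀ S : 𝓗 →ₗ.[ℂ] 𝓗, S = T → (∃ hv : v ∈ S.domain, S ⟨v, hv⟩ = w) →
      ∃ hv : v ∈ T.domain, T ⟨v, hv⟩ = w := by
    rintro S rfl h; exact h
  exact key _ (LinearPMap.isSelfAdjoint_def.1 h) ⟨hv, hw⟩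

/-- A symmetric positive operator `T` for which `T + 1` is onto is self-adjoint. Density of the
domain is automatic: a vector `x + T x` orthogonal to the domain satisfies
`‖x‖² + ⟪T x, x⟫ = 0`. -/
theorem isSelfAdjoint_of_surjective_add_one [CompleteSpace 𝓗] {T : 𝓗 →ₗ.[ℂ] 𝓗}
    (hs : ∀ x y : T.domain, ⟪T x, (y : 𝓗)⟫ = ⟪(x : 𝓗), T y⟫)
    (hp : ∀ x : T.domain, 0 ≤ (⟪T x, (x : 𝓗)⟫).re)
    (hr : ∀ u : 𝓗, ∃ x : T.domain, (x : 𝓗) + T x = u) : IsSelfAdjoint T := by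
  have hd : Dense (T.domain : Set 𝓗) := by
    rw [Submodule.dense_iff_topologicalClosure_eq_top,
      Submodule.topologicalClosure_eq_top_iff, Submodule.eq_bot_iff]
    intro u hu
    obtain ⟨x, rfl⟩ := hr u
    have h0 := Submodule.inner_left_of_mem_orthogonal x.2 hu
    have h1 := congrArg Complex.re h0
    rw [inner_add_left, Complex.add_re, Complex.zero_re] at h1
    have h2 : 0 ≤ (⟪(x : 𝓗), (x : 𝓗)⟫).re := inner_self_nonneg (𝕜 := ℂ)
    have h3 : (⟪(x : 𝓗), (x : 𝓗)⟫).re = 0 := le_antisymm (by linarith [hp x]) h2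
    have h4 : (x : 𝓗) = 0 := re_inner_self_nonpos (𝕜 := ℂ) |>.1 h3.le
    have h5 : x = 0 := Subtype.ext h4
    rw [h5, T.map_zero]; simp
  refine isSelfAdjoint_of_forall_mem_domain hd hs fun v w hvw => ?_
  obtain ⟨z, hz⟩ := hr (v + w)
  have : v - z = 0 := by
    obtain ⟨x, hx⟩ := hr (v - z)
    refine inner_self_eq_zero (𝕜 := ℂ) |>.1 ?_
    nth_rewrite 2 [← hx]
    rw [inner_add_right, inner_sub_left, inner_sub_left, ← hvw x, ← hs z x]
    have := congrArg (fun t => ⟪t, (x : 𝓗)⟫) hz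
    simp only [inner_add_left] at this
    linear_combination -this
  rw [sub_eq_zero] at this
  rw [this]; exact z.2

/-- The square of a self-adjoint operator is self-adjoint. That `1 + T²` is onto is seen by
decomposing `(u, 0)` along the (closed) graph of `T` and its orthogonal complement. -/
theorem IsSelfAdjoint.opComp_self [CompleteSpace 𝓗] {T : 𝓗 →ₗ.[ℂ] 𝓗} (h : IsSelfAdjoint T) :
    IsSelfAdjoint (opComp T T) := by
  have hs : ∀ x y : (opComp T T).domain,
      ⟪opComp T T x, (y : 𝓗)⟫ = ⟪T ⟨x, x.2.1⟩, T ⟨y, y.2.1⟩⟫ := fun x y =>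
    IsSelfAdjoint.inner_apply_left h ⟨T ⟨x, x.2.1⟩, x.2.2⟩ ⟨y, y.2.1⟩
  have hs' : ∀ x y : (opComp T T).domain,
      ⟪(x : 𝓗), opComp T T y⟫ = ⟪T ⟨x, x.2.1⟩, T ⟨y, y.2.1⟩⟫ := fun x y =>
    (IsSelfAdjoint.inner_apply_left h ⟨x, x.2.1⟩ ⟨T ⟨y, y.2.1⟩, y.2.2⟩).symm
  refine isSelfAdjoint_of_surjective_add_one (fun x y => (hs x y).trans (hs' x y).symm)
    (fun x => ?_) fun u => ?_
  · rw [hs]; exact inner_self_nonneg (𝕜 := ℂ)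
  · let K : Submodule ℂ (WithLp 2 (𝓗 × 𝓗)) :=
      T.graph.comap (WithLp.linearEquiv 2 ℂ (𝓗 × 𝓗)).toLinearMap
    have hK : IsClosed (K : Set (WithLp 2 (𝓗 × 𝓗))) :=
      h.isClosed.preimage (WithLp.prod_continuous_ofLp 2 𝓗 𝓗)
    have : CompleteSpace K := hK.completeSpace_coe
    obtain ⟨p, hp, q, hq, hpq⟩ := K.exists_add_mem_mem_orthogonal (WithLp.toLp 2 (u, (0 : 𝓗)))
    obtain ⟨x, hx1, hx2⟩ := (LinearPMap.mem_graph_iff T).1 hp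
    have hq' : ∀ y : T.domain, ⟪-q.fst, (y : 𝓗)⟫ = ⟪q.snd, T y⟫ := by
      intro y
      have hy : WithLp.toLp 2 ((y : 𝓗), T y) ∈ K := T.mem_graph y
      have := Submodule.inner_left_of_mem_orthogonal hy hq
      rw [inner_spinor] at this
      rw [inner_neg_left]
      exact neg_eq_of_add_eq_zero_right this
    obtain ⟨hqd, hqT⟩ := IsSelfAdjoint.exists_apply_eq h hq'
    have e1 : u = (x : 𝓗) + q.fst := by
      have := congrArg WithLp.fst hpq
      rw [WithLp.add_fst] at this
      rw [hx1]; exact this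
    have e2 : T x = -q.snd := by
      have := congrArg WithLp.snd hpq
      rw [WithLp.add_snd] at this
      rw [hx2]; exact eq_neg_of_add_eq_zero_left this.symm
    have hx' : T x ∈ T.domain := by rw [e2]; exact T.domain.neg_mem hqd
    refine ⟨⟨x, x.2, hx'⟩, ?_⟩
    have e3 : (⟨T x, hx'⟩ : T.domain) = -⟨q.snd, hqd⟩ := Subtype.ext e2
    change (x : 𝓗) + T ⟨T x, hx'⟩ = u
    rw [e3, T.map_neg, hqT, neg_neg, e1]

/-- The summands of a self-adjoint direct sum, shifted by real constants, are self-adjoint. -/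
theorem IsSelfAdjoint.of_opSum_opAddConst [CompleteSpace 𝓗] {A B : 𝓗 →ₗ.[ℂ] 𝓗} {c : ℂ}
    (hc : (starRingEnd ℂ) c = c)
    (h : IsSelfAdjoint (opSum (opAddConst A c) (opAddConst B c))) :
    IsSelfAdjoint A ∧ IsSelfAdjoint B := by
  have hd := h.dense_domain
  set S := opSum (opAddConst A c) (opAddConst B c) with hS
  have hf : Dense ((A.domain : Set 𝓗)) := by
    have hr : DenseRange (WithLp.fstL 2 ℂ 𝓗 𝓗) :=
      Function.Surjective.denseRange fun x => ⟨WithLp.toLp 2 (x, 0), rfl⟩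
    refine (hr.dense_image (WithLp.fstL 2 ℂ 𝓗 𝓗).continuous hd).mono ?_
    · rintro _ ⟨Ψ, hΨ, rfl⟩; exact hΨ.1
  have hg : Dense ((B.domain : Set 𝓗)) := by
    have hr : DenseRange (WithLp.sndL 2 ℂ 𝓗 𝓗) :=
      Function.Surjective.denseRange fun x => ⟨WithLp.toLp 2 (0, x), rfl⟩
    refine (hr.dense_image (WithLp.sndL 2 ℂ 𝓗 𝓗).continuous hd).mono ?_
    · rintro _ ⟨Ψ, hΨ, rfl⟩; exact hΨ.2
  let i₁ : A.domain → S.domain := fun x => ⟨WithLp.toLp 2 (x, 0), x.2, B.domain.zero_mem⟩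
  let i₂ : B.domain → S.domain := fun x => ⟨WithLp.toLp 2 (0, x), A.domain.zero_mem, x.2⟩
  have hi₁ : ∀ x, S (i₁ x) = WithLp.toLp 2 (c • (x : 𝓗) + A x, 0) := fun x => by
    refine congrArg (WithLp.toLp 2) (Prod.ext rfl ?_)
    exact (opAddConst B c).map_zero
  have hi₂ : ∀ x, S (i₂ x) = WithLp.toLp 2 (0, c • (x : 𝓗) + B x) := fun x => by
    refine congrArg (WithLp.toLp 2) (Prod.ext ?_ rfl)
    exact (opAddConst A c).map_zero
  constructor
  · refine isSelfAdjoint_of_forall_mem_domain hf (fun x y => ?_) fun v w hvw => ?_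
    · have := IsSelfAdjoint.inner_apply_left h (i₁ x) (i₁ y)
      simp only [hi₁, inner_spinor, WithLp.toLp_fst, WithLp.toLp_snd, i₁, inner_add_left,
        inner_add_right,
        inner_smul_left, inner_smul_right, hc, inner_zero_left, add_zero] at this
      exact add_left_cancel this
    · have : ∀ Ψ : S.domain, ⟪WithLp.toLp 2 (c • v + w, (0 : 𝓗)), (Ψ : Spinor 𝓗)⟫ =
          ⟪WithLp.toLp 2 (v, (0 : 𝓗)), S Ψ⟫ := fun Ψ => by
        have e := hvw ⟨Ψ.1.fst, Ψ.2.1⟩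
        change _ = ⟪WithLp.toLp 2 (v, (0 : 𝓗)), WithLp.toLp 2
          (c • Ψ.1.fst + A ⟨Ψ.1.fst, Ψ.2.1⟩, c • Ψ.1.snd + B ⟨Ψ.1.snd, Ψ.2.2⟩)⟫
        simp only [inner_spinor, WithLp.toLp_fst, WithLp.toLp_snd, inner_add_left, inner_add_right,
          inner_smul_left, inner_smul_right, hc, inner_zero_left, mul_zero, add_zero]
        exact congrArg (fun t => c * ⟪v, Ψ.1.fst⟫ + t) e
      exact (IsSelfAdjoint.exists_apply_eq h this).1.1
  · refine isSelfAdjoint_of_forall_mem_domain hg (fun x y => ?_) fun v w hvw => ?_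
    · have := IsSelfAdjoint.inner_apply_left h (i₂ x) (i₂ y)
      simp only [hi₂, inner_spinor, WithLp.toLp_fst, WithLp.toLp_snd, i₂, inner_add_left,
        inner_add_right,
        inner_smul_left, inner_smul_right, hc, inner_zero_left, zero_add] at this
      exact add_left_cancel this
    · have : ∀ Ψ : S.domain, ⟪WithLp.toLp 2 ((0 : 𝓗), c • v + w), (Ψ : Spinor 𝓗)⟫ =
          ⟪WithLp.toLp 2 ((0 : 𝓗), v), S Ψ⟫ := fun Ψ => by
        have e := hvw ⟨Ψ.1.snd, Ψ.2.2⟩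
        change _ = ⟪WithLp.toLp 2 ((0 : 𝓗), v), WithLp.toLp 2
          (c • Ψ.1.fst + A ⟨Ψ.1.fst, Ψ.2.1⟩, c • Ψ.1.snd + B ⟨Ψ.1.snd, Ψ.2.2⟩)⟫
        simp only [inner_spinor, WithLp.toLp_fst, WithLp.toLp_snd, inner_add_left, inner_add_right,
          inner_smul_left, inner_smul_right, hc, inner_zero_left, mul_zero, zero_add]
        exact congrArg (fun t => c * ⟪v, Ψ.1.snd⟫ + t) e
      exact (IsSelfAdjoint.exists_apply_eq h this).1.2

/-! ### Dirac operators with Lagrangian boundary conditions -/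

variable {d : 𝓗 →ₗ.[ℂ] 𝓗}

theorem mem_dirac_domain {C : Submodule ℂ (d.domain × d.domain)} {Ψ : Spinor 𝓗} :
    Ψ ∈ (dirac d C).domain ↔ ∃ (h₁ : Ψ.fst ∈ d.domain) (h₂ : Ψ.snd ∈ d.domain),
      ((⟨Ψ.fst, h₁⟩, ⟨Ψ.snd, h₂⟩) : d.domain × d.domain) ∈ C := by
  constructor
  · rintro ⟨⟨Φ, hΦ, rfl⟩, h⟩
    exact ⟨h.1, h.2, hΦ⟩
  · rintro ⟨h₁, h₂, hC⟩
    exact ⟨⟨⟨Ψ, h₁, h₂⟩, hC, rfl⟩, h₁, h₂⟩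

theorem dirac_apply {C : Submodule ℂ (d.domain × d.domain)} (Ψ : (dirac d C).domain)
    (h₁ : Ψ.1.fst ∈ d.domain) (h₂ : Ψ.1.snd ∈ d.domain) :
    dirac d C Ψ = WithLp.toLp 2
      (-Complex.I • d ⟨Ψ.1.snd, h₂⟩ + (1 / 2 : ℂ) • Ψ.1.fst,
        -Complex.I • d ⟨Ψ.1.fst, h₁⟩ - (1 / 2 : ℂ) • Ψ.1.snd) := rfl

/-- The boundary form of the derivative, `⟪f', h⟫ + ⟪f, h'⟫`. Integration by parts shows that it
only depends on boundary values. -/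
noncomputable def greenForm (d : 𝓗 →ₗ.[ℂ] 𝓗) (f h : d.domain) : ℂ := ⟪d f, (h : 𝓗)⟫ + ⟪(f : 𝓗), d h⟫

/-- If the maximal derivative `d` is minus the adjoint of its restriction to `N` then a Dirac
operator whose boundary conditions `C ⊇ N × N` form a Lagrangian subspace, i.e. equal their own
annihilator in the boundary form of `diracMax d`, is self-adjoint. -/
theorem isSelfAdjoint_dirac [CompleteSpace 𝓗] {N : Set d.domain}
    (hmax : ∀ v w : 𝓗, (∀ f ∈ N, ⟪(f : 𝓗), w⟫ = -⟪d f, v⟫) → ∃ hv : v ∈ d.domain, d ⟨v, hv⟩ = w)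
    {C : Submodule ℂ (d.domain × d.domain)} (hN : ∀ f ∈ N, (f, 0) ∈ C ∧ (0, f) ∈ C)
    (hC : ∀ q, q ∈ C ↔ ∀ p ∈ C, greenForm d p.1 q.2 + greenForm d p.2 q.1 = 0) :
    IsSelfAdjoint (dirac d C) := by
  -- lifts of pairs of functions satisfying the boundary conditions to the domain
  let i : C → (dirac d C).domain := fun p =>
    ⟨WithLp.toLp 2 (p.1.1, p.1.2), mem_dirac_domain.2 ⟨p.1.1.2, p.1.2.2, p.2⟩⟩
  have hi : ∀ p : C, dirac d C (i p) = WithLp.toLp 2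
      (-Complex.I • d p.1.2 + (1 / 2 : ℂ) • (p.1.1 : 𝓗),
        -Complex.I • d p.1.1 - (1 / 2 : ℂ) • (p.1.2 : 𝓗)) := fun p => rfl
  have hi' : ∀ Ψ : (dirac d C).domain, ∃ p : C, i p = Ψ := fun Ψ => by
    obtain ⟨h₁, h₂, hΨ⟩ := mem_dirac_domain.1 Ψ.2
    exact ⟨⟨_, hΨ⟩, rfl⟩
  have hhalf : (starRingEnd ℂ) (2⁻¹ : ℂ) = 2⁻¹ := by
    rw [map_inv₀, map_ofNat]
  have hgreen : ∀ (p : C) (q : d.domain × d.domain),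
      ⟪dirac d C (i p), WithLp.toLp 2 ((q.1 : 𝓗), (q.2 : 𝓗))⟫ -
        ⟪((i p : Spinor 𝓗)), WithLp.toLp 2 (-Complex.I • d q.2 + (1 / 2 : ℂ) • (q.1 : 𝓗),
        -Complex.I • d q.1 - (1 / 2 : ℂ) • (q.2 : 𝓗))⟫ =
      Complex.I * (greenForm d p.1.1 q.2 + greenForm d p.1.2 q.1) := fun p q => by
    rw [hi]
    simp only [i, greenForm, inner_spinor, WithLp.toLp_fst, WithLp.toLp_snd, inner_add_left,
      inner_add_right, inner_sub_left,
      inner_sub_right, inner_smul_left, inner_smul_right, map_neg, Complex.conj_I, neg_neg, one_div,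
      hhalf]
    ring
  refine isSelfAdjoint_of_forall_mem_domain ?_ (fun x y => ?_) fun v w hvw => ?_
  · rw [Submodule.dense_iff_topologicalClosure_eq_top,
      Submodule.topologicalClosure_eq_top_iff, Submodule.eq_bot_iff]
    intro u hu
    have h0 : ∀ z : 𝓗, (∀ f ∈ N, ⟪(f : 𝓗), z⟫ = 0) → z = 0 := fun z hz => by
      obtain ⟨hv, h⟩ := hmax 0 z fun f hf => by rw [hz f hf, inner_zero_right, neg_zero]
      rw [← h]
      exact d.map_zero
    have h1 : u.fst = 0 := h0 _ fun f hf => by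
      have := Submodule.inner_right_of_mem_orthogonal (i ⟨_, (hN f hf).1⟩).2 hu
      simpa [i, inner_spinor] using this
    have h2 : u.snd = 0 := h0 _ fun f hf => by
      have := Submodule.inner_right_of_mem_orthogonal (i ⟨_, (hN f hf).2⟩).2 hu
      simpa [i, inner_spinor] using this
    exact WithLp.ofLp_injective 2 (Prod.ext h1 h2)
  · obtain ⟨p, rfl⟩ := hi' x
    obtain ⟨q, rfl⟩ := hi' y
    have := hgreen p q.1
    rw [(hC q.1).1 q.2 p p.2, mul_zero, sub_eq_zero] at this
    exact this
  · have hvw' : ∀ p : C, ⟪((i p : Spinor 𝓗)), w⟫ = ⟪dirac d C (i p), v⟫ := fun p => by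
      rw [← inner_conj_symm, hvw (i p), inner_conj_symm]
    -- `i w = (v₂' + i v₁ / 2, v₁' - i v₂ / 2)` recovers the derivatives of `v`
    obtain ⟨h₁, e₁⟩ := hmax v.fst (Complex.I • (w.snd + (1 / 2 : ℂ) • v.snd)) fun f hf => by
      have := hvw' ⟨_, (hN f hf).2⟩
      rw [hi] at this
      simp only [i, inner_spinor, WithLp.toLp_fst, WithLp.toLp_snd, inner_add_left,
        inner_sub_left, inner_smul_left,
        map_neg, Complex.conj_I, neg_neg, one_div, hhalf, ZeroMemClass.coe_zero, inner_zero_left,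
        d.map_zero, mul_zero, zero_add, zero_sub, add_zero] at this
      simp only [inner_smul_right, inner_add_right, one_div]
      rw [this]
      linear_combination ⟪d f, v.fst⟫ * Complex.I_mul_I
    obtain ⟨h₂, e₂⟩ := hmax v.snd (Complex.I • (w.fst - (1 / 2 : ℂ) • v.fst)) fun f hf => by
      have := hvw' ⟨_, (hN f hf).1⟩
      rw [hi] at this
      simp only [i, inner_spinor, WithLp.toLp_fst, WithLp.toLp_snd, inner_add_left,
        inner_sub_left, inner_smul_left,
        map_neg, Complex.conj_I, neg_neg, one_div, hhalf, ZeroMemClass.coe_zero, inner_zero_left,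
        d.map_zero, mul_zero, zero_add, sub_zero, add_zero] at this
      simp only [inner_smul_right, inner_sub_right, one_div]
      rw [this]
      linear_combination ⟪d f, v.snd⟫ * Complex.I_mul_I
    refine mem_dirac_domain.2 ⟨h₁, h₂, (hC _).2 fun p hp => ?_⟩
    have h := hgreen ⟨p, hp⟩ (⟨v.fst, h₁⟩, ⟨v.snd, h₂⟩)
    rw [e₁, e₂] at h
    have hw : WithLp.toLp 2 (-Complex.I • Complex.I • (w.fst - (1 / 2 : ℂ) • v.fst) +
          (1 / 2 : ℂ) • v.fst, -Complex.I • Complex.I • (w.snd + (1 / 2 : ℂ) • v.snd) -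
          (1 / 2 : ℂ) • v.snd) = w := by
      have hII : ∀ a : 𝓗, -Complex.I • Complex.I • a = a := fun a => by simp [smul_smul]
      rw [hII, hII, sub_add_cancel, add_sub_cancel_right]
      rfl
    have hv : WithLp.toLp 2 (v.fst, v.snd) = v := rfl
    change ⟪dirac d C (i ⟨p, hp⟩), WithLp.toLp 2 (v.fst, v.snd)⟫ - _ = _ at h
    rw [hv, hw, hvw' ⟨p, hp⟩, sub_self] at h
    exact (mul_eq_zero.1 h.symm).resolve_left Complex.I_ne_zero

/-! ### The square of a Dirac operator with decoupled boundary conditions -/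

theorem mem_schrodinger_domain {C : Submodule ℂ (d.domain × d.domain)} {ψ : 𝓗} :
    ψ ∈ (schrodinger d C).domain ↔ ∃ (h₁ : ψ ∈ d.domain) (h₂ : d ⟨ψ, h₁⟩ ∈ d.domain),
      ((⟨ψ, h₁⟩, ⟨d ⟨ψ, h₁⟩, h₂⟩) : d.domain × d.domain) ∈ C := by
  constructor
  · rintro ⟨⟨Φ, hΦ, rfl⟩, h⟩
    exact ⟨Φ.2.1, Φ.2.2, hΦ⟩
  · rintro ⟨h₁, h₂, hC⟩
    exact ⟨⟨⟨ψ, h₁, h₂⟩, hC, rfl⟩, h₁, h₂⟩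

/-- For decoupled conditions `ψ₁ ∈ M₁`, `ψ₂ ∈ M₂` the terms of first order in the square of the
Dirac operator cancel. -/
theorem opComp_dirac_prod (M₁ M₂ : Submodule ℂ d.domain) :
    opComp (dirac d (M₁.prod M₂)) (dirac d (M₁.prod M₂)) =
      opSum (opAddConst (schrodinger d (M₁.prod M₂)) (1 / 4))
        (opAddConst (schrodinger d (M₂.prod M₁)) (1 / 4)) := by
  have hI : -Complex.I ≠ 0 := neg_ne_zero.2 Complex.I_ne_zero
  -- `c • x + y` lies in the domain, respectively in `M`, if and only if `x` does
  have hdom : ∀ {x y : 𝓗}, y ∈ d.domain → (-Complex.I • x + y ∈ d.domain ↔ x ∈ d.domain) :=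
    fun {x y} hy => by rw [Submodule.add_mem_iff_left _ hy, Submodule.smul_mem_iff _ hI]
  have hM : ∀ {M : Submodule ℂ d.domain} {x y : d.domain}, y ∈ M →
      (-Complex.I • x + y ∈ M ↔ x ∈ M) :=
    fun {M x y} hy => by rw [Submodule.add_mem_iff_left _ hy, Submodule.smul_mem_iff _ hI]
  refine LinearPMap.ext (Submodule.ext fun Ψ => ?_) fun Ψ hΨ hΨ' => ?_
  · constructor
    · rintro ⟨h, h'⟩
      obtain ⟨h₁, h₂, hm₁, hm₂⟩ := mem_dirac_domain.1 h
      rw [dirac_apply ⟨Ψ, h⟩ h₁ h₂] at h'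
      obtain ⟨k₁, k₂, hk₁, hk₂⟩ := mem_dirac_domain.1 h'
      simp only [sub_eq_add_neg] at k₁ k₂ hk₁ hk₂
      have k₁' : d ⟨Ψ.snd, h₂⟩ ∈ d.domain := (hdom (d.domain.smul_mem _ h₁)).1 k₁
      have k₂' : d ⟨Ψ.fst, h₁⟩ ∈ d.domain :=
        (hdom (d.domain.neg_mem (d.domain.smul_mem _ h₂))).1 k₂
      refine ⟨mem_schrodinger_domain.2 ⟨h₁, k₂', hm₁, ?_⟩,
        mem_schrodinger_domain.2 ⟨h₂, k₁', hm₂, ?_⟩⟩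
      · exact (hM (M₂.neg_mem (M₂.smul_mem (1 / 2) hm₂))).1 hk₂
      · exact (hM (M₁.smul_mem (1 / 2) hm₁)).1 hk₁
    · rintro ⟨h, h'⟩
      obtain ⟨h₁, k₂', hm₁, hk₂⟩ := mem_schrodinger_domain.1 h
      obtain ⟨h₂, k₁', hm₂, hk₁⟩ := mem_schrodinger_domain.1 h'
      have hD : Ψ ∈ (dirac d (M₁.prod M₂)).domain := mem_dirac_domain.2 ⟨h₁, h₂, hm₁, hm₂⟩
      refine ⟨hD, ?_⟩
      rw [dirac_apply ⟨Ψ, hD⟩ h₁ h₂]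
      simp only [sub_eq_add_neg]
      refine mem_dirac_domain.2 ⟨(hdom (d.domain.smul_mem _ h₁)).2 k₁',
        (hdom (d.domain.neg_mem (d.domain.smul_mem _ h₂))).2 k₂', ?_, ?_⟩
      · exact (hM (M₁.smul_mem (1 / 2) hm₁)).2 hk₁
      · exact (hM (M₂.neg_mem (M₂.smul_mem (1 / 2) hm₂))).2 hk₂
  · obtain ⟨h₁, k₂', hm₁, hk₂⟩ := mem_schrodinger_domain.1 hΨ'.1
    obtain ⟨h₂, k₁', hm₂, hk₁⟩ := mem_schrodinger_domain.1 hΨ'.2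
    have e₁ := d.map_add (-Complex.I • ⟨_, k₁'⟩) ((1 / 2 : ℂ) • ⟨_, h₁⟩)
    have e₂ := d.map_sub (-Complex.I • ⟨_, k₂'⟩) ((1 / 2 : ℂ) • ⟨_, h₂⟩)
    rw [d.map_smul, d.map_smul] at e₁ e₂
    refine congrArg (WithLp.toLp 2) (Prod.ext ?_ ?_)
    · refine (congrArg (fun t => -Complex.I • t + (1 / 2 : ℂ) •
        (-Complex.I • d ⟨Ψ.snd, h₂⟩ + (1 / 2 : ℂ) • Ψ.fst)) e₂).trans ?_
      change _ = (1 / 4 : ℂ) • Ψ.fst + -d ⟨d ⟨Ψ.fst, h₁⟩, k₂'⟩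
      match_scalars
      · linear_combination Complex.I_mul_I
      · ring
      · ring
    · refine (congrArg (fun t => -Complex.I • t - (1 / 2 : ℂ) •
        (-Complex.I • d ⟨Ψ.fst, h₁⟩ - (1 / 2 : ℂ) • Ψ.snd)) e₁).trans ?_
      change _ = (1 / 4 : ℂ) • Ψ.snd + -d ⟨d ⟨Ψ.snd, h₂⟩, k₁'⟩
      match_scalars
      · linear_combination Complex.I_mul_I
      · ring
      · ring

/-- If a Dirac operator with decoupled boundary conditions is self-adjoint then so are the two
Schrödinger operators into which its square splits. -/
theorem isSelfAdjoint_schrodinger_of_dirac [CompleteSpace 𝓗] {M₁ M₂ : Submodule ℂ d.domain}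
    (h : IsSelfAdjoint (dirac d (M₁.prod M₂))) :
    IsSelfAdjoint (schrodinger d (M₁.prod M₂)) ∧ IsSelfAdjoint (schrodinger d (M₂.prod M₁)) := by
  have := IsSelfAdjoint.opComp_self h
  rw [opComp_dirac_prod] at this
  exact IsSelfAdjoint.of_opSum_opAddConst (by rw [map_div₀, map_one, map_ofNat]) this

end SelfAdjoint

/-! ### Lagrangian subspaces and couples `(Π, Θ)` -/

section BoundaryPair

variable {M F : Type*} [AddCommGroup M] [Module ℂ M] [NormedAddCommGroup F]
  [InnerProductSpace ℂ F]

local notation "⟪" x ", " y "⟫" => inner ℂ x y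

theorem BoundaryPair.proj_eq_self (b : BoundaryPair F) {v : F} (h : v ∈ LinearMap.range b.proj) :
    b.proj v = v := by
  obtain ⟨u, rfl⟩ := h
  exact LinearMap.congr_fun b.isSymmetricProjection.isIdempotentElem u

/-- The boundary conditions given by a couple `(Π, Θ)` form a Lagrangian subspace. -/
theorem mem_boundaryCond_iff {ρ τ : M →ₗ[ℂ] F} (hsurj : ∀ r t, ∃ m, ρ m = r ∧ τ m = t)
    (b : BoundaryPair F) (m : M) :
    m ∈ boundaryCond ρ τ b ↔ ∀ m' ∈ boundaryCond ρ τ b, ⟪ρ m', τ m⟫ - ⟪τ m', ρ m⟫ = 0 := by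
  have hP := b.isSymmetricProjection.isSymmetric
  constructor
  · rintro ⟨h, e⟩ m' ⟨h', e'⟩
    have h1 : ⟪ρ m', τ m⟫ = ⟪ρ m', (b.op ⟨ρ m, h⟩ : F)⟫ := by
      rw [← e, ← hP, b.proj_eq_self h']
    have h2 : ⟪τ m', ρ m⟫ = ⟪(b.op ⟨ρ m', h'⟩ : F), ρ m⟫ := by
      rw [← e', hP, b.proj_eq_self h]
    rw [h1, h2, sub_eq_zero]
    exact (b.isSymmetric ⟨ρ m', h'⟩ ⟨ρ m, h⟩).symm
  · intro hm
    have h0 : b.proj (ρ m) = ρ m := by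
      refine (sub_eq_zero.1 <| ext_inner_left ℂ fun s => ?_).symm
      obtain ⟨m', h1, h2⟩ := hsurj 0 (s - b.proj s)
      have hm' : m' ∈ boundaryCond ρ τ b := by
        refine ⟨by rw [h1]; exact zero_mem _, ?_⟩
        have : (⟨ρ m', by rw [h1]; exact zero_mem _⟩ : LinearMap.range b.proj) = 0 :=
          Subtype.ext h1
        rw [this, map_zero, h2, map_sub, b.proj_eq_self ⟨s, rfl⟩, sub_self]; rfl
      have := hm m' hm'
      rw [h1, h2, inner_zero_left, zero_sub, neg_eq_zero, inner_sub_left, hP] at this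
      rw [inner_sub_right, this, inner_zero_right]
    have h : ρ m ∈ LinearMap.range b.proj := ⟨_, h0⟩
    refine ⟨h, ?_⟩
    have key : ∀ r : LinearMap.range b.proj, ⟪(r : F), b.proj (τ m) - b.op ⟨ρ m, h⟩⟫ = 0 := by
      intro r
      obtain ⟨m', h1, h2⟩ := hsurj r (b.op r)
      have hr : (⟨ρ m', by rw [h1]; exact r.2⟩ : LinearMap.range b.proj) = r := Subtype.ext h1
      have hm' : m' ∈ boundaryCond ρ τ b := by
        refine ⟨by rw [h1]; exact r.2, ?_⟩
        rw [hr, h2, b.proj_eq_self (b.op r).2]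
      have := hm m' hm'
      have e1 : ⟪(b.op r : F), ρ m⟫ = ⟪(r : F), (b.op ⟨ρ m, h⟩ : F)⟫ := b.isSymmetric r ⟨ρ m, h⟩
      rw [h1, h2, e1] at this
      rw [inner_sub_right, ← hP, b.proj_eq_self r.2, this]
    have := key (⟨b.proj (τ m), _, rfl⟩ - b.op ⟨ρ m, h⟩)
    exact sub_eq_zero.1 (inner_self_eq_zero (𝕜 := ℂ) |>.1 this)

/-- Any Lagrangian subspace is given by a couple `(Π, Θ)`: the range of `Π` consists of the vectors
`ρ m` and `Θ` maps `ρ m` to `Π τ m`. -/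
theorem exists_boundaryCond_eq [FiniteDimensional ℂ F] {ρ τ : M →ₗ[ℂ] F} {N : Submodule ℂ M}
    (hN : ∀ m, m ∈ N ↔ ∀ m' ∈ N, ⟪ρ m', τ m⟫ - ⟪τ m', ρ m⟫ = 0) :
    ∃ b : BoundaryPair F, boundaryCond ρ τ b = N := by
  let R : Submodule ℂ F := N.map ρ
  let P : F →ₗ[ℂ] F := R.starProjection.toLinearMap
  have hPR : LinearMap.range P = R := R.range_starProjection
  have hPs : P.IsSymmetricProjection := R.isSymmetricProjection_starProjection
  have hPx : ∀ m ∈ N, P (ρ m) = ρ m := fun m hm =>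
    Submodule.starProjection_eq_self_iff.2 ⟨m, hm, rfl⟩
  let π : N →ₗ[ℂ] LinearMap.range P :=
    LinearMap.codRestrict _ (ρ ∘ₗ N.subtype) fun m => by
      rw [hPR]; exact ⟨m, m.2, rfl⟩
  have hπ : LinearMap.range π = ⊤ := by
    refine LinearMap.range_eq_top.2 fun v => ?_
    obtain ⟨m, hm, e⟩ : (v : F) ∈ R := hPR ▸ v.2
    exact ⟨⟨m, hm⟩, Subtype.ext e⟩
  obtain ⟨s, hs⟩ := π.exists_rightInverse_of_surjective hπ
  have hs' : ∀ v, ρ (s v) = v := fun v => congrArg Subtype.val (LinearMap.congr_fun hs v)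
  -- `Π τ m = 0` for `m ∈ N` with `ρ m = 0`, so that the choice of the section `s` is immaterial
  have hz : ∀ m ∈ N, ρ m = 0 → P (τ m) = 0 := fun m hm h0 => by
    refine (Submodule.starProjection_apply_eq_zero_iff R).2 ?_
    rintro _ ⟨m', hm', rfl⟩
    have := (hN m).1 hm m' hm'
    rwa [h0, inner_zero_right, sub_zero] at this
  let b : BoundaryPair F :=
    { proj := P
      isSymmetricProjection := hPs
      op := P.rangeRestrict ∘ₗ τ ∘ₗ N.subtype ∘ₗ s
      isSymmetric := fun v w => by
        change ⟪P (τ (s v)), (w : F)⟫ = ⟪(v : F), P (τ (s w))⟫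
        rw [← hs' v, ← hs' w, hPs.isSymmetric, ← hPs.isSymmetric (ρ _), hPx _ (s v).2,
          hPx _ (s w).2]
        have := (hN (s w)).1 (s w).2 (s v) (s v).2
        exact (sub_eq_zero.1 this).symm }
  refine ⟨b, Submodule.ext fun m => ⟨?_, fun hm => ?_⟩⟩
  · rintro ⟨h, e⟩
    set v : LinearMap.range b.proj := ⟨ρ m, h⟩ with hv
    have h0 : ρ (m - s v) = 0 := by rw [map_sub, hs', hv, sub_self]
    have h1 : P (τ (m - s v)) = 0 := by
      rw [map_sub, map_sub]; exact sub_eq_zero.2 e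
    have : m - s v ∈ N := (hN _).2 fun m' hm' => by
      rw [h0, inner_zero_right, sub_zero, ← hPx m' hm', hPs.isSymmetric, h1, inner_zero_right]
    exact (Submodule.sub_mem_iff_left N (s v).2).1 this
  · have h : ρ m ∈ LinearMap.range P := by rw [hPR]; exact ⟨m, hm, rfl⟩
    refine ⟨h, ?_⟩
    have := hz (m - s ⟨ρ m, h⟩) (N.sub_mem hm (s _).2) (by rw [map_sub, hs', sub_self])
    rw [map_sub, map_sub] at this
    exact sub_eq_zero.1 this

end BoundaryPair

/-! ### Integration by parts in `H¹` -/

/-- Indefinite integrals of complex functions are absolutely continuous. -/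
theorem absolutelyContinuousOnInterval_primitive {f : ℝ → ℂ} {a b : ℝ}
    (hf : IntervalIntegrable f volume a b) :
    AbsolutelyContinuousOnInterval (fun x => ∫ t in a..x, f t) a b := by
  have hr : IntervalIntegrable (fun t => (f t).re) volume a b := ⟨hf.1.re, hf.2.re⟩
  have hi : IntervalIntegrable (fun t => (f t).im) volume a b := ⟨hf.1.im, hf.2.im⟩
  have hc : ∀ c : ℂ, AbsolutelyContinuousOnInterval (fun _ : ℝ => c) a b := fun c =>
    (LipschitzWith.const c).lipschitzOnWith.absolutelyContinuousOnInterval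
  have := ((hr.absolutelyContinuousOnInterval_intervalIntegral (c := a) (by simp)).smul (hc 1)).add
    ((hi.absolutelyContinuousOnInterval_intervalIntegral (c := a) (by simp)).smul (hc Complex.I))
  refine Tendsto.congr' (eventually_inf_principal.2 (Eventually.of_forall fun E hE => ?_)) this
  refine Finset.sum_congr rfl fun i hi => ?_
  have key : ∀ x ∈ Set.uIcc a b, ((∫ t in a..x, (f t).re) • (1 : ℂ) +
      (∫ t in a..x, (f t).im) • Complex.I) = ∫ t in a..x, f t := fun x hx => by
    have hx' : IntervalIntegrable f volume a x :=
      hf.mono_set (Set.uIcc_subset_uIcc (by simp) hx)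
    rw [Complex.real_smul, Complex.real_smul, mul_one]
    have e1 := Complex.reCLM.intervalIntegral_comp_comm hx'
    have e2 := Complex.imCLM.intervalIntegral_comp_comm hx'
    simp only [Complex.reCLM_apply, Complex.imCLM_apply] at e1 e2
    rw [e1, e2, Complex.re_add_im]
  have hE' := hE.1 i hi
  exact congrArg₂ dist (key _ hE'.1) (key _ hE'.2)

/-- Integration by parts for indefinite integrals. -/
theorem integral_mul_primitive {f g : ℝ → ℂ} {a b : ℝ} (c d : ℂ)
    (hf : IntervalIntegrable f volume a b) (hg : IntervalIntegrable g volume a b) :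
    ∫ x in a..b, (f x * (d + ∫ t in a..x, g t) + (c + ∫ t in a..x, f t) * g x) =
      (c + ∫ t in a..b, f t) * (d + ∫ t in a..b, g t) - c * d := by
  have hc : ∀ c : ℂ, AbsolutelyContinuousOnInterval (fun _ : ℝ => c) a b := fun c =>
    (LipschitzWith.const c).lipschitzOnWith.absolutelyContinuousOnInterval
  set F : ℝ → ℂ := fun x => c + ∫ t in a..x, f t with hF
  set G : ℝ → ℂ := fun x => d + ∫ t in a..x, g t with hG
  have hFa : AbsolutelyContinuousOnInterval F a b :=
    (hc c).add (absolutelyContinuousOnInterval_primitive hf)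
  have hGa : AbsolutelyContinuousOnInterval G a b :=
    (hc d).add (absolutelyContinuousOnInterval_primitive hg)
  have hq : IntervalIntegrable (fun x => f x * G x + F x * g x) volume a b :=
    (hf.mul_continuousOn hGa.continuousOn).add (hg.continuousOn_mul hFa.continuousOn)
  have hH := (hFa.smul hGa).sub (absolutelyContinuousOnInterval_primitive hq)
  obtain ⟨C, hC⟩ := hH.const_of_ae_hasDerivAt_zero (by
    filter_upwards [hf.ae_hasDerivAt_integral, hg.ae_hasDerivAt_integral,
      hq.ae_hasDerivAt_integral] with x h1 h2 h3 hx
    have := (((h1 hx a (by simp)).const_add c).mul ((h2 hx a (by simp)).const_add d)).sub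
      (h3 hx a (by simp))
    refine this.congr_deriv ?_
    simp only [hF, hG]
    ring)
  have e1 := hC a (by simp)
  have e2 := hC b (by simp)
  simp only [Pi.sub_apply, Pi.mul_apply, smul_eq_mul, intervalIntegral.integral_same,
    sub_zero] at e1 e2
  have e3 : F a = c := by simp [hF]
  have e4 : G a = d := by simp [hG]
  rw [e3, e4] at e1
  linear_combination e1 - e2

/-- A function with an integrable weak derivative is almost everywhere equal to an indefinite
integral of it. -/
theorem exists_ae_eq_primitive {U : Opens ℝ} {f g : ℝ → ℂ} {a b : ℝ} (hab : a < b)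
    (hU : Set.Ioo a b ⊆ (U : Set ℝ)) (hf : IntegrableOn f (Set.Ioo a b))
    (hg : IntegrableOn g (Set.Ioo a b)) (h : IsWeakDeriv U f g) :
    ∃ c : ℂ, ∀ᵐ x, x ∈ Set.Ioo a b → f x = c + ∫ t in a..x, g t := by
  have hgi : Integrable ((Set.Ioo a b).indicator g) := hg.integrable_indicator measurableSet_Ioo
  have hcont : Continuous fun s => ∫ t in s..b, (Set.Ioo a b).indicator g t := by
    have := (intervalIntegral.continuous_primitive
      (fun _ _ => hgi.intervalIntegrable) b).neg
    refine this.congr fun s => ?_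
    rw [Pi.neg_apply, ← intervalIntegral.integral_symm]
  set J : ℝ → ℂ := fun s => ∫ t in s..b, (Set.Ioo a b).indicator g t with hJ
  have hJi : IntegrableOn J (Set.Ioo a b) :=
    (hcont.integrableOn_Icc (a := a) (b := b)).mono_set Set.Ioo_subset_Icc_self
  -- a bump function of integral one
  let χ₀ : ContDiffBump ((a + b) / 2) := ⟨(b - a) / 8, (b - a) / 4, by linarith, by linarith⟩
  set χ : ℝ → ℝ := χ₀.normed volume with hχ
  have hχ1 : ContDiff ℝ ∞ χ := χ₀.contDiff_normed
  have hχc : HasCompactSupport χ := χ₀.hasCompactSupport_normed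
  have hχs : tsupport χ ⊆ Set.Ioo a b := by
    rw [hχ, χ₀.tsupport_normed_eq, Real.closedBall_eq_Icc]
    intro x hx
    have h1 : χ₀.rOut = (b - a) / 4 := rfl
    rw [h1] at hx
    exact ⟨by linarith [hx.1], by linarith [hx.2]⟩
  have hχi : ∫ x, χ x = 1 := χ₀.integral_normed
  set c : ℂ := ∫ s, χ s • (f s + J s) with hcdef
  have hloc : LocallyIntegrableOn (fun s => f s + J s - c) (Set.Ioo a b) :=
    IntegrableOn.locallyIntegrableOn ((Integrable.add hf hJi).sub (integrableOn_const (by simp)))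
  have hint : ∀ θ : ℝ → ℝ, ContDiff ℝ ∞ θ → HasCompactSupport θ → tsupport θ ⊆ Set.Ioo a b →
      Integrable (fun s => θ s • (f s + J s)) := by
    intro θ hθ hc hs
    obtain ⟨M, hM⟩ := hc.exists_bound_of_continuous hθ.continuous
    have : IntegrableOn (fun s => θ s • (f s + J s)) (Set.Ioo a b) :=
      Integrable.bdd_smul (C := M) (Integrable.add hf hJi) hθ.continuous.aestronglyMeasurable
        (Eventually.of_forall hM)
    refine (integrableOn_iff_integrable_of_support_subset fun x hx => ?_).1 this
    exact hs (subset_tsupport _ fun h' => hx (by simp [h']))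
  -- a test function is the sum of a multiple of the bump and of a derivative of a test function
  have hzero : ∀ᵐ x, x ∈ Set.Ioo a b → f x + J x - c = 0 := by
    refine isOpen_Ioo.ae_eq_zero_of_integral_contDiff_smul_eq_zero hloc fun θ hθ hc hs => ?_
    have hθi : Integrable θ := hθ.continuous.integrable_of_hasCompactSupport hc
    have hχI : Integrable χ := hχ1.continuous.integrable_of_hasCompactSupport hχc
    have hk := integral_primitive_eq_zero hab hU hf hg h (θ := fun x => θ x - (∫ y, θ y) * χ x)
      (hθ.sub (contDiff_const.mul hχ1)) (hc.sub hχc.mul_left)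
      ((tsupport_sub _ _).trans (Set.union_subset hs
        ((tsupport_mul_subset_right).trans hχs)))
      (by rw [integral_sub hθi (hχI.const_mul _), integral_const_mul, hχi]; simp)
    have e1 : ∫ s, (θ s - (∫ y, θ y) * χ s) • (f s + J s) =
        (∫ s, θ s • (f s + J s)) - (∫ y, θ y) • c := by
      have hi : Integrable (fun s => (∫ y, θ y) • χ s • (f s + J s)) :=
        (hint χ hχ1 hχc hχs).smul (∫ y, θ y)
      rw [hcdef, ← integral_smul, ← integral_sub (hint θ hθ hc hs) hi]
      simp only [sub_smul, mul_smul]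
    rw [e1] at hk
    rw [← hk, ← integral_smul_const, ← integral_sub (hint θ hθ hc hs) (hθi.smul_const c)]
    simp only [smul_sub]
  refine ⟨c - ∫ t in a..b, g t, ?_⟩
  filter_upwards [hzero] with x hx hxI
  have hgI : IntervalIntegrable g volume a b :=
    (intervalIntegrable_iff_integrableOn_Ioo_of_le hab.le).2 hg
  have e1 : J x = ∫ t in x..b, g t := by
    rw [hJ]
    simp only [intervalIntegral.integral_of_le hxI.2.le, integral_Ioc_eq_integral_Ioo]
    exact setIntegral_congr_fun measurableSet_Ioo fun t ht =>
      Set.indicator_of_mem (show t ∈ Set.Ioo a b from ⟨hxI.1.trans ht.1, ht.2⟩) g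
  have hx' : x ∈ Set.uIcc a b := Set.Icc_subset_uIcc (Set.mem_Icc.2 ⟨hxI.1.le, hxI.2.le⟩)
  have e2 : (∫ t in a..x, g t) + ∫ t in x..b, g t = ∫ t in a..b, g t :=
    intervalIntegral.integral_add_adjacent_intervals
      (hgI.mono_set (Set.uIcc_subset_uIcc (by simp) hx'))
      (hgI.mono_set (Set.uIcc_subset_uIcc hx' (by simp)))
  have := hx hxI
  rw [e1] at this
  linear_combination this - e2

theorem L2.intervalIntegrable {U : Opens ℝ} (f : L2 U) {a b : ℝ} (hab : a ≤ b)
    (h : Set.Ioo a b ⊆ (U : Set ℝ)) : IntervalIntegrable f volume a b :=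
  (intervalIntegrable_iff_integrableOn_Ioo_of_le hab).2 (L2.integrableOn_Ioo f h)

/-- The continuous representative of a function in `H¹` on an interval; it also gives the
one-sided limits. -/
theorem exists_primitive_H1 {U : Opens ℝ} (f : H1 U) {a b : ℝ} (hab : a < b)
    (hU : Set.Ioo a b ⊆ (U : Set ℝ)) :
    ∃ c : ℂ, (∀ᵐ x, x ∈ Set.Ioo a b → (f : L2 U) x = c + ∫ t in a..x, weakDeriv U f t) ∧
      (∀ x ∈ Set.Ico a b, rightLim (f : L2 U) x = c + ∫ t in a..x, weakDeriv U f t) ∧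
      (∀ x ∈ Set.Ioc a b, leftLim (f : L2 U) x = c + ∫ t in a..x, weakDeriv U f t) := by
  obtain ⟨c, hc⟩ := exists_ae_eq_primitive hab hU (L2.integrableOn_Ioo _ hU)
    (L2.integrableOn_Ioo _ hU) (isWeakDeriv_weakDeriv f)
  have hF : ContinuousOn (fun x => c + ∫ t in a..x, weakDeriv U f t) (Set.Icc a b) := by
    rw [← Set.uIcc_of_le hab.le]
    exact continuousOn_const.add (absolutelyContinuousOnInterval_primitive
      (L2.intervalIntegrable _ hab.le hU)).continuousOn
  refine ⟨c, hc, fun x hx => ?_, fun x hx => ?_⟩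
  · have hs : Set.Ioo x b ∈ 𝓝[>] x := Ioo_mem_nhdsGT hx.2
    have h1 := ((hF x ⟨hx.1, hx.2.le⟩).mono_left (nhdsWithin_le_of_mem (Filter.mem_of_superset hs
      fun t ht => ⟨hx.1.trans ht.1.le, ht.2.le⟩))).mono_left
      (inf_le_left : 𝓝[>] x ⊓ ae volume ≤ 𝓝[>] x)
    refine (h1.congr' ?_).limUnder_eq
    filter_upwards [mem_inf_of_left hs, mem_inf_of_right hc] with t ht ht'
    exact (ht' ⟨hx.1.trans_lt ht.1, ht.2⟩).symm
  · have hs : Set.Ioo a x ∈ 𝓝[<] x := Ioo_mem_nhdsLT hx.1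
    have h1 := ((hF x ⟨hx.1.le, hx.2⟩).mono_left (nhdsWithin_le_of_mem (Filter.mem_of_superset hs
      fun t ht => ⟨ht.1.le, ht.2.le.trans hx.2⟩))).mono_left
      (inf_le_left : 𝓝[<] x ⊓ ae volume ≤ 𝓝[<] x)
    refine (h1.congr' ?_).limUnder_eq
    filter_upwards [mem_inf_of_left hs, mem_inf_of_right hc] with t ht ht'
    exact (ht' ⟨ht.1, ht.2.trans_le hx.2⟩).symm

/-- The integrand of the boundary form. -/
noncomputable def greenDensity {U : Opens ℝ} (f g : H1 U) (x : ℝ) : ℂ :=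
  inner ℂ (weakDeriv U f x) ((g : L2 U) x) + inner ℂ ((f : L2 U) x) (weakDeriv U g x)

theorem integrableOn_greenDensity {U : Opens ℝ} (f g : H1 U) :
    IntegrableOn (greenDensity f g) (U : Set ℝ) :=
  (L2.integrable_inner (weakDeriv U f) (g : L2 U)).add
    (L2.integrable_inner (f : L2 U) (weakDeriv U g))

theorem greenForm_weakDeriv {U : Opens ℝ} (f g : H1 U) :
    greenForm (weakDeriv U) f g = ∫ x in U, greenDensity f g x :=
  (integral_add (L2.integrable_inner (weakDeriv U f) (g : L2 U))
    (L2.integrable_inner (f : L2 U) (weakDeriv U g))).symm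

theorem leftLim_eq_rightLim {U : Opens ℝ} (f : H1 U) {x : ℝ} (hx : x ∈ U) :
    leftLim (f : L2 U) x = rightLim (f : L2 U) x := by
  obtain ⟨ε, hε, h⟩ := Metric.isOpen_iff.1 U.isOpen x hx
  rw [Real.ball_eq_Ioo] at h
  obtain ⟨c, -, h1, h2⟩ := exists_primitive_H1 f (by linarith : x - ε < x + ε) h
  rw [h1 x ⟨by linarith, by linarith⟩, h2 x ⟨by linarith, by linarith⟩]

/-- Integration by parts over a bounded interval. -/
theorem integral_greenDensity {U : Opens ℝ} (f g : H1 U) {a b : ℝ} (hab : a < b)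
    (hU : Set.Ioo a b ⊆ (U : Set ℝ)) :
    ∫ x in a..b, greenDensity f g x =
      inner ℂ (leftLim (f : L2 U) b) (leftLim (g : L2 U) b) -
        inner ℂ (rightLim (f : L2 U) a) (rightLim (g : L2 U) a) := by
  obtain ⟨c, hc, hcr, hcl⟩ := exists_primitive_H1 f hab hU
  obtain ⟨d, hd, hdr, hdl⟩ := exists_primitive_H1 g hab hU
  have hf := L2.intervalIntegrable (weakDeriv U f) hab.le hU
  have hg := L2.intervalIntegrable (weakDeriv U g) hab.le hU
  have hf' : IntervalIntegrable (fun t => (starRingEnd ℂ) (weakDeriv U f t)) volume a b :=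
    ⟨Complex.conjCLE.integrable_comp_iff.2 hf.1, Complex.conjCLE.integrable_comp_iff.2 hf.2⟩
  have hconj : ∀ x, (starRingEnd ℂ) (∫ t in a..x, weakDeriv U f t) =
      ∫ t in a..x, (starRingEnd ℂ) (weakDeriv U f t) := fun x => by
    simp only [intervalIntegral, map_sub, integral_conj]
  have key := integral_mul_primitive ((starRingEnd ℂ) c) d hf' hg
  rw [hcr a ⟨le_rfl, hab⟩, hdr a ⟨le_rfl, hab⟩, hcl b ⟨hab, le_rfl⟩, hdl b ⟨hab, le_rfl⟩]
  simp only [intervalIntegral.integral_same, add_zero, RCLike.inner_apply', map_add, hconj]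
  rw [← key, intervalIntegral.integral_of_le hab.le, intervalIntegral.integral_of_le hab.le,
    integral_Ioc_eq_integral_Ioo, integral_Ioc_eq_integral_Ioo]
  refine setIntegral_congr_ae measurableSet_Ioo ?_
  filter_upwards [hc, hd] with x h1 h2 hx
  simp only [greenDensity, RCLike.inner_apply']
  rw [h1 hx, h2 hx, map_add, hconj]

/-- The left limits of a function in `H¹(U)` are its continuous representative. -/
theorem ae_leftLim_eq {U : Opens ℝ} (f : H1 U) :
    ∀ᵐ x ∂volume.restrict (U : Set ℝ), leftLim (f : L2 U) x = (f : L2 U) x := by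
  rw [ae_restrict_iff' U.isOpen.measurableSet, ae_iff]
  refine measure_null_of_locally_null _ fun x hx => ?_
  have hxU : x ∈ (U : Set ℝ) := by
    by_contra h
    exact hx fun h' => absurd h' h
  obtain ⟨ε, hε, h⟩ := Metric.isOpen_iff.1 U.isOpen x hxU
  rw [Real.ball_eq_Ioo] at h
  obtain ⟨c, h0, -, h2⟩ := exists_primitive_H1 f (by linarith : x - ε < x + ε) h
  refine ⟨_, inter_mem_nhdsWithin _ (Ioo_mem_nhds (by linarith : x - ε < x)
    (by linarith : x < x + ε)), ?_⟩
  refine measure_mono_null ?_ (ae_iff.1 h0)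
  rintro t ⟨ht, ht'⟩ h3
  exact ht fun _ => (h2 t ⟨ht'.1, ht'.2.le⟩).trans (h3 ht').symm

theorem integrableOn_inner_leftLim {U : Opens ℝ} (f g : H1 U) :
    IntegrableOn (fun x => inner ℂ (leftLim (f : L2 U) x) (leftLim (g : L2 U) x))
      (U : Set ℝ) := by
  refine Integrable.congr (L2.integrable_inner (𝕜 := ℂ) (f : L2 U) (g : L2 U)) ?_
  filter_upwards [ae_leftLim_eq f, ae_leftLim_eq g] with x h1 h2
  rw [h1, h2]

/-- Integration by parts over a half-line; the boundary term at infinity vanishes, because it is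
the limit of an integrable function. -/
theorem integral_greenDensity_Ioi {U : Opens ℝ} (f g : H1 U) {a : ℝ}
    (hU : Set.Ioi a ⊆ (U : Set ℝ)) :
    ∫ x in Set.Ioi a, greenDensity f g x =
      -inner ℂ (rightLim (f : L2 U) a) (rightLim (g : L2 U) a) := by
  have h1 := intervalIntegral_tendsto_integral_Ioi a
    ((integrableOn_greenDensity f g).mono_set hU) tendsto_id
  have h2 := (h1.add_const (inner ℂ (rightLim (f : L2 U) a) (rightLim (g : L2 U) a))).congr'
    (f₂ := fun x => inner ℂ (leftLim (f : L2 U) x) (leftLim (g : L2 U) x)) (by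
      filter_upwards [eventually_gt_atTop a] with x hx
      simp only [id]
      rw [integral_greenDensity f g hx ((Set.Ioo_subset_Ioi_self).trans hU), sub_add_cancel])
  have h3 := IntegrableAtFilter.eq_zero_of_tendsto (μ := volume)
    ⟨Set.Ioi a, Ioi_mem_atTop a, (integrableOn_inner_leftLim f g).mono_set hU⟩ (fun s hs => by
      obtain ⟨b, hb⟩ := mem_atTop_sets.1 hs
      exact top_unique ((Real.volume_Ici (a := b)).ge.trans (measure_mono fun x hx => hb x hx))) h2
  exact eq_neg_of_add_eq_zero_left h3

theorem integral_greenDensity_Iic {U : Opens ℝ} (f g : H1 U) {b : ℝ}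
    (hU : Set.Iio b ⊆ (U : Set ℝ)) :
    ∫ x in Set.Iic b, greenDensity f g x =
      inner ℂ (leftLim (f : L2 U) b) (leftLim (g : L2 U) b) := by
  have hi : IntegrableOn (greenDensity f g) (Set.Iic b) :=
    (integrableOn_Iic_iff_integrableOn_Iio).2 ((integrableOn_greenDensity f g).mono_set hU)
  have h1 := intervalIntegral_tendsto_integral_Iic b hi tendsto_id
  have h2 := (h1.const_sub (inner ℂ (leftLim (f : L2 U) b) (leftLim (g : L2 U) b))).congr'
    (f₂ := fun x => inner ℂ (leftLim (f : L2 U) x) (leftLim (g : L2 U) x)) (by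
      filter_upwards [eventually_lt_atBot b] with x hx
      simp only [id]
      rw [integral_greenDensity f g hx ((Set.Ioo_subset_Iio_self).trans hU),
        leftLim_eq_rightLim f (hU hx), leftLim_eq_rightLim g (hU hx), sub_sub_cancel])
  have h3 := IntegrableAtFilter.eq_zero_of_tendsto (μ := volume)
    ⟨Set.Iio b, Iio_mem_atBot b, (integrableOn_inner_leftLim f g).mono_set hU⟩ (fun s hs => by
      obtain ⟨b, hb⟩ := mem_atBot_sets.1 hs
      exact top_unique ((Real.volume_Iic (a := b)).ge.trans (measure_mono fun x hx => hb x hx))) h2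
  exact (sub_eq_zero.1 h3).symm

/-- If the integrals of `q` over intervals without cuts are differences of boundary values then its
integral over an interval with cuts at `Z` is the sum of the boundary values at all cuts and
ends. -/
theorem integral_eq_sum_cuts {q l r : ℝ → ℂ} (hq : Integrable q) {Y : Set ℝ}
    (h : ∀ a b, a < b → Disjoint (Set.Ioo a b) Y → ∫ x in a..b, q x = l b - r a)
    (Z : Finset ℝ) : ∀ a b, a < b → (Z : Set ℝ) = Y ∩ Set.Ioo a b →
      ∫ x in a..b, q x = l b - r a + ∑ z ∈ Z, (l z - r z) := by
  induction Z using Finset.induction_on_max with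
  | empty =>
    intro a b hab hZ
    rw [h a b hab, Finset.sum_empty, add_zero]
    rw [Set.disjoint_iff_inter_eq_empty, Set.inter_comm, ← hZ, Finset.coe_empty]
  | insert m Z hm ih =>
    intro a b hab hZ
    rw [Finset.coe_insert] at hZ
    have hmb : m ∈ Y ∩ Set.Ioo a b := hZ ▸ Set.mem_insert _ _
    rw [← intervalIntegral.integral_add_adjacent_intervals (b := m) hq.intervalIntegrable
      hq.intervalIntegrable, ih a m hmb.2.1, h m b hmb.2.2,
      Finset.sum_insert fun h' => (hm m h').false]
    · ring
    · refine Set.disjoint_left.2 fun x hx hxY => ?_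
      have : x ∈ insert m (Z : Set ℝ) := hZ ▸ ⟨hxY, hmb.2.1.trans hx.1, hx.2⟩
      rcases this with rfl | hx'
      · exact hx.1.false
      · exact (hm x hx').not_gt hx.1
    · ext x
      constructor
      · intro hx
        have : x ∈ Y ∩ Set.Ioo a b := hZ ▸ Set.mem_insert_of_mem _ hx
        exact ⟨this.1, this.2.1, hm x hx⟩
      · rintro ⟨hxY, h1, h2⟩
        have : x ∈ insert m (Z : Set ℝ) := hZ ▸ ⟨hxY, h1, h2.trans hmb.2.2⟩
        rcases this with rfl | hx'
        · exact absurd h2 (lt_irrefl _)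
        · exact hx'

/-- Integration by parts on `ℝ \ Y`. -/
theorem greenForm_cutLine {n : ℕ} {y : Fin n → ℝ} (hy : StrictMono y) (f g : H1 (cutLine y)) :
    greenForm (weakDeriv (cutLine y)) f g =
      ∑ k, (inner ℂ (valL y k f) (valL y k g) - inner ℂ (valR y k f) (valR y k g)) := by
  set l : ℝ → ℂ := fun x =>
    inner ℂ (leftLim (f : L2 (cutLine y)) x) (leftLim (g : L2 (cutLine y)) x) with hl
  set r : ℝ → ℂ := fun x =>
    inner ℂ (rightLim (f : L2 (cutLine y)) x) (rightLim (g : L2 (cutLine y)) x) with hr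
  have hq : Integrable (greenDensity f g) := by
    have := integrableOn_greenDensity f g
    rwa [IntegrableOn, restrict_cutLine] at this
  have hlr : ∀ x ∉ Set.range y, l x = r x := fun x hx => by
    have hx' : x ∈ cutLine y := hx
    simp only [hl, hr, leftLim_eq_rightLim f hx', leftLim_eq_rightLim g hx']
  obtain ⟨a, ha⟩ : ∃ a, ∀ x ∈ Set.range y, a < x := by
    obtain ⟨a, ha⟩ := (Set.finite_range y).bddBelow
    exact ⟨a - 1, fun x hx => by linarith [ha hx]⟩
  obtain ⟨b, hab, hb⟩ : ∃ b, a < b ∧ ∀ x ∈ Set.range y, x < b := by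
    obtain ⟨b, hb⟩ := (Set.finite_range y).bddAbove
    exact ⟨max (b + 1) (a + 1), lt_max_of_lt_right (by linarith),
      fun x hx => lt_max_of_lt_left (by linarith [hb hx])⟩
  have e1 := integral_greenDensity_Iic f g (b := a) fun x hx h => (ha x h).not_gt hx
  have e2 := integral_greenDensity_Ioi f g (a := b) fun x hx h => (hb x h).not_gt hx
  have e3 := integral_eq_sum_cuts (l := l) (r := r) hq (Y := Set.range y)
    (fun a b hab h => integral_greenDensity f g hab (Set.disjoint_left.1 h))
    (Finset.univ.image y) a b hab (by
      rw [Finset.coe_image, Finset.coe_univ, Set.image_univ]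
      exact (Set.inter_eq_left.2 fun x hx => Set.mem_Ioo.2 ⟨ha x hx, hb x hx⟩).symm)
  rw [Finset.sum_image fun i _ j _ h => hy.injective h] at e3
  have e0 : ∀ q : ℝ → ℂ, ∫ x in (cutLine y : Set ℝ), q x = ∫ x, q x := fun q => by
    rw [restrict_cutLine]
  rw [greenForm_weakDeriv, e0, ← integral_add_compl measurableSet_Iic hq,
    Set.compl_Iic, e1, ← Set.Ioc_union_Ioi_eq_Ioi hab.le, setIntegral_union
    (Set.Ioc_disjoint_Ioi le_rfl) measurableSet_Ioi hq.integrableOn hq.integrableOn, e2,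
    ← intervalIntegral.integral_of_le hab.le, e3]
  have h1 := hlr a fun h => (ha a h).false
  have h2 := hlr b fun h => (hb b h).false
  change l a + (l b - r a + ∑ k, (l (y k) - r (y k)) + -r b) = ∑ k, (l (y k) - r (y k))
  rw [h1, h2]
  ring

/-! ### Test functions and functions with prescribed boundary values -/

theorem exists_H1_of_isWeakDeriv {U : Opens ℝ} {f g : ℝ → ℂ}
    (hf : MemLp f 2 (volume.restrict (U : Set ℝ))) (hg : MemLp g 2 (volume.restrict (U : Set ℝ)))
    (h : IsWeakDeriv U f g) :
    ∃ F : H1 U, (F : L2 U) =ᵐ[volume.restrict (U : Set ℝ)] f ∧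
      weakDeriv U F =ᵐ[volume.restrict (U : Set ℝ)] g := by
  have h' : IsWeakDeriv U (hf.toLp f) (hg.toLp g) :=
    h.congr hf.coeFn_toLp.symm hg.coeFn_toLp.symm
  refine ⟨⟨hf.toLp f, mem_H1_iff.2 ⟨_, h'⟩⟩, hf.coeFn_toLp, ?_⟩
  have hmem : (hf.toLp f, hg.toLp g) ∈ (weakDeriv U).graph := by
    rw [weakDeriv, Submodule.toLinearPMap_graph_eq _ (weakDerivGraph_snd_eq_zero U)]
    exact h'
  have := LinearPMap.mem_graph_snd_inj _ hmem
    ((weakDeriv U).mem_graph ⟨hf.toLp f, mem_H1_iff.2 ⟨_, h'⟩⟩) rfl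
  rw [← this]
  exact hg.coeFn_toLp

/-- Cutting off a compactly supported smooth function to a set `s` yields a function in `H¹(U)` if
derivatives of test functions on `U` have integral zero over `s`, i.e. if `U` does not meet the
boundary of `s`. -/
theorem exists_H1_indicator {U : Opens ℝ} {s : Set ℝ} (hs : MeasurableSet s)
    (hint : ∀ θ : ℝ → ℂ, ContDiff ℝ 1 θ → HasCompactSupport θ → tsupport θ ⊆ U →
      ∫ x in s, deriv θ x = 0)
    {φ : ℝ → ℂ} (hφ : ContDiff ℝ ∞ φ) (hc : HasCompactSupport φ) :
    ∃ F : H1 U, (F : L2 U) =ᵐ[volume.restrict (U : Set ℝ)] s.indicator φ ∧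
      weakDeriv U F =ᵐ[volume.restrict (U : Set ℝ)] s.indicator (deriv φ) := by
  have hφ' : Continuous (deriv φ) := hφ.continuous_deriv (by simp)
  refine exists_H1_of_isWeakDeriv
    ((hφ.continuous.memLp_of_hasCompactSupport hc).indicator hs)
    ((hφ'.memLp_of_hasCompactSupport hc.deriv).indicator hs) fun θ hθ hθc hθU => ?_
  have hθ' : Continuous (deriv θ) := hθ.continuous_deriv (by simp)
  -- the integrands vanish outside the support of `θ`
  have hz : ∀ x, x ∉ (U : Set ℝ) → θ x = 0 := fun x hx =>
    image_eq_zero_of_notMem_tsupport fun h => hx (hθU h)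
  have hz' : ∀ x, x ∉ (U : Set ℝ) → deriv θ x = 0 := fun x hx =>
    image_eq_zero_of_notMem_tsupport fun h => hx (hθU (tsupport_deriv_subset h))
  rw [setIntegral_eq_integral_of_forall_compl_eq_zero (fun x hx => by rw [hz' x hx, mul_zero]),
    setIntegral_eq_integral_of_forall_compl_eq_zero (fun x hx => by rw [hz x hx, mul_zero])]
  have e : ∀ a b : ℝ → ℂ, ∫ x, s.indicator a x * b x = ∫ x in s, a x * b x := fun a b => by
    rw [← integral_indicator hs]
    refine integral_congr_ae (Eventually.of_forall fun x => ?_)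
    by_cases hx : x ∈ s <;> simp [hx]
  rw [e, e, eq_neg_iff_add_eq_zero, ← integral_add]
  · have h0 := hint (fun x => φ x * θ x) ((hφ.mul hθ).of_le (by simp)) hc.mul_right
      ((tsupport_mul_subset_right).trans hθU)
    rw [← h0]
    refine integral_congr_ae (Eventually.of_forall fun x => ?_)
    have h1 := (hφ.differentiable (by simp) x).hasDerivAt
    have h2 := (hθ.differentiable (by simp) x).hasDerivAt
    change _ = deriv (fun x => φ x * θ x) x
    refine Eq.trans ?_ (h1.mul h2).deriv.symm
    ring
  · exact ((hφ.continuous.mul hθ').integrable_of_hasCompactSupport hc.mul_right).integrableOn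
  · exact ((hφ'.mul hθ.continuous).integrable_of_hasCompactSupport hc.deriv.mul_right).integrableOn

theorem rightLim_eq_of_tendsto {U : Opens ℝ} {F : L2 U} {φ : ℝ → ℂ} {z : ℝ} {c : ℂ}
    (hF : F =ᵐ[volume.restrict (U : Set ℝ)] φ) (hU : (U : Set ℝ) ∈ 𝓝[>] z)
    (hφ : Tendsto φ (𝓝[>] z) (𝓝 c)) : rightLim F z = c :=
  ((hφ.mono_left inf_le_left).congr' ((eventually_right_of_ae hU hF).mono
    fun _ h => h.symm)).limUnder_eq

theorem leftLim_eq_of_tendsto {U : Opens ℝ} {F : L2 U} {φ : ℝ → ℂ} {z : ℝ} {c : ℂ}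
    (hF : F =ᵐ[volume.restrict (U : Set ℝ)] φ) (hU : (U : Set ℝ) ∈ 𝓝[<] z)
    (hφ : Tendsto φ (𝓝[<] z) (𝓝 c)) : leftLim F z = c :=
  ((hφ.mono_left inf_le_left).congr' ((eventually_left_of_ae hU hF).mono
    fun _ h => h.symm)).limUnder_eq

/-- The functions in `H¹(U)` whose boundary values vanish. -/
def zeroTrace (U : Opens ℝ) : Set (H1 U) :=
  {F | ∀ z ∉ U, ((U : Set ℝ) ∈ 𝓝[>] z → rightLim (F : L2 U) z = 0) ∧
    ((U : Set ℝ) ∈ 𝓝[<] z → leftLim (F : L2 U) z = 0)}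

/-- The weak derivative on `H¹(U)` is minus the adjoint of its restriction to functions with zero
boundary values, since these include all test functions. -/
theorem exists_weakDeriv_eq {U : Opens ℝ} {v w : L2 U}
    (h : ∀ F ∈ zeroTrace U, inner ℂ (F : L2 U) w = -inner ℂ (weakDeriv U F) v) :
    ∃ hv : v ∈ H1 U, weakDeriv U ⟨v, hv⟩ = w := by
  suffices hw : IsWeakDeriv U v w by
    have hmem : (v, w) ∈ (weakDeriv U).graph := by
      rw [weakDeriv, Submodule.toLinearPMap_graph_eq _ (weakDerivGraph_snd_eq_zero U)]
      exact hw
    obtain ⟨x, hx1, hx2⟩ := (LinearPMap.mem_graph_iff _).1 hmem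
    subst hx1
    exact ⟨x.2, hx2⟩
  intro φ hφ hc hs
  have hφ' : ContDiff ℝ ∞ fun x => (starRingEnd ℂ) (φ x) :=
    Complex.conjCLE.contDiff.comp hφ
  have hc' : HasCompactSupport fun x => (starRingEnd ℂ) (φ x) :=
    hc.comp_left (g := starRingEnd ℂ) (map_zero _)
  obtain ⟨F, h1, h2⟩ := exists_H1_indicator (U := U) MeasurableSet.univ (fun θ hθ hθc _ => by
    rw [setIntegral_univ]
    exact integral_eq_zero_of_hasDerivAt_of_integrable
      (fun x => (hθ.differentiable (by simp) x).hasDerivAt)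
      ((hθ.continuous_deriv (by simp)).integrable_of_hasCompactSupport hθc.deriv)
      (hθ.continuous.integrable_of_hasCompactSupport hθc)) hφ' hc'
  rw [Set.indicator_univ] at h1 h2
  have hd : ∀ x, deriv (fun x => (starRingEnd ℂ) (φ x)) x = (starRingEnd ℂ) (deriv φ x) :=
    fun x => ((hφ.differentiable (by simp) x).hasDerivAt.star).deriv
  have hF : F ∈ zeroTrace U := fun z hz => by
    have hz' : (fun x => (starRingEnd ℂ) (φ x)) =ᶠ[𝓝 z] fun _ => 0 := by
      filter_upwards [(isClosed_tsupport φ).isOpen_compl.mem_nhds fun h => hz (hs h)] with x hx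
      rw [image_eq_zero_of_notMem_tsupport hx, map_zero]
    have ht := tendsto_const_nhds.congr' hz'.symm
    exact ⟨fun hU => rightLim_eq_of_tendsto h1 hU (ht.mono_left nhdsWithin_le_nhds),
      fun hU => leftLim_eq_of_tendsto h1 hU (ht.mono_left nhdsWithin_le_nhds)⟩
  have key := h F hF
  rw [L2.inner_def, L2.inner_def] at key
  have e1 : ∫ x in (U : Set ℝ), inner ℂ ((F : L2 U) x) (w x) = ∫ x in U, w x * φ x := by
    refine integral_congr_ae ?_
    filter_upwards [h1] with x hx
    rw [hx, RCLike.inner_apply, Complex.conj_conj]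
  have e2 : ∫ x in (U : Set ℝ), inner ℂ (weakDeriv U F x) (v x) = ∫ x in U, v x * deriv φ x := by
    refine integral_congr_ae ?_
    filter_upwards [h2] with x hx
    rw [hx, hd, RCLike.inner_apply, Complex.conj_conj]
  rw [e1, e2] at key
  rw [key, neg_neg]

theorem exists_bump (y : ℝ) {ε : ℝ} (hε : 0 < ε) :
    ∃ φ : ℝ → ℂ, ContDiff ℝ ∞ φ ∧ HasCompactSupport φ ∧ φ y = 1 ∧
      ∀ z, ε ≤ |z - y| → φ =ᶠ[𝓝 z] fun _ => 0 := by
  let χ : ContDiffBump y := ⟨ε / 4, ε / 2, by linarith, by linarith⟩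
  refine ⟨fun x => (χ x : ℂ), Complex.ofRealCLM.contDiff.comp χ.contDiff,
    χ.hasCompactSupport.comp_left (g := ((↑) : ℝ → ℂ)) (by simp), ?_, fun z hz => ?_⟩
  · simp [χ.one_of_mem_closedBall (Metric.mem_closedBall_self χ.rIn_pos.le)]
  · have : z ∉ tsupport χ := by
      rw [χ.tsupport_eq, Metric.mem_closedBall, Real.dist_eq, not_le]
      exact lt_of_lt_of_le (by change ε / 2 < ε; linarith) hz
    filter_upwards [(isClosed_tsupport χ).isOpen_compl.mem_nhds this] with x hx
    rw [image_eq_zero_of_notMem_tsupport hx, Complex.ofReal_zero]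

/-- A function in `H¹(U)` with `f(y⁺) = 1` whose other boundary values vanish. -/
theorem exists_rightLim_eq_one {U : Opens ℝ} {y ε : ℝ} (hy : y ∉ U) (hU : (U : Set ℝ) ∈ 𝓝[>] y)
    (hε : 0 < ε) : ∃ F : H1 U, rightLim (F : L2 U) y = 1 ∧
      (∀ z, ε ≤ |z - y| → (U : Set ℝ) ∈ 𝓝[>] z → rightLim (F : L2 U) z = 0) ∧
      ∀ z, z = y ∨ ε ≤ |z - y| → (U : Set ℝ) ∈ 𝓝[<] z → leftLim (F : L2 U) z = 0 := by
  obtain ⟨φ, hφ, hc, h1, h0⟩ := exists_bump y hε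
  obtain ⟨F, hF, -⟩ := exists_H1_indicator (U := U) measurableSet_Ioi (fun θ hθ hθc hθU => by
    rw [hθc.integral_Ioi_deriv_eq hθ y,
      image_eq_zero_of_notMem_tsupport fun h => hy (hθU h), neg_zero]) hφ hc
  have hz : ∀ z, ε ≤ |z - y| → Tendsto ((Set.Ioi y).indicator φ) (𝓝 z) (𝓝 0) := fun z hz =>
    tendsto_const_nhds.congr' ((h0 z hz).mono fun x hx => by
      rw [Set.indicator_apply, hx, ite_self])
  refine ⟨F, rightLim_eq_of_tendsto hF hU ?_,
    fun z h hU => rightLim_eq_of_tendsto hF hU ((hz z h).mono_left nhdsWithin_le_nhds),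
    fun z h hU => leftLim_eq_of_tendsto hF hU ?_⟩
  · rw [← h1]
    refine (hφ.continuous.continuousAt.mono_left nhdsWithin_le_nhds).congr' ?_
    filter_upwards [self_mem_nhdsWithin] with x hx
    rw [Set.indicator_of_mem hx]
  · rcases h with rfl | h
    · refine tendsto_const_nhds.congr' ?_
      filter_upwards [self_mem_nhdsWithin] with x hx
      rw [Set.indicator_of_notMem (Set.notMem_Ioi.2 (le_of_lt hx))]
    · exact (hz z h).mono_left nhdsWithin_le_nhds

/-- A function in `H¹(U)` with `f(y⁻) = 1` whose other boundary values vanish. -/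
theorem exists_leftLim_eq_one {U : Opens ℝ} {y ε : ℝ} (hy : y ∉ U) (hU : (U : Set ℝ) ∈ 𝓝[<] y)
    (hε : 0 < ε) : ∃ F : H1 U, leftLim (F : L2 U) y = 1 ∧
      (∀ z, ε ≤ |z - y| → (U : Set ℝ) ∈ 𝓝[<] z → leftLim (F : L2 U) z = 0) ∧
      ∀ z, z = y ∨ ε ≤ |z - y| → (U : Set ℝ) ∈ 𝓝[>] z → rightLim (F : L2 U) z = 0 := by
  obtain ⟨φ, hφ, hc, h1, h0⟩ := exists_bump y hε
  obtain ⟨F, hF, -⟩ := exists_H1_indicator (U := U) measurableSet_Iio (fun θ hθ hθc hθU => by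
    rw [← integral_Iic_eq_integral_Iio, hθc.integral_Iic_deriv_eq hθ y,
      image_eq_zero_of_notMem_tsupport fun h => hy (hθU h)]) hφ hc
  have hz : ∀ z, ε ≤ |z - y| → Tendsto ((Set.Iio y).indicator φ) (𝓝 z) (𝓝 0) := fun z hz =>
    tendsto_const_nhds.congr' ((h0 z hz).mono fun x hx => by
      rw [Set.indicator_apply, hx, ite_self])
  refine ⟨F, leftLim_eq_of_tendsto hF hU ?_,
    fun z h hU => leftLim_eq_of_tendsto hF hU ((hz z h).mono_left nhdsWithin_le_nhds),
    fun z h hU => rightLim_eq_of_tendsto hF hU ?_⟩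
  · rw [← h1]
    refine (hφ.continuous.continuousAt.mono_left nhdsWithin_le_nhds).congr' ?_
    filter_upwards [self_mem_nhdsWithin] with x hx
    rw [Set.indicator_of_mem hx]
  · rcases h with rfl | h
    · refine tendsto_const_nhds.congr' ?_
      filter_upwards [self_mem_nhdsWithin] with x hx
      rw [Set.indicator_of_notMem (Set.notMem_Iio.2 (le_of_lt hx))]
    · exact (hz z h).mono_left nhdsWithin_le_nhds

/-! ### Point interactions on the line -/

section Line

variable {n : ℕ} {y : Fin n → ℝ}

theorem not_mem_cutLine (k : Fin n) : y k ∉ cutLine y := fun h => h ⟨k, rfl⟩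

theorem val_eq_zero_of_mem_zeroTrace {f : H1 (cutLine y)} (hf : f ∈ zeroTrace (cutLine y))
    (k : Fin n) : valL y k f = 0 ∧ valR y k f = 0 :=
  ⟨(hf _ (not_mem_cutLine k)).2 (cutLine_mem_left y _),
    (hf _ (not_mem_cutLine k)).1 (cutLine_mem_right y _)⟩

/-- The boundary values of a function in `H¹(ℝ \ Y)` can be prescribed. -/
theorem exists_val_eq (hy : Function.Injective y) (a b : Fin n → ℂ) :
    ∃ f : H1 (cutLine y), ∀ k, valL y k f = a k ∧ valR y k f = b k := by
  have hε : ∀ k, ∃ ε > 0, ∀ j ≠ k, ε ≤ |y j - y k| := fun k => by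
    have h : (Set.range y \ {y k})ᶜ ∈ 𝓝 (y k) :=
      ((Set.finite_range y).subset Set.sdiff_subset).isClosed.isOpen_compl.mem_nhds (by simp)
    obtain ⟨ε, hε, h⟩ := Metric.mem_nhds_iff.1 h
    refine ⟨ε, hε, fun j hj => not_lt.1 fun hlt => ?_⟩
    exact h (show y j ∈ Metric.ball (y k) ε by rwa [Metric.mem_ball, Real.dist_eq])
      ⟨⟨j, rfl⟩, fun h' => hj (hy h')⟩
  have hL : ∀ k, ∃ F : H1 (cutLine y), ∀ j,
      valL y j F = (if j = k then 1 else 0) ∧ valR y j F = 0 := fun k => by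
    obtain ⟨ε, hε, h⟩ := hε k
    obtain ⟨F, h1, h2, h3⟩ := exists_leftLim_eq_one (not_mem_cutLine k) (cutLine_mem_left y _) hε
    refine ⟨F, fun j => ⟨?_, ?_⟩⟩
    · split_ifs with hj
      · rw [hj]; exact h1
      · exact h2 _ (h j hj) (cutLine_mem_left y _)
    · refine h3 _ ?_ (cutLine_mem_right y _)
      by_cases hj : j = k
      · exact Or.inl (by rw [hj])
      · exact Or.inr (h j hj)
  have hR : ∀ k, ∃ F : H1 (cutLine y), ∀ j,
      valL y j F = 0 ∧ valR y j F = (if j = k then 1 else 0) := fun k => by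
    obtain ⟨ε, hε, h⟩ := hε k
    obtain ⟨F, h1, h2, h3⟩ := exists_rightLim_eq_one (not_mem_cutLine k) (cutLine_mem_right y _) hε
    refine ⟨F, fun j => ⟨?_, ?_⟩⟩
    · refine h3 _ ?_ (cutLine_mem_left y _)
      by_cases hj : j = k
      · exact Or.inl (by rw [hj])
      · exact Or.inr (h j hj)
    · split_ifs with hj
      · rw [hj]; exact h1
      · exact h2 _ (h j hj) (cutLine_mem_right y _)
  choose L hL using hL
  choose R hR using hR
  refine ⟨∑ k, (a k • L k + b k • R k), fun j => ⟨?_, ?_⟩⟩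
  · simp [map_sum, hL, hR]
  · simp [map_sum, hL, hR]

theorem jump_apply (k : Fin n) (f : H1 (cutLine y)) : jump y k f = valR y k f - valL y k f := rfl

theorem mean_apply (k : Fin n) (f : H1 (cutLine y)) :
    mean y k f = 1 / 2 * (valL y k f + valR y k f) := rfl

/-- The mean values and jumps of a function in `H¹(ℝ \ Y)` can be prescribed. -/
theorem exists_mean_jump_eq (hy : Function.Injective y) (m j : Fin n → ℂ) :
    ∃ f : H1 (cutLine y), ∀ k, mean y k f = m k ∧ jump y k f = j k := by
  obtain ⟨f, hf⟩ := exists_val_eq hy (fun k => m k - j k / 2) (fun k => m k + j k / 2)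
  refine ⟨f, fun k => ?_⟩
  rw [mean_apply, jump_apply, (hf k).1, (hf k).2]
  constructor <;> ring

/-- The boundary form of the derivative in terms of jumps and mean values. -/
theorem greenForm_eq_sum_jump_mean (hy : StrictMono y) (f g : H1 (cutLine y)) :
    greenForm (weakDeriv (cutLine y)) f g =
      -∑ k, (mean y k g * (starRingEnd ℂ) (jump y k f) +
        jump y k g * (starRingEnd ℂ) (mean y k f)) := by
  rw [greenForm_cutLine hy, ← Finset.sum_neg_distrib]
  refine Finset.sum_congr rfl fun k _ => ?_
  simp only [RCLike.inner_apply, jump_apply, mean_apply, map_sub, map_add, map_mul, map_div₀,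
    map_one, map_ofNat]
  ring

theorem rho_apply_zero (Ψ : H1Pair y) (k : Fin n) : rho y Ψ (k, 0) = Complex.I * jump y k Ψ.2 := rfl

theorem rho_apply_one (Ψ : H1Pair y) (k : Fin n) : rho y Ψ (k, 1) = Complex.I * jump y k Ψ.1 := rfl

theorem tau_apply_zero (Ψ : H1Pair y) (k : Fin n) : tau y Ψ (k, 0) = mean y k Ψ.1 := rfl

theorem tau_apply_one (Ψ : H1Pair y) (k : Fin n) : tau y Ψ (k, 1) = mean y k Ψ.2 := rfl

theorem exists_rho_tau_eq (hy : Function.Injective y) (r t : EuclideanSpace ℂ (Fin n × Fin 2)) :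
    ∃ Ψ, rho y Ψ = r ∧ tau y Ψ = t := by
  obtain ⟨f, hf⟩ := exists_mean_jump_eq hy (fun k => t (k, 0)) (fun k => -Complex.I * r (k, 1))
  obtain ⟨g, hg⟩ := exists_mean_jump_eq hy (fun k => t (k, 1)) (fun k => -Complex.I * r (k, 0))
  have hI : ∀ z : ℂ, Complex.I * (-Complex.I * z) = z := fun z => by
    linear_combination -z * Complex.I_mul_I
  refine ⟨(f, g), PiLp.ext fun q => ?_, PiLp.ext fun q => ?_⟩
  · obtain ⟨k, j⟩ := q
    fin_cases j
    · exact (congrArg (Complex.I * ·) (hg k).2).trans (hI _)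
    · exact (congrArg (Complex.I * ·) (hf k).2).trans (hI _)
  · obtain ⟨k, j⟩ := q
    fin_cases j
    · exact (hf k).1
    · exact (hg k).1

/-- The boundary form of the Dirac operator in terms of `ρ` and `τ`. -/
theorem inner_rho_tau_sub (hy : StrictMono y) (Ψ Φ : H1Pair y) :
    inner ℂ (rho y Ψ) (tau y Φ) - inner ℂ (tau y Ψ) (rho y Φ) =
      Complex.I * (greenForm (weakDeriv (cutLine y)) Ψ.1 Φ.2 +
        greenForm (weakDeriv (cutLine y)) Ψ.2 Φ.1) := by
  rw [greenForm_eq_sum_jump_mean hy, greenForm_eq_sum_jump_mean hy, PiLp.inner_apply,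
    PiLp.inner_apply, Fintype.sum_prod_type, Fintype.sum_prod_type, ← Finset.sum_sub_distrib,
    ← neg_add, ← Finset.sum_add_distrib, mul_neg, Finset.mul_sum, ← Finset.sum_neg_distrib]
  refine Finset.sum_congr rfl fun k _ => ?_
  simp only [Fin.sum_univ_two, rho_apply_zero, rho_apply_one, tau_apply_zero, tau_apply_one,
    RCLike.inner_apply, map_mul, Complex.conj_I]
  ring

theorem mem_boundaryCond_of_eq_zero {M F : Type*} [AddCommGroup M] [Module ℂ M]
    [NormedAddCommGroup F] [InnerProductSpace ℂ F] {ρ τ : M →ₗ[ℂ] F} (b : BoundaryPair F) {m : M}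
    (h1 : ρ m = 0) (h2 : τ m = 0) : m ∈ boundaryCond ρ τ b := by
  have h : ρ m ∈ LinearMap.range b.proj := by rw [h1]; exact zero_mem _
  refine ⟨h, ?_⟩
  have : (⟨ρ m, h⟩ : LinearMap.range b.proj) = 0 := Subtype.ext h1
  rw [this, h2, map_zero, map_zero]; rfl

/-- The conditions `ρ Ψ ∈ ran Π`, `Π τ Ψ = Θ ρ Ψ` are Lagrangian for the boundary form of the Dirac
operator. -/
theorem mem_boundaryCond_rho_tau_iff (hy : StrictMono y)
    (b : BoundaryPair (EuclideanSpace ℂ (Fin n × Fin 2))) (Φ : H1Pair y) :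
    Φ ∈ boundaryCond (rho y) (tau y) b ↔ ∀ Ψ ∈ boundaryCond (rho y) (tau y) b,
      greenForm (weakDeriv (cutLine y)) Ψ.1 Φ.2 +
        greenForm (weakDeriv (cutLine y)) Ψ.2 Φ.1 = 0 := by
  rw [mem_boundaryCond_iff (exists_rho_tau_eq hy.injective)]
  simp only [inner_rho_tau_sub hy, mul_eq_zero, Complex.I_ne_zero, false_or]

theorem isSelfAdjoint_diracPT (hy : StrictMono y)
    (b : BoundaryPair (EuclideanSpace ℂ (Fin n × Fin 2))) : IsSelfAdjoint (diracPT y b) := by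
  refine isSelfAdjoint_dirac (N := zeroTrace (cutLine y)) (fun v w => exists_weakDeriv_eq)
    (fun f hf => ?_) (mem_boundaryCond_rho_tau_iff hy b)
  have h1 : ∀ k, jump y k f = 0 := fun k => by
    rw [jump_apply, (val_eq_zero_of_mem_zeroTrace hf k).1, (val_eq_zero_of_mem_zeroTrace hf k).2,
      sub_zero]
  have h2 : ∀ k, mean y k f = 0 := fun k => by
    rw [mean_apply, (val_eq_zero_of_mem_zeroTrace hf k).1, (val_eq_zero_of_mem_zeroTrace hf k).2,
      add_zero, mul_zero]
  constructor
  · refine mem_boundaryCond_of_eq_zero b (PiLp.ext fun q => ?_) (PiLp.ext fun q => ?_)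
    · obtain ⟨k, j⟩ := q
      fin_cases j
      · exact (congrArg (Complex.I * ·) (map_zero (jump y k))).trans (mul_zero _)
      · exact (congrArg (Complex.I * ·) (h1 k)).trans (mul_zero _)
    · obtain ⟨k, j⟩ := q
      fin_cases j
      · exact h2 k
      · exact map_zero (mean y k)
  · refine mem_boundaryCond_of_eq_zero b (PiLp.ext fun q => ?_) (PiLp.ext fun q => ?_)
    · obtain ⟨k, j⟩ := q
      fin_cases j
      · exact (congrArg (Complex.I * ·) (h1 k)).trans (mul_zero _)
      · exact (congrArg (Complex.I * ·) (map_zero (jump y k))).trans (mul_zero _)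
    · obtain ⟨k, j⟩ := q
      fin_cases j
      · exact map_zero (mean y k)
      · exact h2 k

/-- If the boundary conditions of `D_{Π,Θ}` decouple into `ψ₁ ∈ M₁` and `ψ₂ ∈ M₂`, then `M₁` and
`M₂` are each other's annihilators in the boundary form of the derivative. -/
theorem mem_iff_of_boundaryCond_eq_prod (hy : StrictMono y)
    {b : BoundaryPair (EuclideanSpace ℂ (Fin n × Fin 2))} {M₁ M₂ : Submodule ℂ (H1 (cutLine y))}
    (h : boundaryCond (rho y) (tau y) b = M₁.prod M₂) :
    (∀ f, f ∈ M₁ ↔ ∀ g ∈ M₂, greenForm (weakDeriv (cutLine y)) g f = 0) ∧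
      (∀ g, g ∈ M₂ ↔ ∀ f ∈ M₁, greenForm (weakDeriv (cutLine y)) f g = 0) := by
  have key := mem_boundaryCond_rho_tau_iff hy b
  rw [h] at key
  have hz : ∀ f, greenForm (weakDeriv (cutLine y)) f 0 = 0 := fun f => by
    simp [greenForm, LinearPMap.map_zero]
  constructor
  · intro f
    have := key (f, 0)
    simp only [Submodule.mem_prod, Submodule.zero_mem, and_true, hz, zero_add] at this
    rw [this]
    exact ⟨fun h g hg => h (0, g) ⟨M₁.zero_mem, hg⟩, fun h Ψ hΨ => h Ψ.2 hΨ.2⟩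
  · intro g
    have := key (0, g)
    simp only [Submodule.mem_prod, Submodule.zero_mem, true_and, hz, add_zero] at this
    rw [this]
    exact ⟨fun h f hf => h (f, 0) ⟨hf, M₂.zero_mem⟩, fun h Ψ hΨ => h Ψ.1 hΨ.1⟩

/-- The decoupled boundary conditions `ψ₁ ∈ M₁`, `ψ₁' ∈ M₂`, `ψ₂ ∈ M₂`, `ψ₂' ∈ M₁` for a pair
`(Ψ, Ψ')`. -/
noncomputable def crossedCond (M₁ M₂ : Submodule ℂ (H1 (cutLine y))) :
    Submodule ℂ ((spinorDeriv y).domain × (spinorDeriv y).domain) :=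
  (M₁.comap (spinorComp y 0 ∘ₗ LinearMap.fst ℂ _ _) ⊓
    M₂.comap (spinorComp y 0 ∘ₗ LinearMap.snd ℂ _ _)) ⊓
  (M₂.comap (spinorComp y 1 ∘ₗ LinearMap.fst ℂ _ _) ⊓
    M₁.comap (spinorComp y 1 ∘ₗ LinearMap.snd ℂ _ _))

theorem mem_crossedCond {M₁ M₂ : Submodule ℂ (H1 (cutLine y))}
    {X : (spinorDeriv y).domain × (spinorDeriv y).domain} :
    X ∈ crossedCond M₁ M₂ ↔ (spinorComp y 0 X.1 ∈ M₁ ∧ spinorComp y 0 X.2 ∈ M₂) ∧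
      (spinorComp y 1 X.1 ∈ M₂ ∧ spinorComp y 1 X.2 ∈ M₁) := Iff.rfl

/-- The boundary form of the second derivative in terms of `rhoHat` and `tauHat`. -/
theorem inner_rhoHat_tauHat_sub (hy : StrictMono y)
    (X Z : (spinorDeriv y).domain × (spinorDeriv y).domain) :
    inner ℂ (rhoHat y X) (tauHat y Z) - inner ℂ (tauHat y X) (rhoHat y Z) =
      ∑ c, (greenForm (weakDeriv (cutLine y)) (spinorComp y c X.1) (spinorComp y c Z.2) -
        greenForm (weakDeriv (cutLine y)) (spinorComp y c X.2) (spinorComp y c Z.1)) := by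
  rw [PiLp.inner_apply, PiLp.inner_apply, Fintype.sum_prod_type, Fintype.sum_prod_type,
    ← Finset.sum_sub_distrib]
  refine Finset.sum_congr rfl fun c _ => ?_
  rw [greenForm_eq_sum_jump_mean hy, greenForm_eq_sum_jump_mean hy, Fintype.sum_prod_type,
    Fintype.sum_prod_type, ← Finset.sum_sub_distrib, neg_sub_neg, ← Finset.sum_sub_distrib]
  refine Finset.sum_congr rfl fun k _ => ?_
  have h1 : ∀ W, rhoHat y W (c, k, 0) = jump y k (spinorComp y c W.2) := fun _ => rfl
  have h2 : ∀ W, rhoHat y W (c, k, 1) = -jump y k (spinorComp y c W.1) := fun _ => rfl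
  have h3 : ∀ W, tauHat y W (c, k, 0) = mean y k (spinorComp y c W.1) := fun _ => rfl
  have h4 : ∀ W, tauHat y W (c, k, 1) = mean y k (spinorComp y c W.2) := fun _ => rfl
  simp only [Fin.sum_univ_two, h1, h2, h3, h4, RCLike.inner_apply, map_neg]
  ring

/-- The crossed conditions are given by a couple `(Π, Θ)` in `ℂ⁴ⁿ`, because they are
Lagrangian. -/
theorem exists_boundaryCond_eq_crossedCond (hy : StrictMono y)
    {M₁ M₂ : Submodule ℂ (H1 (cutLine y))}
    (h₁ : ∀ f, f ∈ M₁ ↔ ∀ g ∈ M₂, greenForm (weakDeriv (cutLine y)) g f = 0)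
    (h₂ : ∀ g, g ∈ M₂ ↔ ∀ f ∈ M₁, greenForm (weakDeriv (cutLine y)) f g = 0) :
    ∃ b : BoundaryPair (EuclideanSpace ℂ (Fin 2 × Fin n × Fin 2)),
      boundaryCond (rhoHat y) (tauHat y) b = crossedCond M₁ M₂ := by
  refine exists_boundaryCond_eq fun Z => ?_
  simp only [inner_rhoHat_tauHat_sub hy, Fin.sum_univ_two]
  have hz : ∀ f, greenForm (weakDeriv (cutLine y)) 0 f = 0 := fun f => by
    simp [greenForm, LinearPMap.map_zero]
  constructor
  · intro hZ X hX
    obtain ⟨⟨a1, a2⟩, a3, a4⟩ := mem_crossedCond.1 hZ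
    obtain ⟨⟨b1, b2⟩, b3, b4⟩ := mem_crossedCond.1 hX
    rw [(h₂ _).1 a2 _ b1, (h₁ _).1 a1 _ b2, (h₁ _).1 a4 _ b3, (h₂ _).1 a3 _ b4]
    ring
  · intro h
    -- test against pairs with a single component
    let mk : H1 (cutLine y) → H1 (cutLine y) → (spinorDeriv y).domain := fun f g =>
      ⟨WithLp.toLp 2 (f, g), f.2, g.2⟩
    have hmk0 : ∀ f g, spinorComp y 0 (mk f g) = f := fun _ _ => rfl
    have hmk1 : ∀ f g, spinorComp y 1 (mk f g) = g := fun _ _ => rfl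
    refine ⟨⟨(h₁ _).2 fun g hg => ?_, (h₂ _).2 fun f hf => ?_⟩,
      (h₂ _).2 fun f hf => ?_, (h₁ _).2 fun g hg => ?_⟩
    · have := h (mk 0 0, mk g 0) ⟨⟨M₁.zero_mem, hg⟩, M₂.zero_mem, M₁.zero_mem⟩
      simpa [hmk0, hmk1, hz] using this
    · have := h (mk f 0, mk 0 0) ⟨⟨hf, M₂.zero_mem⟩, M₂.zero_mem, M₁.zero_mem⟩
      simpa [hmk0, hmk1, hz] using this
    · have := h (mk 0 0, mk 0 f) ⟨⟨M₁.zero_mem, M₂.zero_mem⟩, M₂.zero_mem, hf⟩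
      simpa [hmk0, hmk1, hz] using this
    · have := h (mk 0 g, mk 0 0) ⟨⟨M₁.zero_mem, M₂.zero_mem⟩, hg, M₁.zero_mem⟩
      simpa [hmk0, hmk1, hz] using this

theorem schrodinger_crossedCond (M₁ M₂ : Submodule ℂ (H1 (cutLine y))) :
    schrodinger (spinorDeriv y) (crossedCond M₁ M₂) =
      opSum (schrodinger (weakDeriv (cutLine y)) (M₁.prod M₂))
        (schrodinger (weakDeriv (cutLine y)) (M₂.prod M₁)) := by
  refine LinearPMap.ext (Submodule.ext fun Ψ => ?_) fun Ψ _ _ => rfl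
  constructor
  · intro h
    obtain ⟨k1, k2, ⟨m1, m2⟩, m3, m4⟩ := mem_schrodinger_domain.1 h
    exact ⟨mem_schrodinger_domain.2 ⟨k1.1, k2.1, m1, m2⟩,
      mem_schrodinger_domain.2 ⟨k1.2, k2.2, m3, m4⟩⟩
  · rintro ⟨h, h'⟩
    obtain ⟨k1, k2, m1, m2⟩ := mem_schrodinger_domain.1 h
    obtain ⟨k1', k2', m3, m4⟩ := mem_schrodinger_domain.1 h'
    exact mem_schrodinger_domain.2 ⟨⟨k1, k1'⟩, ⟨k2, k2'⟩, ⟨m1, m2⟩, m3, m4⟩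

theorem opAddConst_opSum {𝓗 : Type*} [NormedAddCommGroup 𝓗] [InnerProductSpace ℂ 𝓗]
    (A B : 𝓗 →ₗ.[ℂ] 𝓗) (c : ℂ) :
    opAddConst (opSum A B) c = opSum (opAddConst A c) (opAddConst B c) := rfl

end Line

/-! ### The eye graph -/

section Eye

theorem eyePi_apply (v : EuclideanSpace ℂ (Fin 3 × Fin 2)) (q : Fin 3 × Fin 2) :
    eyePi v q = (![![(2 * v (0, 0) - v (1, 0) - v (2, 0)) / 3, 0],
      ![(2 * v (1, 0) - v (0, 0) - v (2, 0)) / 3, v (1, 1)],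
      ![(2 * v (2, 0) - v (0, 0) - v (1, 0)) / 3, 0]] : Fin 3 → Fin 2 → ℂ) q.1 q.2 := by
  obtain ⟨k, j⟩ := q
  change ∑ x, eyePiMatrix (k, j) x * v x = _
  fin_cases k <;> fin_cases j <;>
  · simp [Fintype.sum_prod_type, Fin.sum_univ_three, Fin.sum_univ_two, eyePiMatrix, finProdFinEquiv]
    try ring

theorem eyeTheta_apply (v : EuclideanSpace ℂ (Fin 3 × Fin 2)) (q : Fin 3 × Fin 2) :
    eyeTheta v q = (![![-(Complex.I / 2) * v (1, 1), 0],
      ![0, Complex.I / 2 * (v (0, 0) - v (2, 0))],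
      ![Complex.I / 2 * v (1, 1), 0]] : Fin 3 → Fin 2 → ℂ) q.1 q.2 := by
  obtain ⟨k, j⟩ := q
  change ∑ x, eyeThetaMatrix (k, j) x * v x = _
  fin_cases k <;> fin_cases j <;>
  · simp [Fintype.sum_prod_type, Fin.sum_univ_three, Fin.sum_univ_two, eyeThetaMatrix,
      finProdFinEquiv]
    try ring

theorem eyePi_eq_self_iff (v : EuclideanSpace ℂ (Fin 3 × Fin 2)) :
    eyePi v = v ↔ v (0, 1) = 0 ∧ v (2, 1) = 0 ∧ v (0, 0) + v (1, 0) + v (2, 0) = 0 := by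
  constructor
  · intro h
    have e : ∀ q, eyePi v q = v q := fun q => by rw [h]
    have e00 := e (0, 0)
    have e01 := e (0, 1)
    have e21 := e (2, 1)
    simp [eyePi_apply] at e00 e01 e21
    exact ⟨e01.symm, e21.symm, by linear_combination -3 * e00⟩
  · rintro ⟨h1, h2, h3⟩
    ext ⟨k, j⟩
    rw [eyePi_apply]
    fin_cases k <;> fin_cases j <;> simp [h1, h2]
    · linear_combination -h3 / 3
    · linear_combination -h3 / 3
    · linear_combination -h3 / 3

theorem isSymmetricProjection_eyePi : eyePi.IsSymmetricProjection := by
  refine ⟨LinearMap.ext fun v => (eyePi_eq_self_iff _).2 ?_, fun v w => ?_⟩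
  · simp only [eyePi_apply]
    simp
    ring
  · simp [PiLp.inner_apply, Fintype.sum_prod_type, Fin.sum_univ_three, Fin.sum_univ_two,
      eyePi_apply, Complex.conj_ofNat]
    ring

theorem mem_range_eyePi {v : EuclideanSpace ℂ (Fin 3 × Fin 2)} :
    v ∈ LinearMap.range eyePi ↔
      v (0, 1) = 0 ∧ v (2, 1) = 0 ∧ v (0, 0) + v (1, 0) + v (2, 0) = 0 := by
  rw [← eyePi_eq_self_iff]
  exact LinearMap.IsIdempotentElem.mem_range_iff isSymmetricProjection_eyePi.1

theorem eyeTheta_mem_range (v : EuclideanSpace ℂ (Fin 3 × Fin 2)) :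
    eyeTheta v ∈ LinearMap.range eyePi := by
  rw [mem_range_eyePi]
  simp [eyeTheta_apply]

/-- The pair `(Π, Θ)` of the eye graph. -/
noncomputable def eyePair : BoundaryPair (EuclideanSpace ℂ (Fin 3 × Fin 2)) where
  proj := eyePi
  isSymmetricProjection := isSymmetricProjection_eyePi
  op := eyeTheta.restrict fun v _ => eyeTheta_mem_range v
  isSymmetric := fun v w => by
    change inner ℂ (eyeTheta v) (w : EuclideanSpace ℂ (Fin 3 × Fin 2)) =
      inner ℂ (v : EuclideanSpace ℂ (Fin 3 × Fin 2)) (eyeTheta w)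
    simp [PiLp.inner_apply, Fintype.sum_prod_type, Fin.sum_univ_three, Fin.sum_univ_two,
      eyeTheta_apply, Complex.conj_ofNat]
    ring

/-- The rows of `Π τ Ψ = Θ ρ Ψ`, together with `ρ Ψ ∈ ran Π`, are linear combinations of the six
vertex conditions, and conversely. -/
theorem boundaryCond_eyePair (y : Fin 3 → ℝ) :
    boundaryCond (rho y) (tau y) eyePair = (eyeCont y).prod (eyeFlux y) := by
  have hI : ∀ {z : ℂ}, Complex.I * z = 0 → z = 0 := fun h =>
    (mul_eq_zero.1 h).resolve_left Complex.I_ne_zero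
  refine Submodule.ext fun ⟨f, g⟩ => ⟨fun ⟨h, e⟩ => ?_, fun ⟨⟨⟨a1, a2⟩, a3, a4⟩, b1, b2⟩ => ?_⟩
  · obtain ⟨h1, h2, h3⟩ := mem_range_eyePi.1 h
    have e : ∀ q, eyePi (tau y (f, g)) q = eyeTheta (rho y (f, g)) q := fun q => by
      exact congrArg (fun v : EuclideanSpace ℂ (Fin 3 × Fin 2) => v q) e
    have e00 := e (0, 0)
    have e10 := e (1, 0)
    have e20 := e (2, 0)
    have e11 := e (1, 1)
    simp only [eyePi_apply, eyeTheta_apply, rho_apply_zero, rho_apply_one, tau_apply_zero,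
      tau_apply_one, jump_apply, mean_apply, Matrix.cons_val] at h1 h2 h3 e00 e10 e20 e11
    have k1 := hI h1
    have k2 := hI h2
    have k3 := hI (z := jump y 0 g + jump y 1 g + jump y 2 g)
      (by simp only [jump_apply]; linear_combination h3)
    simp only [jump_apply] at k3
    refine ⟨⟨⟨?_, ?_⟩, ?_, ?_⟩, ?_, ?_⟩
    · linear_combination -k1
    · linear_combination e00 - e10 + k1 / 2 - (valR y 1 f - valL y 1 f) / 2 * Complex.I_mul_I
    · linear_combination e10 - e20 + k2 / 2 - (valR y 1 f - valL y 1 f) / 2 * Complex.I_mul_I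
    · linear_combination -k2
    · linear_combination -e11 - k3 / 2 - ((valR y 0 g - valL y 0 g) -
        (valR y 2 g - valL y 2 g)) / 2 * Complex.I_mul_I
    · linear_combination e11 - k3 / 2 + ((valR y 0 g - valL y 0 g) -
        (valR y 2 g - valL y 2 g)) / 2 * Complex.I_mul_I
  · have h : rho y (f, g) ∈ LinearMap.range eyePi := by
      rw [mem_range_eyePi]
      simp only [rho_apply_zero, rho_apply_one, jump_apply]
      refine ⟨?_, ?_, ?_⟩
      · linear_combination -Complex.I * a1
      · linear_combination -Complex.I * a4
      · linear_combination -Complex.I * (b1 + b2)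
    refine ⟨h, PiLp.ext fun ⟨k, j⟩ => ?_⟩
    change eyePi (tau y (f, g)) (k, j) = eyeTheta (rho y (f, g)) (k, j)
    rw [eyePi_apply, eyeTheta_apply]
    simp only [rho_apply_zero, rho_apply_one, tau_apply_zero, tau_apply_one, jump_apply, mean_apply]
    fin_cases k <;> fin_cases j <;> simp only [Fin.zero_eta, Fin.mk_one, Fin.reduceFinMk,
      Matrix.cons_val]
    · linear_combination a1 / 3 + 2 / 3 * a2 + a3 / 3 + a4 / 6 +
        (valR y 1 f - valL y 1 f) / 2 * Complex.I_mul_I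
    · linear_combination -a1 / 6 - a2 / 3 + a3 / 3 + a4 / 6
    · linear_combination (b2 - b1) / 2 - ((valR y 0 g - valL y 0 g) -
        (valR y 2 g - valL y 2 g)) / 2 * Complex.I_mul_I
    · linear_combination -a1 / 6 - a2 / 3 - 2 / 3 * a3 - a4 / 3 -
        (valR y 1 f - valL y 1 f) / 2 * Complex.I_mul_I

end Eye

/-! ### Finite metric graphs -/

namespace MetricGraph

variable {E V : Type*} (G : MetricGraph E V)

theorem lo_not_mem_edge (e : E) (h : G.lo e ≠ ⊥) : (G.lo e).toReal ∉ G.edge e := fun h' => by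
  have h1 : G.lo e < ((G.lo e).toReal : EReal) := h'.1
  rw [EReal.coe_toReal (ne_top_of_lt (G.lo_lt_hi e)) h] at h1
  exact h1.false

theorem hi_not_mem_edge (e : E) (h : G.hi e ≠ ⊤) : (G.hi e).toReal ∉ G.edge e := fun h' => by
  have h1 : ((G.hi e).toReal : EReal) < G.hi e := h'.2
  rw [EReal.coe_toReal h (ne_bot_of_gt (G.lo_lt_hi e))] at h1
  exact h1.false

open Classical in
/-- Integration by parts on an edge. -/
theorem greenForm_edge (e : E) (f g : H1 (G.edge e)) :
    greenForm (weakDeriv (G.edge e)) f g =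
      (if G.hi e ≠ ⊤ then inner ℂ (leftLim (f : QGraph.L2 (G.edge e)) (G.hi e).toReal)
        (leftLim (g : QGraph.L2 (G.edge e)) (G.hi e).toReal) else 0) -
      (if G.lo e ≠ ⊥ then inner ℂ (rightLim (f : QGraph.L2 (G.edge e)) (G.lo e).toReal)
        (rightLim (g : QGraph.L2 (G.edge e)) (G.lo e).toReal) else 0) := by
  have hmem : ∀ x : ℝ, x ∈ (G.edge e : Set ℝ) ↔ G.lo e < x ∧ (x : EReal) < G.hi e :=
    fun x => Iff.rfl
  have hi := integrableOn_greenDensity f g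
  rw [greenForm_weakDeriv]
  generalize hlo : G.lo e = lo at hmem
  generalize hhi : G.hi e = hi' at hmem
  have hlt : lo < hi' := hlo ▸ hhi ▸ G.lo_lt_hi e
  have key : ∀ s : Set ℝ, (G.edge e : Set ℝ) = s →
      ∫ x in (G.edge e : Set ℝ), greenDensity f g x = ∫ x in s, greenDensity f g x :=
    fun s hs => by rw [hs]
  induction lo with
  | bot =>
    rw [if_neg (not_not.2 rfl : ¬((⊥ : EReal) ≠ ⊥)), sub_zero]
    induction hi' with
    | bot => exact absurd hlt (lt_irrefl _)
    | coe b =>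
      have hs : (G.edge e : Set ℝ) = Set.Iio b := Set.ext fun x => by simp [hmem]
      rw [key _ hs, if_pos (EReal.coe_ne_top b), EReal.toReal_coe, ← integral_Iic_eq_integral_Iio,
        integral_greenDensity_Iic f g hs.ge]
    | top =>
      have hs : (G.edge e : Set ℝ) = Set.univ := Set.ext fun x => by simp [hmem]
      have hq : Integrable (greenDensity f g) := by rwa [hs, integrableOn_univ] at hi
      have h0 : (0 : ℝ) ∈ G.edge e := hs.ge (Set.mem_univ _)
      rw [key _ hs, if_neg (not_not.2 rfl : ¬((⊤ : EReal) ≠ ⊤)), setIntegral_univ,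
        ← integral_add_compl (measurableSet_Iic (a := (0 : ℝ))) hq, Set.compl_Iic,
        integral_greenDensity_Iic f g ((Set.subset_univ _).trans hs.ge),
        integral_greenDensity_Ioi f g ((Set.subset_univ _).trans hs.ge),
        leftLim_eq_rightLim f h0, leftLim_eq_rightLim g h0, add_neg_cancel]
  | coe a =>
    rw [if_pos (by simp : ((a : ℝ) : EReal) ≠ ⊥), EReal.toReal_coe]
    induction hi' with
    | bot => exact absurd hlt not_lt_bot
    | coe b =>
      have hs : (G.edge e : Set ℝ) = Set.Ioo a b := Set.ext fun x => by simp [hmem]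
      have hab : a < b := EReal.coe_lt_coe_iff.1 hlt
      rw [key _ hs, if_pos (EReal.coe_ne_top b), EReal.toReal_coe, ← integral_Ioc_eq_integral_Ioo,
        ← intervalIntegral.integral_of_le hab.le, integral_greenDensity f g hab hs.ge]
    | top =>
      have hs : (G.edge e : Set ℝ) = Set.Ioi a := Set.ext fun x => by simp [hmem]
      rw [key _ hs, if_neg (not_not.2 rfl : ¬((⊤ : EReal) ≠ ⊤)),
        integral_greenDensity_Ioi f g hs.ge, zero_sub]
  | top => exact absurd hlt not_top_lt

/-- The boundary values of a function in `H¹` of an edge can be prescribed. -/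
theorem exists_edge_val_eq (e : E) (a b : ℂ) : ∃ f : H1 (G.edge e),
    (G.lo e ≠ ⊥ → rightLim (f : QGraph.L2 (G.edge e)) (G.lo e).toReal = a) ∧
    (G.hi e ≠ ⊤ → leftLim (f : QGraph.L2 (G.edge e)) (G.hi e).toReal = b) := by
  obtain ⟨ε, hε, h⟩ : ∃ ε > 0, G.lo e ≠ ⊥ → G.hi e ≠ ⊤ →
      ε ≤ |(G.hi e).toReal - (G.lo e).toReal| := by
    by_cases h : G.lo e ≠ ⊥ ∧ G.hi e ≠ ⊤
    · refine ⟨_, abs_pos.2 (sub_pos.2 ?_).ne', fun _ _ => le_rfl⟩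
      rw [← EReal.coe_lt_coe_iff, EReal.coe_toReal (ne_top_of_lt (G.lo_lt_hi e)) h.1,
        EReal.coe_toReal h.2 (ne_bot_of_gt (G.lo_lt_hi e))]
      exact G.lo_lt_hi e
    · exact ⟨1, one_pos, fun h1 h2 => absurd ⟨h1, h2⟩ h⟩
  have hL : ∃ f : H1 (G.edge e),
      (G.lo e ≠ ⊥ → rightLim (f : QGraph.L2 (G.edge e)) (G.lo e).toReal = 1) ∧
      (G.hi e ≠ ⊤ → leftLim (f : QGraph.L2 (G.edge e)) (G.hi e).toReal = 0) := by
    by_cases hlo : G.lo e = ⊥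
    · refine ⟨0, fun h => absurd hlo h, fun h => ?_⟩
      exact map_zero (leftTrace _ _ (G.edge_mem_left e h))
    · obtain ⟨F, h1, -, h3⟩ := exists_rightLim_eq_one (G.lo_not_mem_edge e hlo)
        (G.edge_mem_right e hlo) hε
      exact ⟨F, fun _ => h1, fun hhi => h3 _ (Or.inr (h hlo hhi)) (G.edge_mem_left e hhi)⟩
  have hR : ∃ f : H1 (G.edge e),
      (G.lo e ≠ ⊥ → rightLim (f : QGraph.L2 (G.edge e)) (G.lo e).toReal = 0) ∧
      (G.hi e ≠ ⊤ → leftLim (f : QGraph.L2 (G.edge e)) (G.hi e).toReal = 1) := by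
    by_cases hhi : G.hi e = ⊤
    · refine ⟨0, fun h => ?_, fun h => absurd hhi h⟩
      exact map_zero (rightTrace _ _ (G.edge_mem_right e h))
    · obtain ⟨F, h1, -, h3⟩ := exists_leftLim_eq_one (G.hi_not_mem_edge e hhi)
        (G.edge_mem_left e hhi) hε
      exact ⟨F, fun hlo => h3 _ (Or.inr (by rw [abs_sub_comm]; exact h hlo hhi))
        (G.edge_mem_right e hlo), fun _ => h1⟩
  obtain ⟨L, hL1, hL2⟩ := hL
  obtain ⟨R, hR1, hR2⟩ := hR
  refine ⟨a • L + b • R, fun h => ?_, fun h => ?_⟩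
  · have := map_add (rightTrace _ _ (G.edge_mem_right e h)) (a • L) (b • R)
    rw [map_smul, map_smul] at this
    refine this.trans ?_
    change a * rightLim _ _ + b * rightLim _ _ = a
    rw [hL1 h, hR1 h, mul_one, mul_zero, add_zero]
  · have := map_add (leftTrace _ _ (G.edge_mem_left e h)) (a • L) (b • R)
    rw [map_smul, map_smul] at this
    refine this.trans ?_
    change a * leftLim _ _ + b * leftLim _ _ = b
    rw [hL2 h, hR2 h, mul_one, mul_zero, zero_add]

theorem exists_val_eq (a : G.Endpoint → ℂ) : ∃ f : G.deriv.domain, ∀ p, G.val p f = a p := by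
  classical
  choose F hF1 hF2 using fun e => G.exists_edge_val_eq e
    (if h : G.lo e ≠ ⊥ then a (Sum.inl ⟨e, h⟩) else 0)
    (if h : G.hi e ≠ ⊤ then a (Sum.inr ⟨e, h⟩) else 0)
  refine ⟨⟨WithLp.toLp 2 fun e => (F e : QGraph.L2 (G.edge e)), fun e => (F e).2⟩, ?_⟩
  rintro (⟨e, h⟩ | ⟨e, h⟩)
  · exact (hF1 e h).trans (dif_pos h)
  · exact (hF2 e h).trans (dif_pos h)

variable [Fintype E]

open Classical in
/-- Integration by parts on a graph. -/
theorem greenForm_deriv (f g : G.deriv.domain) :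
    greenForm G.deriv f g = ∑ p, G.sign p * inner ℂ (G.val p f) (G.val p g) := by
  have h1 : greenForm G.deriv f g =
      ∑ e, greenForm (weakDeriv (G.edge e)) (G.restr e f) (G.restr e g) := by
    rw [greenForm, PiLp.inner_apply, PiLp.inner_apply, ← Finset.sum_add_distrib]
    rfl
  have h2 : ∀ (P : E → Prop) [DecidablePred P] [Fintype {e // P e}] (F : E → ℂ),
      ∑ e, (if P e then F e else 0) = ∑ e : {e // P e}, F e := fun P _ _ F => by
    rw [← Finset.sum_filter, ← Finset.sum_subtype_eq_sum_filter]
    exact Finset.sum_congr (by ext; simp) fun _ _ => rfl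
  rw [h1, Fintype.sum_sum_type]
  simp only [greenForm_edge]
  rw [Finset.sum_sub_distrib, h2 fun e => G.hi e ≠ ⊤, h2 fun e => G.lo e ≠ ⊥, sub_eq_neg_add,
    ← Finset.sum_neg_distrib]
  refine congrArg₂ (· + ·) (Finset.sum_congr rfl fun e _ => ?_) (Finset.sum_congr rfl fun e _ => ?_)
  · exact (neg_one_mul _).symm
  · exact (one_mul _).symm

theorem greenForm_conj {𝓗 : Type*} [NormedAddCommGroup 𝓗] [InnerProductSpace ℂ 𝓗]
    (d : 𝓗 →ₗ.[ℂ] 𝓗) (f g : d.domain) :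
    (starRingEnd ℂ) (greenForm d f g) = greenForm d g f := by
  rw [greenForm, greenForm, map_add, inner_conj_symm, inner_conj_symm, add_comm]

/-- Continuous functions and functions with vanishing signed sums annihilate each other in the
boundary form: at each vertex the common value can be factored out. -/
theorem greenForm_cont_flux {f g : G.deriv.domain} (hf : f ∈ G.cont) (hg : g ∈ G.flux) :
    greenForm G.deriv f g = 0 := by
  classical
  rw [greenForm_deriv, ← Finset.sum_fiberwise_of_maps_to (t := Finset.univ.image G.vert)
    (g := G.vert) fun p _ => Finset.mem_image_of_mem _ (Finset.mem_univ p)]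
  refine Finset.sum_eq_zero fun v hv => ?_
  obtain ⟨p₀, -, rfl⟩ := Finset.mem_image.1 hv
  rw [← mul_zero ((starRingEnd ℂ) (G.val p₀ f)), ← hg (G.vert p₀), Finset.mul_sum]
  refine Finset.sum_congr rfl fun p hp => ?_
  rw [hf p p₀ (Finset.mem_filter.1 hp).2, RCLike.inner_apply]
  ring

/-- The Kirchhoff conditions are Lagrangian. -/
theorem mem_cont_prod_flux_iff (q : G.deriv.domain × G.deriv.domain) :
    q ∈ G.cont.prod G.flux ↔ ∀ p ∈ G.cont.prod G.flux,
      greenForm G.deriv p.1 q.2 + greenForm G.deriv p.2 q.1 = 0 := by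
  classical
  have hz : ∀ f, greenForm G.deriv 0 f = 0 := fun f => by
    simp [greenForm, LinearPMap.map_zero]
  have hsign : ∀ p, G.sign p * G.sign p = 1 := by rintro (p | p) <;> simp [sign]
  have hsign' : ∀ p, (starRingEnd ℂ) (G.sign p) = G.sign p := by rintro (p | p) <;> simp [sign]
  constructor
  · rintro ⟨h1, h2⟩ p ⟨h3, h4⟩
    rw [G.greenForm_cont_flux h3 h2, ← greenForm_conj, G.greenForm_cont_flux h1 h4, map_zero,
      add_zero]
  · intro h
    constructor
    · intro p₁ p₂ hp
      -- test against the function with flux concentrated at two endpoints of the same vertex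
      obtain ⟨f, hf⟩ := G.exists_val_eq fun p => G.sign p *
        ((if p = p₁ then 1 else 0) - (if p = p₂ then 1 else 0))
      have hff : f ∈ G.flux := fun v => by
        simp only [hf, ← mul_assoc, hsign, one_mul, Finset.sum_sub_distrib, Finset.sum_ite_eq',
          Finset.mem_filter, Finset.mem_univ, true_and, hp, sub_self]
      have := h (0, f) ⟨G.cont.zero_mem, hff⟩
      rw [hz, zero_add, greenForm_deriv] at this
      have e : ∀ p, G.sign p * inner ℂ (G.val p f) (G.val p q.1) =
          (if p = p₁ then G.val p q.1 else 0) - (if p = p₂ then G.val p q.1 else 0) := fun p => by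
        rw [hf, RCLike.inner_apply, map_mul, hsign', mul_left_comm, ← mul_assoc (G.sign p), hsign]
        split_ifs <;> simp
      simp only [e, Finset.sum_sub_distrib, Finset.sum_ite_eq', Finset.mem_univ, if_true] at this
      exact sub_eq_zero.1 this
    · intro v
      -- test against a function that equals one at a single vertex
      obtain ⟨f, hf⟩ := G.exists_val_eq fun p => if G.vert p = v then 1 else 0
      have hfc : f ∈ G.cont := fun p₁ p₂ hp => by rw [hf, hf, hp]
      have := h (f, 0) ⟨hfc, G.flux.zero_mem⟩
      rw [hz, add_zero, greenForm_deriv] at this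
      refine (Finset.sum_filter _ _).trans ((Finset.sum_congr rfl fun p _ => ?_).trans this)
      rw [hf, RCLike.inner_apply]
      by_cases hp : G.vert p = v
      · rw [if_pos hp, if_pos hp, map_one, mul_one]
      · rw [if_neg hp, if_neg hp, map_zero, mul_zero, mul_zero]

theorem isSelfAdjoint_diracK : IsSelfAdjoint G.diracK := by
  classical
  refine isSelfAdjoint_dirac (N := {f | ∀ e, G.restr e f ∈ zeroTrace (G.edge e)})
    (fun v w h => ?_) (fun f hf => ?_) G.mem_cont_prod_flux_iff
  · have key : ∀ e, ∃ hv : v e ∈ H1 (G.edge e), weakDeriv (G.edge e) ⟨v e, hv⟩ = w e := fun e => by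
      refine exists_weakDeriv_eq fun F hF => ?_
      -- extension by zero to the other edges
      let Fe : ∀ e', H1 (G.edge e') := Pi.single (M := fun e' => H1 (G.edge e')) e F
      have := h ⟨WithLp.toLp 2 fun e' => (Fe e' : QGraph.L2 (G.edge e')), fun e' => (Fe e').2⟩
        fun e' => by
          change Fe e' ∈ zeroTrace (G.edge e')
          by_cases he : e' = e
          · subst he
            simpa [Fe] using hF
          · have : Fe e' = 0 := Pi.single_eq_of_ne (M := fun e' => H1 (G.edge e')) he F
            rw [this]
            exact fun z _ => ⟨fun hU => map_zero (rightTrace _ z hU),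
              fun hU => map_zero (leftTrace _ z hU)⟩
      rw [PiLp.inner_apply, PiLp.inner_apply] at this
      change ∑ e', inner ℂ (Fe e' : QGraph.L2 (G.edge e')) (w e') =
        -∑ e', inner ℂ (weakDeriv (G.edge e') (Fe e')) (v e') at this
      rw [Finset.sum_eq_single e, Finset.sum_eq_single e] at this
      · simpa [Fe] using this
      · intro e' _ he
        have : Fe e' = 0 := Pi.single_eq_of_ne (M := fun e' => H1 (G.edge e')) he F
        rw [this, LinearPMap.map_zero, inner_zero_left]
      · simp
      · intro e' _ he
        have : Fe e' = 0 := Pi.single_eq_of_ne (M := fun e' => H1 (G.edge e')) he F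
        rw [this, ZeroMemClass.coe_zero, inner_zero_left]
      · simp
    choose hv hvw using key
    exact ⟨hv, PiLp.ext hvw⟩
  · have hval : ∀ p, G.val p f = 0 := by
      rintro (⟨e, h⟩ | ⟨e, h⟩)
      · exact (hf e _ (G.lo_not_mem_edge e h)).1 (G.edge_mem_right e h)
      · exact (hf e _ (G.hi_not_mem_edge e h)).2 (G.edge_mem_left e h)
    refine ⟨⟨fun p q _ => by rw [hval, hval], G.flux.zero_mem⟩,
      G.cont.zero_mem, fun v => Finset.sum_eq_zero fun p _ => by rw [hval, mul_zero]⟩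

end MetricGraph

end QGraph

theorem mainTheorem8 :
    -- decoupled boundary conditions on the line with points `y₁ < ... < yₙ`
    (∀ (n : ℕ) (y : Fin n → ℝ), StrictMono y →
      ∀ (b : QGraph.BoundaryPair (EuclideanSpace ℂ (Fin n × Fin 2)))
        (d₁ d₂ : ℕ) (B₁ : QGraph.H1 (QGraph.cutLine y) →ₗ[ℂ] EuclideanSpace ℂ (Fin d₁))
        (B₂ : QGraph.H1 (QGraph.cutLine y) →ₗ[ℂ] EuclideanSpace ℂ (Fin d₂)),
        (∀ ψ₁ ψ₂ : QGraph.H1 (QGraph.cutLine y),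
          (∃ h : QGraph.rho y (ψ₁, ψ₂) ∈ LinearMap.range b.proj,
            b.proj (QGraph.tau y (ψ₁, ψ₂)) = b.op ⟨QGraph.rho y (ψ₁, ψ₂), h⟩) ↔
          (B₁ ψ₁ = 0 ∧ B₂ ψ₂ = 0)) →
        IsSelfAdjoint (QGraph.diracPT y b) ∧
        IsSelfAdjoint (QGraph.schrodingerB y B₁ B₂) ∧
        IsSelfAdjoint (QGraph.schrodingerB y B₂ B₁) ∧
        QGraph.opComp (QGraph.diracPT y b) (QGraph.diracPT y b) =
          QGraph.opSum (QGraph.opAddConst (QGraph.schrodingerB y B₁ B₂) (1 / 4))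
            (QGraph.opAddConst (QGraph.schrodingerB y B₂ B₁) (1 / 4)) ∧
        ∃ b' : QGraph.BoundaryPair (EuclideanSpace ℂ (Fin 2 × Fin n × Fin 2)),
          QGraph.opComp (QGraph.diracPT y b) (QGraph.diracPT y b) =
            QGraph.opAddConst (QGraph.schrodingerPT y b') (1 / 4) ∧
          QGraph.schrodingerPT y b' =
            QGraph.opSum (QGraph.schrodingerB y B₁ B₂) (QGraph.schrodingerB y B₂ B₁)) ∧
    -- the eye graph
    (∀ y : Fin 3 → ℝ, StrictMono y →
      (∃ b : QGraph.BoundaryPair (EuclideanSpace ℂ (Fin 3 × Fin 2)),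
        b.proj = QGraph.eyePi ∧
        (∀ v : LinearMap.range b.proj,
          (b.op v : EuclideanSpace ℂ (Fin 3 × Fin 2)) = QGraph.eyeTheta v) ∧
        QGraph.eyeDirac y = QGraph.diracPT y b) ∧
      IsSelfAdjoint (QGraph.eyeDirac y) ∧
      IsSelfAdjoint (QGraph.eyeSchrodingerK y) ∧
      IsSelfAdjoint (QGraph.eyeSchrodingerKstar y) ∧
      QGraph.opComp (QGraph.eyeDirac y) (QGraph.eyeDirac y) =
        QGraph.opSum (QGraph.opAddConst (QGraph.eyeSchrodingerK y) (1 / 4))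
          (QGraph.opAddConst (QGraph.eyeSchrodingerKstar y) (1 / 4))) ∧
    -- any finite metric graph
    (∀ (E V : Type*) [Fintype E] (G : QGraph.MetricGraph E V),
      IsSelfAdjoint G.diracK ∧
      IsSelfAdjoint G.schrodingerK ∧
      IsSelfAdjoint G.schrodingerKstar ∧
      QGraph.opComp G.diracK G.diracK =
        QGraph.opSum (QGraph.opAddConst G.schrodingerK (1 / 4))
          (QGraph.opAddConst G.schrodingerKstar (1 / 4))) := by
  refine ⟨fun n y hy b d₁ d₂ B₁ B₂ hB => ?_, fun y hy => ?_, fun E V _ G => ?_⟩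
  · have hC : QGraph.boundaryCond (QGraph.rho y) (QGraph.tau y) b =
        (LinearMap.ker B₁).prod (LinearMap.ker B₂) :=
      Submodule.ext fun Ψ => hB Ψ.1 Ψ.2
    have hD := QGraph.isSelfAdjoint_diracPT hy b
    have e : QGraph.diracPT y b = QGraph.dirac (QGraph.weakDeriv (QGraph.cutLine y))
        ((LinearMap.ker B₁).prod (LinearMap.ker B₂)) := by
      rw [QGraph.diracPT, hC]
    rw [e] at hD ⊢
    have hS := QGraph.isSelfAdjoint_schrodinger_of_dirac hD
    have hsq := QGraph.opComp_dirac_prod (d := QGraph.weakDeriv (QGraph.cutLine y))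
      (LinearMap.ker B₁) (LinearMap.ker B₂)
    obtain ⟨h₁, h₂⟩ := QGraph.mem_iff_of_boundaryCond_eq_prod hy hC
    obtain ⟨b', hb'⟩ := QGraph.exists_boundaryCond_eq_crossedCond hy h₁ h₂
    have hH : QGraph.schrodingerPT y b' =
        QGraph.opSum (QGraph.schrodingerB y B₁ B₂) (QGraph.schrodingerB y B₂ B₁) := by
      rw [QGraph.schrodingerPT, hb', QGraph.schrodinger_crossedCond]
      rfl
    exact ⟨hD, hS.1, hS.2, hsq, b', by rw [hH, QGraph.opAddConst_opSum]; exact hsq, hH⟩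
  · have e : QGraph.eyeDirac y = QGraph.diracPT y QGraph.eyePair := by
      rw [QGraph.diracPT, QGraph.boundaryCond_eyePair, QGraph.eyeDirac]
    have hD := QGraph.isSelfAdjoint_diracPT hy QGraph.eyePair
    rw [← e] at hD
    have hS := QGraph.isSelfAdjoint_schrodinger_of_dirac hD
    exact ⟨⟨QGraph.eyePair, rfl, fun v => rfl, e⟩, hD, hS.1, hS.2, QGraph.opComp_dirac_prod _ _⟩
  · have hD := G.isSelfAdjoint_diracK
    have hS := QGraph.isSelfAdjoint_schrodinger_of_dirac hD
    exact ⟨hD, hS.1, hS.2, QGraph.opComp_dirac_prod _ _⟩
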